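/- Let $\theta$ be an irrational real number, $q=e^{2\pi i\theta}$, and let $\tau\in\mathbb C$, $\tau\neq 0$. Let $\mathcal O(\mathbb C^*)$ be the algebra of holomorphic functions on $\mathbb C^*$, with the derivation $\delta=\tau z\frac{d}{dz}$ and the action $\alpha$ of the group $\theta\mathbb Z$ whose generator $\theta$ acts by $\alpha(f)(z)=f(qz)$. Let $\mathcal B_q^\tau$ be the category of triples $(M,\sigma,\nabla)$, where $M$ is a finitely presented $\mathcal O(\mathbb C^*)$-module, $\sigma$ is an action of $\theta\mathbb Z$ on $M$ with $\sigma(mf)=\sigma(m)\alpha(f)$, and $\nabla:M\to M$ is an additive map with $\nabla(mf)=\nabla(m)f+m\,\delta(f)$ and $\nabla\sigma=\sigma\nabla$, which is regular singular: $M$ has a module basis $e_1,\dots,e_n$ such that, if $\nabla(e_i)=\sum_j A_{ij}e_j$, every function $z^{-1}A_{ij}$ has at most a simple pole at $0$. Morphisms are the $\mathcal O(\mathbb C^*)$-linear maps commuting with $\sigma$ and $\nabla$. The tensor product is $(M\otimes_{\mathcal O(\mathbb C^*)}N,\ \sigma\otimes\sigma',\ \nabla\otimes 1+1\otimes\nabla')$,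 with unit object $(\mathcal O(\mathbb C^*),\alpha,\delta)$. Fix a point $z\in\mathbb C^*$, let $\mathcal O_z$ be the ring of germs at $z$ of holomorphic functions, and let $\omega(M,\sigma,\nabla)=(\ker\nabla)_z$ be the space of germs at $z$ of local solutions of $\nabla=0$, that is, the kernel of $\delta\otimes 1+1\otimes\nabla$ on $\mathcal O_z\otimes_{\mathcal O(\mathbb C^*)}M$. 1. $\mathcal B_q^\tau$ is a neutral Tannakian category over $\mathbb C$ with fibre functor $\omega$: it is a $\mathbb C$-linear abelian rigid symmetric tensor category with bilinear tensor product and $\operatorname{End}(1)=\mathbb C$, and $\omega$, with the canonical isomorphisms $\omega(M)\otimes_{\mathbb C}\omega(N)\cong\omega(M\otimes N)$, $x\otimes y\mapsto x\otimes y$, is a $\mathbb C$-linear, faithful, exact symmetric tensor functor with finite dimensional values. 2. $\mathcal B_q^\tau$ is equivalent, as a symmetric tensor category with fibre functor (that is, $\omega$ corresponds to the forgetful functor), to the category $\mathsf{Rep}(\mathbb Z+\theta\mathbb Z)$ of finite dimensional complex representations of the group $\mathbb Z+\theta\mathbb Z\subset\mathbb R$. Moreover $\mathbb Z+\theta\mathbb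 Z\cong\mathbb Z^2$, so $\mathcal B_q^\tau$ is equivalent in the same sense to $\mathsf{Rep}(\mathbb Z^2)$. It is also equivalent in the same sense to the category of finite dimensional representations of the algebraic hull of $\mathbb Z^2$, the affine group scheme over $\mathbb C$ whose coordinate ring is the Hopf algebra of representative functions on $\mathbb Z^2$ (functions whose translates span a finite dimensional space). -/

import Mathlib

open CategoryTheory MonoidalCategory TensorProduct

noncomputable section

namespace EquivariantRH

/-! ### Equivariant differential modules over an equivariant differential `ℂ`-algebra -/

/-- The derivation `δ` of the `ℂ`-algebra `R` commutes with the action `α` of `G` on `R`. -/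
class IsEquivariantDerivation {R G : Type} [CommRing R] [Algebra ℂ R] [Group G]
    (δ : Derivation ℂ R R) (α : G →* (R ≃ₐ[ℂ] R)) : Prop where
  comm : ∀ (g : G) (r : R), δ (α g r) = α g (δ r)

/-- `D` is a connection on the `R`-module `M` covering the derivation `δ` (Leibniz rule). -/
def IsConnection {R M : Type} [CommRing R] [Algebra ℂ R] [AddCommGroup M] [Module R M]
    (δ : Derivation ℂ R R) (D : M →+ M) : Prop :=
  ∀ (r : R) (m : M), D (r • m) = r • D m + δ r • m

section TensorConnection

variable {R M N : Type} [CommRing R] [Algebra ℂ R] [AddCommGroup M] [Module R M]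
  [AddCommGroup N] [Module R N] {δ : Derivation ℂ R R}

/-- The connection `D ⊗ 1 + 1 ⊗ D'` on `M ⊗ N`. -/
def tensorConnection {D : M →+ M} (hD : IsConnection δ D) {D' : N →+ N}
    (hD' : IsConnection δ D') : M ⊗[R] N →+ M ⊗[R] N :=
  TensorProduct.liftAddHom
    (AddMonoidHom.mk' (fun m => AddMonoidHom.mk' (fun n => D m ⊗ₜ[R] n + m ⊗ₜ[R] D' n)
        (fun n n' => by simp only [tmul_add, map_add]; abel))
      (fun m m' => by ext n; simp [add_tmul]; abel))
    (fun r m n => by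
      have h1 := hD r m
      have h2 := hD' r n
      simp [h1, h2, add_tmul, tmul_add, smul_tmul]
      abel)

@[simp]
theorem tensorConnection_tmul {D : M →+ M} (hD : IsConnection δ D) {D' : N →+ N}
    (hD' : IsConnection δ D') (m : M) (n : N) :
    tensorConnection hD hD' (m ⊗ₜ n) = D m ⊗ₜ[R] n + m ⊗ₜ[R] D' n := rfl

theorem isConnection_tensorConnection {D : M →+ M} (hD : IsConnection δ D) {D' : N →+ N}
    (hD' : IsConnection δ D') : IsConnection δ (tensorConnection hD hD') := by
  intro r x
  induction x with
  | zero => simp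
  | add x y hx hy => simp only [smul_add, map_add, hx, hy]; abel
  | tmul m n =>
    have h1 := hD r m
    simp only [smul_tmul', tensorConnection_tmul, h1, add_tmul, smul_add]
    abel

end TensorConnection

/-- A `G`-equivariant differential module over `(R, δ, α)`: an `R`-module with an action `σ` of `G`
covering `α` and a `G`-equivariant connection covering `δ`. -/
structure EqDiffMod {R G : Type} [CommRing R] [Algebra ℂ R] [Group G]
    (δ : Derivation ℂ R R) (α : G →* (R ≃ₐ[ℂ] R)) where
  carrier : Type
  [addCommGroup : AddCommGroup carrier]
  [module : Module R carrier]
  /-- the action of the group; `σ g` is semilinear with respect to `α g` -/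
  σ : ∀ g : G, carrier →ₛₗ[((α g : R ≃ₐ[ℂ] R) : R →+* R)] carrier
  σ_one : ∀ m, σ 1 m = m
  σ_mul : ∀ g h m, σ (g * h) m = σ g (σ h m)
  /-- the connection -/
  conn : carrier →+ carrier
  isConnection : IsConnection δ conn
  conn_σ : ∀ g m, conn (σ g m) = σ g (conn m)

namespace EqDiffMod

variable {R G : Type} [CommRing R] [Algebra ℂ R] [Group G]
  {δ : Derivation ℂ R R} {α : G →* (R ≃ₐ[ℂ] R)}

instance : CoeSort (EqDiffMod δ α) Type := ⟨carrier⟩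

attribute [instance] addCommGroup module

/-- Morphisms: `R`-linear maps commuting with the group actions and the connections. -/
@[ext]
structure Hom (M N : EqDiffMod δ α) where
  lin : M →ₗ[R] N
  map_σ : ∀ g m, lin (M.σ g m) = N.σ g (lin m)
  map_conn : ∀ m, lin (M.conn m) = N.conn (lin m)

instance : Category (EqDiffMod δ α) where
  Hom := Hom
  id M := ⟨LinearMap.id, fun _ _ => rfl, fun _ => rfl⟩
  comp f g := ⟨g.lin ∘ₗ f.lin, fun _ _ => by simp [f.map_σ, g.map_σ],
    fun _ => by simp [f.map_conn, g.map_conn]⟩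

@[simp] theorem id_lin (M : EqDiffMod δ α) : Hom.lin (𝟙 M) = LinearMap.id := rfl

@[simp] theorem comp_lin {M N P : EqDiffMod δ α} (f : M ⟶ N) (g : N ⟶ P) :
    Hom.lin (f ≫ g) = Hom.lin g ∘ₗ Hom.lin f := rfl

@[ext]
theorem hom_ext {M N : EqDiffMod δ α} {f g : M ⟶ N} (h : Hom.lin f = Hom.lin g) : f = g :=
  Hom.ext h

section Linear

variable {M N : EqDiffMod δ α}

instance : Zero (M ⟶ N) := ⟨⟨0, by simp, by simp⟩⟩
instance : Add (M ⟶ N) := ⟨fun f g => ⟨Hom.lin f + Hom.lin g,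
  by simp [f.map_σ, g.map_σ], by simp [f.map_conn, g.map_conn]⟩⟩
instance : Neg (M ⟶ N) := ⟨fun f => ⟨-Hom.lin f, by simp [f.map_σ], by simp [f.map_conn]⟩⟩
instance : Sub (M ⟶ N) := ⟨fun f g => ⟨Hom.lin f - Hom.lin g,
  by simp [f.map_σ, g.map_σ], by simp [f.map_conn, g.map_conn]⟩⟩
instance : SMul ℂ (M ⟶ N) := ⟨fun c f => ⟨algebraMap ℂ R c • Hom.lin f,
  by simp [f.map_σ], fun m => by
    have := N.isConnection (algebraMap ℂ R c) (f.lin m)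
    simp [f.map_conn, this]⟩⟩
instance : SMul ℕ (M ⟶ N) := ⟨fun c f => ⟨c • Hom.lin f,
  by simp [f.map_σ], by simp [f.map_conn]⟩⟩
instance : SMul ℤ (M ⟶ N) := ⟨fun c f => ⟨c • Hom.lin f,
  by simp [f.map_σ], by simp [f.map_conn]⟩⟩

theorem lin_injective : Function.Injective (fun f : M ⟶ N => Hom.lin f) := fun _ _ h => hom_ext h

instance : AddCommGroup (M ⟶ N) :=
  lin_injective.addCommGroup _ rfl (fun _ _ => rfl) (fun _ => rfl) (fun _ _ => rfl)
    (fun _ _ => rfl) (fun _ _ => rfl)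

@[simp] theorem add_lin (f g : M ⟶ N) : Hom.lin (f + g) = Hom.lin f + Hom.lin g := rfl
@[simp] theorem zero_lin : Hom.lin (0 : M ⟶ N) = 0 := rfl
@[simp] theorem smul_lin (c : ℂ) (f : M ⟶ N) :
    Hom.lin (c • f) = algebraMap ℂ R c • Hom.lin f := rfl

instance : Module ℂ (M ⟶ N) where
  one_smul _ := by ext; simp
  mul_smul _ _ _ := by ext; simp [mul_smul]
  smul_zero _ := by ext; simp
  smul_add _ _ _ := by ext; simp
  add_smul _ _ _ := by ext; simp [add_smul]
  zero_smul _ := by ext; simp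

end Linear

instance : Preadditive (EqDiffMod δ α) where
  add_comp _ _ _ _ _ _ := by ext; simp
  comp_add _ _ _ _ _ _ := by ext; simp

instance : Linear ℂ (EqDiffMod δ α) where
  smul_comp _ _ _ _ _ _ := by ext; simp
  comp_smul _ _ _ _ _ _ := by ext; simp

/-- The underlying `R`-module. -/
@[simps]
def forgetMod : EqDiffMod δ α ⥤ ModuleCat.{0} R where
  obj M := ModuleCat.of R M
  map f := ModuleCat.ofHom (Hom.lin f)

instance : (forgetMod (δ := δ) (α := α)).Faithful where
  map_injective h := hom_ext (congrArg ModuleCat.Hom.hom h)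

/-- An isomorphism from an `R`-linear equivalence compatible with the structures. -/
def isoMk {M N : EqDiffMod δ α} (e : M ≃ₗ[R] N) (h1 : ∀ g m, e (M.σ g m) = N.σ g (e m))
    (h2 : ∀ m, e (M.conn m) = N.conn (e m)) : M ≅ N where
  hom := ⟨e, h1, h2⟩
  inv := ⟨e.symm, fun g n => by apply e.injective; simp [h1], fun n => by
    apply e.injective; simp [h2]⟩
  hom_inv_id := by ext; simp
  inv_hom_id := by ext; simp

/-- `(M, σ, ∇) ⊗ (N, σ', ∇') = (M ⊗ N, σ ⊗ σ', ∇ ⊗ 1 + 1 ⊗ ∇')`. -/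
def tensor (M N : EqDiffMod δ α) : EqDiffMod δ α where
  carrier := M ⊗[R] N
  σ g := TensorProduct.map (M.σ g) (N.σ g)
  σ_one x := by
    induction x with
    | zero => simp
    | add x y hx hy => simp only [map_add, hx, hy]
    | tmul m n => simp [M.σ_one, N.σ_one]
  σ_mul g h x := by
    induction x with
    | zero => simp
    | add x y hx hy => simp only [map_add, hx, hy]
    | tmul m n => simp [M.σ_mul, N.σ_mul]
  conn := tensorConnection M.isConnection N.isConnection
  isConnection := isConnection_tensorConnection _ _
  conn_σ g x := by
    induction x with
    | zero => simp
    | add x y hx hy => simp only [map_add, hx, hy]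
    | tmul m n => simp [M.conn_σ, N.conn_σ]

/-- The action of `g` on `R`, as a semilinear map. -/
def baseAction (α : G →* (R ≃ₐ[ℂ] R)) (g : G) : R →ₛₗ[((α g : R ≃ₐ[ℂ] R) : R →+* R)] R where
  toFun := α g
  map_add' := map_add _
  map_smul' := by simp

theorem isConnection_self (δ : Derivation ℂ R R) :
    IsConnection δ (δ.toLinearMap.toAddMonoidHom : R →+ R) := fun r m => by simp [mul_comm]

/-- The unit object `(R, α, δ)`. -/
def unit [IsEquivariantDerivation δ α] : EqDiffMod δ α where
  carrier := R
  σ := baseAction α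
  σ_one m := by simp [baseAction]
  σ_mul g h m := by
    change α (g * h) m = α g (α h m)
    simp
  conn := δ.toLinearMap.toAddMonoidHom
  isConnection := isConnection_self δ
  conn_σ g m := IsEquivariantDerivation.comm g m

/-- The tensor product of two morphisms. -/
def tensorMap {M M' N N' : EqDiffMod δ α} (f : M ⟶ M') (g : N ⟶ N') :
    tensor M N ⟶ tensor M' N' where
  lin := TensorProduct.map (Hom.lin f) (Hom.lin g)
  map_σ k := by
    change ∀ x : M ⊗[R] N, TensorProduct.map f.lin g.lin (TensorProduct.map (M.σ k) (N.σ k) x) =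
      TensorProduct.map (M'.σ k) (N'.σ k) (TensorProduct.map f.lin g.lin x)
    intro x
    induction x with
    | zero => simp
    | add x y hx hy => simp only [map_add, hx, hy]
    | tmul m n => simp [f.map_σ, g.map_σ]
  map_conn := by
    change ∀ x : M ⊗[R] N, TensorProduct.map f.lin g.lin
        (tensorConnection M.isConnection N.isConnection x) =
      tensorConnection M'.isConnection N'.isConnection (TensorProduct.map f.lin g.lin x)
    intro x
    induction x with
    | zero => simp
    | add x y hx hy => simp only [map_add, hx, hy]
    | tmul m n => simp [f.map_conn, g.map_conn]

/-- The associativity isomorphism. -/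
def assocIso (M N P : EqDiffMod δ α) : tensor (tensor M N) P ≅ tensor M (tensor N P) :=
  isoMk (M := tensor (tensor M N) P) (N := tensor M (tensor N P)) (TensorProduct.assoc R M N P)
    (fun g => by
      change ∀ x : (M ⊗[R] N) ⊗[R] P, TensorProduct.assoc R M N P
          (TensorProduct.map (TensorProduct.map (M.σ g) (N.σ g)) (P.σ g) x) =
        TensorProduct.map (M.σ g) (TensorProduct.map (N.σ g) (P.σ g))
          (TensorProduct.assoc R M N P x)
      intro x
      induction x with
      | zero => simp
      | add x y hx hy => simp only [map_add, hx, hy]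
      | tmul x p =>
        induction x with
        | zero => simp
        | add x y hx hy => simp only [map_add, add_tmul, hx, hy]
        | tmul m n => rfl)
    (by
      change ∀ x : (M ⊗[R] N) ⊗[R] P, TensorProduct.assoc R M N P
          (tensorConnection (isConnection_tensorConnection M.isConnection N.isConnection)
            P.isConnection x) =
        tensorConnection M.isConnection
          (isConnection_tensorConnection N.isConnection P.isConnection)
          (TensorProduct.assoc R M N P x)
      intro x
      induction x with
      | zero => simp
      | add x y hx hy => simp only [map_add, hx, hy]
      | tmul x p =>
        induction x with
        | zero => simp
        | add x y hx hy => simp only [map_add, add_tmul, hx, hy]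
        | tmul m n => simp [add_tmul, tmul_add, add_assoc])

/-- The symmetry isomorphism. -/
def commIso (M N : EqDiffMod δ α) : tensor M N ≅ tensor N M :=
  isoMk (M := tensor M N) (N := tensor N M) (TensorProduct.comm R M N)
    (fun g => by
      change ∀ x : M ⊗[R] N, TensorProduct.comm R M N (TensorProduct.map (M.σ g) (N.σ g) x) =
        TensorProduct.map (N.σ g) (M.σ g) (TensorProduct.comm R M N x)
      intro x
      induction x with
      | zero => simp
      | add x y hx hy => simp only [map_add, hx, hy]
      | tmul m n => rfl)
    (by
      change ∀ x : M ⊗[R] N, TensorProduct.comm R M N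
          (tensorConnection M.isConnection N.isConnection x) =
        tensorConnection N.isConnection M.isConnection (TensorProduct.comm R M N x)
      intro x
      induction x with
      | zero => simp
      | add x y hx hy => simp only [map_add, hx, hy]
      | tmul m n => simp [add_comm])

variable [IsEquivariantDerivation δ α]

/-- The left unit isomorphism. -/
def leftUnitIso (M : EqDiffMod δ α) : tensor unit M ≅ M :=
  isoMk (M := tensor unit M) (N := M) (TensorProduct.lid R M)
    (fun g => by
      change ∀ x : R ⊗[R] M, TensorProduct.lid R M
        (TensorProduct.map (baseAction α g) (M.σ g) x) =
          M.σ g (TensorProduct.lid R M x)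
      intro x
      induction x with
      | zero => simp
      | add x y hx hy => simp only [map_add, hx, hy]
      | tmul r m => exact ((M.σ g).map_smulₛₗ r m).symm)
    (by
      change ∀ x : R ⊗[R] M, TensorProduct.lid R M
        (tensorConnection (isConnection_self δ) M.isConnection x) =
          M.conn (TensorProduct.lid R M x)
      intro x
      induction x with
      | zero => simp
      | add x y hx hy => simp only [map_add, hx, hy]
      | tmul r m => simp [M.isConnection r m, add_comm])

/-- The right unit isomorphism. -/
def rightUnitIso (M : EqDiffMod δ α) : tensor M unit ≅ M :=
  isoMk (M := tensor M unit) (N := M) (TensorProduct.rid R M)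
    (fun g => by
      change ∀ x : M ⊗[R] R, TensorProduct.rid R M
        (TensorProduct.map (M.σ g) (baseAction α g) x) =
          M.σ g (TensorProduct.rid R M x)
      intro x
      induction x with
      | zero => simp
      | add x y hx hy => simp only [map_add, hx, hy]
      | tmul m r => exact ((M.σ g).map_smulₛₗ r m).symm)
    (by
      change ∀ x : M ⊗[R] R, TensorProduct.rid R M
        (tensorConnection M.isConnection (isConnection_self δ) x) =
          M.conn (TensorProduct.rid R M x)
      intro x
      induction x with
      | zero => simp
      | add x y hx hy => simp only [map_add, hx, hy]
      | tmul m r => simp [M.isConnection r m])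

instance : MonoidalCategoryStruct (EqDiffMod δ α) where
  tensorObj := tensor
  tensorUnit := unit
  tensorHom := tensorMap
  whiskerLeft M _ _ f := tensorMap (𝟙 M) f
  whiskerRight f N := tensorMap f (𝟙 N)
  associator := assocIso
  leftUnitor := leftUnitIso
  rightUnitor := rightUnitIso

/-- The forgetful functor to `R`-modules preserves the tensor operations on the nose. -/
def inducingData : Monoidal.InducingFunctorData (forgetMod (δ := δ) (α := α)) where
  μIso _ _ := Iso.refl _
  εIso := Iso.refl _
  whiskerLeft_eq _ _ _ _ := by ext1; exact TensorProduct.ext rfl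
  whiskerRight_eq _ _ := by ext1; exact TensorProduct.ext rfl
  tensorHom_eq _ _ := by ext1; exact TensorProduct.ext rfl
  associator_eq _ _ _ := by ext1; exact TensorProduct.ext (TensorProduct.ext rfl)
  leftUnitor_eq _ := by ext1; exact TensorProduct.ext rfl
  rightUnitor_eq _ := by ext1; exact TensorProduct.ext rfl

instance : MonoidalCategory (EqDiffMod δ α) := Monoidal.induced forgetMod inducingData

instance : (forgetMod (δ := δ) (α := α)).Monoidal :=
  Monoidal.fromInducedMonoidal forgetMod inducingData

instance : BraidedCategory (EqDiffMod δ α) :=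
  BraidedCategory.ofFaithful forgetMod commIso
    (fun M N => by ext1; exact TensorProduct.ext rfl)

instance : (forgetMod (δ := δ) (α := α)).Braided where
  braided M N := by ext1; exact TensorProduct.ext rfl

instance : SymmetricCategory (EqDiffMod δ α) := SymmetricCategory.ofFaithful forgetMod

instance : MonoidalPreadditive (EqDiffMod δ α) where
  whiskerLeft_zero := by intros; ext1; exact TensorProduct.ext' fun x y => tmul_zero _ _
  zero_whiskerRight := by intros; ext1; exact TensorProduct.ext' fun x y => zero_tmul _ _
  whiskerLeft_add _ _ := by ext1; exact TensorProduct.ext' fun x y => tmul_add _ _ _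
  add_whiskerRight _ _ := by ext1; exact TensorProduct.ext' fun x y => add_tmul _ _ _

instance : MonoidalLinear ℂ (EqDiffMod δ α) where
  whiskerLeft_smul _ _ _ _ _ := by ext1; exact TensorProduct.ext' fun x y => tmul_smul _ _ _
  smul_whiskerRight _ _ _ _ _ := by ext1; exact TensorProduct.ext' fun x y => (smul_tmul' _ _ _).symm

end EqDiffMod


namespace EqDiffMod

variable {R G : Type} [CommRing R] [Algebra ℂ R] [Group G]
  {δ : Derivation ℂ R R} {α : G →* (R ≃ₐ[ℂ] R)}

/-! ### Horizontal sections after extension of scalars -/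

section Horizontal

variable {S : Type} [CommRing S] [Algebra ℂ S] [Algebra R S]

/-- The derivation `δS` of the `R`-algebra `S` extends the derivation `δ` of `R`. -/
class ExtendsDerivation (δ : Derivation ℂ R R) (δS : Derivation ℂ S S) : Prop where
  map_algebraMap : ∀ r : R, δS (algebraMap R S r) = algebraMap R S (δ r)

theorem ExtendsDerivation.isConnection (δ : Derivation ℂ R R) (δS : Derivation ℂ S S)
    [h : ExtendsDerivation δ δS] :
    IsConnection δ (δS.toLinearMap.toAddMonoidHom : S →+ S) := fun r s => by
  simp [Algebra.smul_def, h.map_algebraMap, mul_comm, add_comm]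

variable [IsScalarTower ℂ R S] (δS : Derivation ℂ S S) [ExtendsDerivation δ δS]

/-- The connection `δS ⊗ 1 + 1 ⊗ ∇` on `S ⊗ M`, as a `ℂ`-linear map. -/
def extendedConnection (M : EqDiffMod δ α) : S ⊗[R] M →ₗ[ℂ] S ⊗[R] M where
  toFun := tensorConnection (ExtendsDerivation.isConnection δ δS) M.isConnection
  map_add' := map_add _
  map_smul' c x := by
    induction x with
    | zero => simp
    | add x y hx hy => simp only [smul_add, map_add, hx, hy]
    | tmul s m => simp [smul_tmul']

@[simp]
theorem extendedConnection_tmul (M : EqDiffMod δ α) (s : S) (m : M) :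
    extendedConnection δS M (s ⊗ₜ m) = δS s ⊗ₜ m + s ⊗ₜ M.conn m := rfl

/-- The `ℂ`-linear map `1 ⊗ f : S ⊗ M → S ⊗ N` induced by a morphism. -/
def extendMap (S : Type) [CommRing S] [Algebra ℂ S] [Algebra R S] [IsScalarTower ℂ R S]
    {M N : EqDiffMod δ α} (f : M ⟶ N) : S ⊗[R] M →ₗ[ℂ] S ⊗[R] N :=
  ((Hom.lin f).baseChange S).restrictScalars ℂ

@[simp]
theorem extendMap_tmul {M N : EqDiffMod δ α} (f : M ⟶ N) (s : S) (m : M) :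
    extendMap S f (s ⊗ₜ m) = s ⊗ₜ Hom.lin f m := rfl

theorem extendMap_conn {M N : EqDiffMod δ α} (f : M ⟶ N) (x : S ⊗[R] M) :
    extendedConnection δS N (extendMap S f x) = extendMap S f (extendedConnection δS M x) := by
  induction x with
  | zero => simp
  | add x y hx hy => simp only [map_add, hx, hy]
  | tmul s m => simp [f.map_conn]

/-- The functor sending `M` to the space of horizontal elements of `S ⊗ M`. -/
def horizontal : EqDiffMod δ α ⥤ ModuleCat.{0} ℂ where
  obj M := ModuleCat.of ℂ (LinearMap.ker (extendedConnection δS M))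
  map {M N} f := ModuleCat.ofHom ((extendMap S f).restrict (fun x hx => by
    rw [LinearMap.mem_ker] at hx ⊢
    rw [extendMap_conn, hx, map_zero]))
  map_id M := by
    ext1
    refine LinearMap.ext fun x => ?_
    refine Subtype.ext ?_
    change extendMap S (𝟙 M) x.1 = x.1
    induction x.1 with
    | zero => simp
    | add x y hx hy => simp only [map_add, hx, hy]
    | tmul s m => simp
  map_comp f g := by
    ext1
    refine LinearMap.ext fun x => ?_
    refine Subtype.ext ?_
    change extendMap S (f ≫ g) x.1 = extendMap S g (extendMap S f x.1)
    induction x.1 with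
    | zero => simp
    | add x y hx hy => simp only [map_add, hx, hy]
    | tmul s m => simp

end Horizontal

end EqDiffMod

/-! ### Holomorphic functions on `ℂ*` -/

/-- Extension by zero to `ℂ` of a function on `ℂ* = ℂˣ`. -/
def extZero (f : ℂˣ → ℂ) : ℂ → ℂ := Function.extend Units.val f 0

@[simp]
theorem extZero_coe (f : ℂˣ → ℂ) (z : ℂˣ) : extZero f z = f z :=
  Units.val_injective.extend_apply f 0 z

theorem extZero_eventuallyEq {f : ℂˣ → ℂ} {g : ℂ → ℂ} (h : ∀ z : ℂˣ, f z = g z) (z : ℂˣ) :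
    extZero f =ᶠ[nhds (z : ℂ)] g := by
  filter_upwards [isOpen_ne.mem_nhds z.ne_zero] with w hw
  simpa [h] using extZero_coe f (Units.mk0 w hw)

/-- `f` is holomorphic on `ℂ*`. -/
def IsHol (f : ℂˣ → ℂ) : Prop := ∀ z : ℂˣ, DifferentiableAt ℂ (extZero f) z

theorem IsHol.of_eq {f : ℂˣ → ℂ} (g : ℂ → ℂ) (h : ∀ z : ℂˣ, f z = g z)
    (hg : ∀ z : ℂˣ, DifferentiableAt ℂ g z) : IsHol f := fun z =>
  (hg z).congr_of_eventuallyEq (extZero_eventuallyEq h z)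

theorem IsHol.analyticAt {f : ℂˣ → ℂ} (hf : IsHol f) (z : ℂˣ) : AnalyticAt ℂ (extZero f) z := by
  rw [Complex.analyticAt_iff_eventually_differentiableAt]
  filter_upwards [isOpen_ne.mem_nhds z.ne_zero] with w hw
  exact hf (Units.mk0 w hw)

/-- The `ℂ`-algebra `𝒪(ℂ*)` of holomorphic functions on `ℂ*`. -/
def Hol : Subalgebra ℂ (ℂˣ → ℂ) where
  carrier := {f | IsHol f}
  mul_mem' {f g} hf hg := IsHol.of_eq (extZero f * extZero g) (by simp) (fun z => (hf z).mul (hg z))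
  add_mem' {f g} hf hg := IsHol.of_eq (extZero f + extZero g) (by simp) (fun z => (hf z).add (hg z))
  algebraMap_mem' c := IsHol.of_eq (fun _ => c) (fun _ => rfl) (fun _ => differentiableAt_const c)

/-- The derivation `τ z d/dz` of `𝒪(ℂ*)`. -/
def eulerDerivation (τ : ℂ) : Derivation ℂ Hol Hol where
  toFun f := ⟨fun z => τ * z * deriv (extZero f) z,
    IsHol.of_eq (fun z => τ * z * deriv (extZero f) z) (fun _ => rfl) (fun z =>
      ((differentiableAt_const τ).mul differentiableAt_id).mul
        (f.2.analyticAt z).deriv.differentiableAt)⟩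
  map_add' f g := by
    ext z
    have h : extZero (f.1 + g.1) =ᶠ[nhds (z : ℂ)] extZero f + extZero g :=
      extZero_eventuallyEq (by simp) z
    change τ * z * deriv (extZero (f.1 + g.1)) z =
      τ * z * deriv (extZero f) z + τ * z * deriv (extZero g) z
    rw [h.deriv_eq, deriv_add (f.2 z) (g.2 z), mul_add]
  map_smul' c f := by
    ext z
    have h : extZero (c • f.1) =ᶠ[nhds (z : ℂ)] c • extZero f :=
      extZero_eventuallyEq (by simp) z
    change τ * z * deriv (extZero (c • f.1)) z = c * (τ * z * deriv (extZero f) z)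
    rw [h.deriv_eq, deriv_const_smul c (f.2 z), smul_eq_mul]
    ring
  map_one_eq_zero' := by
    ext z
    have h : extZero 1 =ᶠ[nhds (z : ℂ)] fun _ => 1 := extZero_eventuallyEq (by simp) z
    change τ * z * deriv (extZero 1) z = 0
    rw [h.deriv_eq, deriv_const, mul_zero]
  leibniz' f g := by
    ext z
    have h : extZero (f.1 * g.1) =ᶠ[nhds (z : ℂ)] extZero f * extZero g :=
      extZero_eventuallyEq (by simp) z
    change τ * z * deriv (extZero (f.1 * g.1)) z =
      f.1 z * (τ * z * deriv (extZero g) z) + g.1 z * (τ * z * deriv (extZero f) z)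
    rw [h.deriv_eq, deriv_mul (f.2 z) (g.2 z), extZero_coe, extZero_coe]
    ring

theorem eulerDerivation_apply (τ : ℂ) (f : Hol) (z : ℂˣ) :
    (eulerDerivation τ f : ℂˣ → ℂ) z = τ * z * deriv (extZero f) z := rfl

theorem extZero_rotate (u : ℂˣ) (f : ℂˣ → ℂ) (z : ℂˣ) :
    extZero (fun w => f (u * w)) =ᶠ[nhds (z : ℂ)] fun w => extZero f (u * w) :=
  extZero_eventuallyEq (fun w => by
    have := extZero_coe f (u * w)
    push_cast at this
    exact this.symm) z

/-- The automorphism `f ↦ f (u ·)` of `𝒪(ℂ*)`, as an algebra homomorphism. -/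
def rotateHom (u : ℂˣ) : Hol →ₐ[ℂ] Hol where
  toFun f := ⟨fun z => f.1 (u * z), fun z => by
    have h := f.2 (u * z)
    push_cast at h
    exact (DifferentiableAt.comp (z : ℂ) h (differentiableAt_id.const_mul (u : ℂ))).congr_of_eventuallyEq
      (extZero_rotate u f.1 z)⟩
  map_one' := rfl
  map_mul' _ _ := rfl
  map_zero' := rfl
  map_add' _ _ := rfl
  commutes' _ := rfl

@[simp]
theorem rotateHom_apply (u : ℂˣ) (f : Hol) (z : ℂˣ) :
    (rotateHom u f : ℂˣ → ℂ) z = (f : ℂˣ → ℂ) (u * z) := rfl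

/-- The action of `ℂˣ` on `𝒪(ℂ*)` by `(u, f) ↦ f (u ·)`. -/
def rotate : ℂˣ →* (Hol ≃ₐ[ℂ] Hol) where
  toFun u := AlgEquiv.ofAlgHom (rotateHom u) (rotateHom u⁻¹)
    (by ext f z; simp) (by ext f z; simp)
  map_one' := by ext f z; simp
  map_mul' u v := by ext f z; simp [mul_comm, mul_left_comm]

theorem rotate_apply (u : ℂˣ) (f : Hol) (z : ℂˣ) :
    (rotate u f : ℂˣ → ℂ) z = (f : ℂˣ → ℂ) (u * z) := rfl

/-- The group `θℤ`, written multiplicatively. -/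
abbrev ThetaZ (θ : ℝ) : Type := Multiplicative (AddSubgroup.zmultiples θ)

/-- `t ↦ exp (2πit)` as a homomorphism from `θℤ` to `ℂˣ`. -/
def expTwoPiI (θ : ℝ) : ThetaZ θ →* ℂˣ where
  toFun t := Units.mk0 (Complex.exp (2 * Real.pi * Complex.I * (t.toAdd : ℝ))) (Complex.exp_ne_zero _)
  map_one' := by ext; simp
  map_mul' s t := by ext; simp [mul_add, Complex.exp_add]

/-- The action `α` of `θℤ` on `𝒪(ℂ*)`: the element `t` sends `f` to `z ↦ f (exp (2πit) z)`, so
the generator `θ` acts by `f ↦ f (q ·)` with `q = exp (2πiθ)`. -/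
def thetaAction (θ : ℝ) : ThetaZ θ →* (Hol ≃ₐ[ℂ] Hol) := rotate.comp (expTwoPiI θ)

instance (θ : ℝ) (τ : ℂ) : IsEquivariantDerivation (eulerDerivation τ) (thetaAction θ) where
  comm g f := by
    ext z
    set u := expTwoPiI θ g
    change τ * z * deriv (extZero (fun w => f.1 (u * w))) z =
      τ * ((u * z : ℂˣ) : ℂ) * deriv (extZero f) (u * z : ℂˣ)
    rw [(extZero_rotate u f.1 z).deriv_eq, deriv_comp_mul_left]
    simp
    ring

/-! ### Germs of holomorphic functions -/

/-- The `ℂ`-algebra of all germs of functions at `z`. -/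
instance germAlgebra (z : ℂ) : Algebra ℂ (Filter.Germ (nhds z) ℂ) :=
  Algebra.ofModule
    (fun c f g => Filter.Germ.inductionOn₂ f g fun _ _ =>
      congrArg Filter.Germ.ofFun (smul_mul_assoc c _ _))
    (fun c f g => Filter.Germ.inductionOn₂ f g fun _ _ =>
      congrArg Filter.Germ.ofFun (mul_smul_comm c _ _))

/-- The `ℂ`-algebra `𝒪_z` of germs at `z` of holomorphic functions. -/
def HolGerm (z : ℂ) : Subalgebra ℂ (Filter.Germ (nhds z) ℂ) where
  carrier := {g | ∃ f : ℂ → ℂ, AnalyticAt ℂ f z ∧ g = (f : Filter.Germ (nhds z) ℂ)}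
  mul_mem' := by
    rintro _ _ ⟨f, hf, rfl⟩ ⟨g, hg, rfl⟩
    exact ⟨f * g, hf.mul hg, rfl⟩
  add_mem' := by
    rintro _ _ ⟨f, hf, rfl⟩ ⟨g, hg, rfl⟩
    exact ⟨f + g, hf.add hg, rfl⟩
  algebraMap_mem' c := ⟨fun _ => c, analyticAt_const, by
    rw [Algebra.algebraMap_eq_smul_one]
    exact congrArg Filter.Germ.ofFun (funext fun _ => mul_one c)⟩

/-- The germ of an analytic function. -/
def HolGerm.mk {z : ℂ} (f : ℂ → ℂ) (hf : AnalyticAt ℂ f z) : HolGerm z := ⟨f, f, hf, rfl⟩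

/-- The operator `τ z d/dz` on germs. -/
def eulerGerm (τ z : ℂ) : Filter.Germ (nhds z) ℂ → Filter.Germ (nhds z) ℂ :=
  Filter.Germ.map' (fun f w => τ * w * deriv f w)
    (fun _ _ h => h.deriv.mono fun w hw => by simp [hw])

/-- The derivation `τ z d/dz` of `𝒪_z`. -/
def eulerDerivationGerm (τ z : ℂ) : Derivation ℂ (HolGerm z) (HolGerm z) where
  toFun g := ⟨eulerGerm τ z g, by
    obtain ⟨_, f, hf, rfl⟩ := g
    exact ⟨fun w => τ * w * deriv f w, (analyticAt_const.mul analyticAt_id).mul hf.deriv, rfl⟩⟩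
  map_add' := by
    rintro ⟨_, f, hf, rfl⟩ ⟨_, g, hg, rfl⟩
    refine Subtype.ext (Filter.Germ.coe_eq.2 ?_)
    filter_upwards [hf.eventually_analyticAt, hg.eventually_analyticAt] with w h1 h2
    change τ * w * deriv (f + g) w = τ * w * deriv f w + τ * w * deriv g w
    rw [deriv_add h1.differentiableAt h2.differentiableAt, mul_add]
  map_smul' := by
    rintro c ⟨_, f, hf, rfl⟩
    refine Subtype.ext (Filter.Germ.coe_eq.2 ?_)
    filter_upwards [hf.eventually_analyticAt] with w h1
    change τ * w * deriv (c • f) w = c * (τ * w * deriv f w)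
    rw [deriv_const_smul c h1.differentiableAt, smul_eq_mul]
    ring
  map_one_eq_zero' := by
    refine Subtype.ext (Filter.Germ.coe_eq.2 (Filter.Eventually.of_forall fun w => ?_))
    change τ * w * deriv (fun _ => (1 : ℂ)) w = 0
    simp
  leibniz' := by
    rintro ⟨_, f, hf, rfl⟩ ⟨_, g, hg, rfl⟩
    refine Subtype.ext (Filter.Germ.coe_eq.2 ?_)
    filter_upwards [hf.eventually_analyticAt, hg.eventually_analyticAt] with w h1 h2
    change τ * w * deriv (f * g) w = f w * (τ * w * deriv g w) + g w * (τ * w * deriv f w)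
    rw [deriv_mul h1.differentiableAt h2.differentiableAt]
    ring

/-- The germ at `z ∈ ℂ*` of a holomorphic function on `ℂ*`. -/
def germHom (z : ℂˣ) : Hol →ₐ[ℂ] HolGerm z where
  toFun f := HolGerm.mk (extZero f) (f.2.analyticAt z)
  map_one' := Subtype.ext (Filter.Germ.coe_eq.2 (extZero_eventuallyEq (by simp) z))
  map_mul' f g := Subtype.ext (Filter.Germ.coe_eq.2 (extZero_eventuallyEq (by simp) z))
  map_zero' := Subtype.ext (Filter.Germ.coe_eq.2 (extZero_eventuallyEq (by simp) z))
  map_add' f g := Subtype.ext (Filter.Germ.coe_eq.2 (extZero_eventuallyEq (by simp) z))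
  commutes' c := Subtype.ext (by
    rw [Algebra.algebraMap_eq_smul_one, Algebra.algebraMap_eq_smul_one]
    exact Filter.Germ.coe_eq.2 (extZero_eventuallyEq (by simp) z))

instance (z : ℂˣ) : Algebra Hol (HolGerm (z : ℂ)) := (germHom z).toAlgebra

instance (z : ℂˣ) : IsScalarTower ℂ Hol (HolGerm (z : ℂ)) :=
  IsScalarTower.of_algebraMap_eq fun c => ((germHom z).commutes c).symm

instance (τ : ℂ) (z : ℂˣ) :
    EqDiffMod.ExtendsDerivation (eulerDerivation τ) (eulerDerivationGerm τ (z : ℂ)) where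
  map_algebraMap f := Subtype.ext (Filter.Germ.coe_eq.2
    (extZero_eventuallyEq (fun w => eulerDerivation_apply τ f w) z).symm)

/-! ### The category `B_q^τ` and its fibre functor -/

/-- `f` is meromorphic at `0`, with at most a simple pole there. -/
def AtMostSimplePole (f : ℂ → ℂ) : Prop :=
  MeromorphicAt f 0 ∧ ((-1 : ℤ) : WithTop ℤ) ≤ meromorphicOrderAt f 0

/-- The connection of `M` is regular singular: there is a finite module basis `e` such that, for
the matrix `A` given by `∇ e_i = ∑_j A_ij e_j`, all `z⁻¹ A_ij` have at most a simple pole at `0`. -/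
def IsRegularSingular {θ : ℝ} {τ : ℂ} (M : EqDiffMod (eulerDerivation τ) (thetaAction θ)) : Prop :=
  ∃ (n : ℕ) (e : Module.Basis (Fin n) Hol M), ∀ i j,
    AtMostSimplePole (fun z => z⁻¹ * extZero (e.repr (M.conn (e i)) j : Hol) z)

/-- The defining condition of the objects of `B_q^τ`. -/
def objBqTau (θ : ℝ) (τ : ℂ) : ObjectProperty (EqDiffMod (eulerDerivation τ) (thetaAction θ)) :=
  fun M => Module.FinitePresentation Hol M ∧ IsRegularSingular M

theorem extZero_zero : extZero 0 = 0 := by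
  funext w
  rcases eq_or_ne w 0 with rfl | hw
  · simp [extZero]
  · exact extZero_coe 0 (Units.mk0 w hw)

theorem extZero_add (f g : ℂˣ → ℂ) : extZero (f + g) = extZero f + extZero g := by
  funext w
  rcases eq_or_ne w 0 with rfl | hw
  · simp [extZero]
  · have h1 := extZero_coe (f + g) (Units.mk0 w hw)
    have h2 := extZero_coe f (Units.mk0 w hw)
    have h3 := extZero_coe g (Units.mk0 w hw)
    rw [Units.val_mk0] at h1 h2 h3
    rw [Pi.add_apply, h1, h2, h3, Pi.add_apply]

theorem atMostSimplePole_zero : AtMostSimplePole (fun z => z⁻¹ * extZero (0 : Hol) z) := by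
  have h : (fun z : ℂ => z⁻¹ * extZero (0 : Hol) z) = fun _ => 0 := by
    simp [extZero_zero]
  rw [h]
  refine ⟨MeromorphicAt.const 0 0, ?_⟩
  rw [meromorphicOrderAt_eq_top_iff.2 (by simp)]
  exact le_top

theorem AtMostSimplePole.add {f g : Hol} (hf : AtMostSimplePole (fun z => z⁻¹ * extZero f z))
    (hg : AtMostSimplePole (fun z => z⁻¹ * extZero g z)) :
    AtMostSimplePole (fun z => z⁻¹ * extZero (f + g : Hol) z) := by
  have h : (fun z : ℂ => z⁻¹ * extZero (f + g : Hol) z) =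
      (fun z => z⁻¹ * extZero f z) + (fun z => z⁻¹ * extZero g z) := by
    funext w
    simp [extZero_add, mul_add]
  rw [h]
  exact ⟨hf.1.add hg.1, (le_min hf.2 hg.2).trans (meromorphicOrderAt_add hf.1 hg.1)⟩

theorem finitePresentation_of_basis {n : ℕ} {M : Type} [AddCommGroup M] [Module Hol M]
    (e : Module.Basis (Fin n) Hol M) : Module.FinitePresentation Hol M :=
  Module.FinitePresentation.of_equiv e.equivFun.symm

theorem isRegularSingular_unit (θ : ℝ) (τ : ℂ) :
    IsRegularSingular (𝟙_ (EqDiffMod (eulerDerivation τ) (thetaAction θ))) := by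
  refine ⟨1, (Module.Basis.singleton (Fin 1) Hol : Module.Basis (Fin 1) Hol Hol), fun i j => ?_⟩
  have h : eulerDerivation τ ((Module.Basis.singleton (Fin 1) Hol : Module.Basis (Fin 1) Hol Hol) i)
      = 0 := by simp
  have h2 : ((Module.Basis.singleton (Fin 1) Hol : Module.Basis (Fin 1) Hol Hol).repr
      (eulerDerivation τ ((Module.Basis.singleton (Fin 1) Hol : Module.Basis (Fin 1) Hol Hol) i)) j)
      = 0 := by rw [h]; simp
  change AtMostSimplePole (fun z => z⁻¹ * extZero
    ((Module.Basis.singleton (Fin 1) Hol : Module.Basis (Fin 1) Hol Hol).repr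
      (eulerDerivation τ ((Module.Basis.singleton (Fin 1) Hol : Module.Basis (Fin 1) Hol Hol) i)) j
      : Hol) z)
  rw [h2]
  exact atMostSimplePole_zero

theorem IsRegularSingular.tensor {θ : ℝ} {τ : ℂ}
    {M N : EqDiffMod (eulerDerivation τ) (thetaAction θ)} (hM : IsRegularSingular M)
    (hN : IsRegularSingular N) : IsRegularSingular (M ⊗ N) := by
  obtain ⟨m, e, he⟩ := hM
  obtain ⟨n, f, hf⟩ := hN
  refine ⟨m * n, (e.tensorProduct f).reindex finProdFinEquiv, fun i j => ?_⟩
  obtain ⟨⟨i, k⟩, rfl⟩ := finProdFinEquiv.surjective i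
  obtain ⟨⟨j, l⟩, rfl⟩ := finProdFinEquiv.surjective j
  have key : ((e.tensorProduct f).reindex finProdFinEquiv).repr
      (tensorConnection M.isConnection N.isConnection
        ((e.tensorProduct f).reindex finProdFinEquiv (finProdFinEquiv (i, k))))
        (finProdFinEquiv (j, l)) =
      (if k = l then e.repr (M.conn (e i)) j else 0) +
        (if i = j then f.repr (N.conn (f k)) l else 0) := by
    simp [Module.Basis.tensorProduct_apply, Finsupp.single_apply]
  change AtMostSimplePole (fun z => z⁻¹ * extZero
    (((e.tensorProduct f).reindex finProdFinEquiv).repr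
      (tensorConnection M.isConnection N.isConnection
        ((e.tensorProduct f).reindex finProdFinEquiv (finProdFinEquiv (i, k))))
        (finProdFinEquiv (j, l)) : Hol) z)
  rw [key]
  refine AtMostSimplePole.add ?_ ?_
  · split_ifs
    · exact he i j
    · exact atMostSimplePole_zero
  · split_ifs
    · exact hf k l
    · exact atMostSimplePole_zero

instance (θ : ℝ) (τ : ℂ) : (objBqTau θ τ).IsMonoidal where
  prop_unit := ⟨inferInstanceAs (Module.FinitePresentation Hol Hol), isRegularSingular_unit θ τ⟩
  prop_tensor M N hM hN := by
    have h := hM.2.tensor hN.2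
    obtain ⟨n, e, -⟩ := id h
    exact ⟨finitePresentation_of_basis e, h⟩

/-- The category `B_q^τ`, `q = exp (2πiθ)`: the full subcategory of the category of
`θℤ`-equivariant `𝒪(ℂ*)`-modules with equivariant connection covering `τ z d/dz` on the finitely
presented, regular singular objects. -/
abbrev BqTau (θ : ℝ) (τ : ℂ) := (objBqTau θ τ).FullSubcategory

/-- The functor `(M, σ, ∇) ↦ (ker ∇)_z`, the space of horizontal elements of `𝒪_z ⊗ M`, that is,
of germs at `z` of local solutions of `∇ = 0`. -/
def fibreFunctor (θ : ℝ) (τ : ℂ) (z : ℂˣ) : BqTau θ τ ⥤ ModuleCat.{0} ℂ :=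
  (objBqTau θ τ).ι ⋙ EqDiffMod.horizontal (eulerDerivationGerm τ (z : ℂ))

/-- The element of `𝒪_z ⊗ M` underlying a germ of a solution. -/
def fibreFunctor.toGerm {θ : ℝ} {τ : ℂ} {z : ℂˣ} {M : BqTau θ τ}
    (x : (fibreFunctor θ τ z).obj M) : HolGerm (z : ℂ) ⊗[Hol] M.obj :=
  Subtype.val (p := fun y => y ∈ LinearMap.ker
    (EqDiffMod.extendedConnection (eulerDerivationGerm τ (z : ℂ)) M.obj)) x

/-- The element of `𝒪_z ⊗ (M ⊗ N)` underlying a germ of a solution. -/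
def fibreFunctor.toGermTensor {θ : ℝ} {τ : ℂ} {z : ℂˣ} {M N : BqTau θ τ}
    (x : (fibreFunctor θ τ z).obj (M ⊗ N)) : HolGerm (z : ℂ) ⊗[Hol] (M.obj ⊗[Hol] N.obj) :=
  fibreFunctor.toGerm x

/-- A tensor structure `μ` on the fibre functor is the canonical one: under
`𝒪_z ⊗ (M ⊗ N) = (𝒪_z ⊗ M) ⊗ (𝒪_z ⊗ N)`, the germ `μ (x ⊗ y)` is `x ⊗ y`. -/
def IsCanonicalTensorStructure (θ : ℝ) (τ : ℂ) (z : ℂˣ) [(fibreFunctor θ τ z).Monoidal] : Prop :=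
  ∀ (M N : BqTau θ τ) (x : (fibreFunctor θ τ z).obj M) (y : (fibreFunctor θ τ z).obj N),
    TensorProduct.AlgebraTensorModule.distribBaseChange Hol (HolGerm (z : ℂ)) M.obj N.obj
      (fibreFunctor.toGermTensor
        ((Functor.LaxMonoidal.μ (fibreFunctor θ τ z) M N).hom (x ⊗ₜ[ℂ] y))) =
      fibreFunctor.toGerm x ⊗ₜ[HolGerm (z : ℂ)] fibreFunctor.toGerm y

/-! ### Neutral Tannakian categories -/

/-- The `k`-linear symmetric monoidal category `C`, with the tensor functor `ω`, is a neutral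
Tannakian category over the field `k` with fibre functor `ω`. -/
structure IsNeutralTannakian (k : Type) [Field k] {C : Type 1} [Category.{0} C] [Preadditive C]
    [Linear k C] [MonoidalCategory C] [SymmetricCategory C] (ω : C ⥤ ModuleCat.{0} k)
    [ω.Braided] : Prop where
  /-- `C` is abelian -/
  hasFiniteProducts : Limits.HasFiniteProducts C
  hasKernels : Limits.HasKernels C
  hasCokernels : Limits.HasCokernels C
  isNormalMonoCategory : IsNormalMonoCategory C
  isNormalEpiCategory : IsNormalEpiCategory C
  /-- the tensor product is `k`-bilinear -/
  monoidalPreadditive : MonoidalPreadditive C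
  monoidalLinear : MonoidalLinear k C
  /-- all objects have duals -/
  rigid : Nonempty (RigidCategory C)
  /-- `End 1 = k` -/
  endUnit : Function.Bijective (fun c : k => c • 𝟙 (𝟙_ C))
  /-- `ω` is `k`-linear, faithful and exact, with finite dimensional values -/
  additive : ω.Additive
  linear : ω.Linear k
  faithful : ω.Faithful
  preservesFiniteLimits : Limits.PreservesFiniteLimits ω
  preservesFiniteColimits : Limits.PreservesFiniteColimits ω
  finite : ∀ X, Module.Finite k (ω.obj X)

/-- There is an equivalence of symmetric monoidal categories between `C` and `D` under which the
tensor functors `F` and `F'` correspond to each other. (If `F` and `F'` are linear and faithful,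
such an equivalence is linear.) -/
def TensorEquivalentOver {C D V : Type 1} [Category.{0} C] [Category.{0} D] [Category.{0} V]
    [MonoidalCategory C] [MonoidalCategory D] [MonoidalCategory V]
    [BraidedCategory C] [BraidedCategory D] (F : C ⥤ V) [F.Monoidal] (F' : D ⥤ V) [F'.Monoidal] :
    Prop :=
  ∃ (e : C ≌ D) (_ : e.functor.Braided) (i : e.functor ⋙ F' ≅ F), NatTrans.IsMonoidal i.hom

/-- The forgetful functor from finite dimensional complex representations to vector spaces. -/
abbrev forgetRep (H : Type) [Group H] : FDRep ℂ H ⥤ ModuleCat.{0} ℂ :=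
  Action.forget (FGModuleCat ℂ) H ⋙ forget₂ (FGModuleCat ℂ) (ModuleCat ℂ)

/-- The subgroup `ℤ + θℤ` of `ℝ`. -/
abbrev ZPlusThetaZ (θ : ℝ) : AddSubgroup ℝ :=
  AddSubgroup.zmultiples (1 : ℝ) ⊔ AddSubgroup.zmultiples θ

/-! ### Representations of affine group schemes, and the algebraic hull of a group -/

section Comodule

variable {A : Type} [CommRing A]

/-- The map `(V ⊗ B) ⊗ (W ⊗ B) → (V ⊗ W) ⊗ B`, `(v ⊗ a) ⊗ (w ⊗ b) ↦ (v ⊗ w) ⊗ ab`. -/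
def mulTensor (B V W : Type) [CommRing B] [Algebra ℂ B] [AddCommGroup V] [Module ℂ V]
    [AddCommGroup W] [Module ℂ W] : (V ⊗[ℂ] B) ⊗[ℂ] (W ⊗[ℂ] B) →ₗ[ℂ] (V ⊗[ℂ] W) ⊗[ℂ] B :=
  (LinearMap.mul' ℂ B).lTensor (V ⊗[ℂ] W) ∘ₗ
    (TensorProduct.tensorTensorTensorComm ℂ V B W B).toLinearMap

@[simp]
theorem mulTensor_tmul {B V W : Type} [CommRing B] [Algebra ℂ B] [AddCommGroup V] [Module ℂ V]
    [AddCommGroup W] [Module ℂ W] (v : V) (a : B) (w : W) (b : B) :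
    mulTensor B V W ((v ⊗ₜ a) ⊗ₜ (w ⊗ₜ b)) = (v ⊗ₜ w) ⊗ₜ (a * b) := rfl

/-- A finite dimensional representation of the affine group scheme with coordinate ring the
commutative Hopf algebra `A`, that is, a finite dimensional right `A`-comodule. -/
structure FdComod (A : Type) [CommRing A] [HopfAlgebra ℂ A] where
  carrier : Type
  [addCommGroup : AddCommGroup carrier]
  [module : Module ℂ carrier]
  [finite : Module.Finite ℂ carrier]
  coact : carrier →ₗ[ℂ] carrier ⊗[ℂ] A
  coassoc : ∀ v, TensorProduct.assoc ℂ carrier A A (coact.rTensor A (coact v)) =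
    (Coalgebra.comul (R := ℂ) (A := A)).lTensor carrier (coact v)
  counit : ∀ v, (Coalgebra.counit (R := ℂ) (A := A)).lTensor carrier (coact v) = v ⊗ₜ 1

namespace FdComod

variable [HopfAlgebra ℂ A]

instance : CoeSort (FdComod A) Type := ⟨carrier⟩

attribute [instance] addCommGroup module finite

/-- Morphisms of comodules. -/
@[ext]
structure Hom (V W : FdComod A) where
  lin : V →ₗ[ℂ] W
  map_coact : ∀ v, W.coact (lin v) = lin.rTensor A (V.coact v)

instance : Category (FdComod A) where
  Hom := Hom
  id V := ⟨LinearMap.id, by simp⟩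
  comp f g := ⟨g.lin ∘ₗ f.lin, by simp [f.map_coact, g.map_coact, LinearMap.rTensor_comp]⟩

@[ext]
theorem hom_ext {V W : FdComod A} {f g : V ⟶ W} (h : Hom.lin f = Hom.lin g) : f = g :=
  Hom.ext h

@[simp] theorem id_lin (V : FdComod A) : Hom.lin (𝟙 V) = LinearMap.id := rfl

@[simp] theorem comp_lin {U V W : FdComod A} (f : U ⟶ V) (g : V ⟶ W) :
    Hom.lin (f ≫ g) = Hom.lin g ∘ₗ Hom.lin f := rfl

/-- The underlying vector space. -/
@[simps]
def forgetComod (A : Type) [CommRing A] [HopfAlgebra ℂ A] : FdComod A ⥤ ModuleCat.{0} ℂ where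
  obj V := ModuleCat.of ℂ V
  map f := ModuleCat.ofHom (Hom.lin f)

instance : (forgetComod A).Faithful where
  map_injective h := hom_ext (congrArg ModuleCat.Hom.hom h)

/-- An isomorphism from a linear equivalence compatible with the coactions. -/
def isoMk {V W : FdComod A} (e : V ≃ₗ[ℂ] W)
    (h : ∀ v, W.coact (e v) = e.toLinearMap.rTensor A (V.coact v)) : V ≅ W where
  hom := ⟨e, h⟩
  inv := ⟨e.symm, fun w => by
    obtain ⟨v, rfl⟩ := e.surjective w
    have h2 : e.symm.toLinearMap.rTensor A (e.toLinearMap.rTensor A (V.coact v)) = V.coact v := by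
      rw [← LinearMap.comp_apply, ← LinearMap.rTensor_comp]
      simp
    simp [h, h2]⟩
  hom_inv_id := by ext; simp
  inv_hom_id := by ext; simp

theorem mulTensor_comul {V W : Type} [AddCommGroup V] [Module ℂ V] [AddCommGroup W] [Module ℂ W]
    (x : V ⊗[ℂ] A) (y : W ⊗[ℂ] A) :
    (Coalgebra.comul (R := ℂ) (A := A)).lTensor (V ⊗[ℂ] W) (mulTensor A V W (x ⊗ₜ y)) =
      mulTensor (A ⊗[ℂ] A) V W ((Coalgebra.comul (R := ℂ) (A := A)).lTensor V x ⊗ₜ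
        (Coalgebra.comul (R := ℂ) (A := A)).lTensor W y) := by
  induction x with
  | zero => simp
  | add x x' hx hx' => simp only [add_tmul, map_add, hx, hx']
  | tmul v a =>
    induction y with
    | zero => simp
    | add y y' hy hy' => simp only [tmul_add, map_add, hy, hy']
    | tmul w b => simp

theorem mulTensor_counit {V W : Type} [AddCommGroup V] [Module ℂ V] [AddCommGroup W] [Module ℂ W]
    (x : V ⊗[ℂ] A) (y : W ⊗[ℂ] A) :
    (Coalgebra.counit (R := ℂ) (A := A)).lTensor (V ⊗[ℂ] W) (mulTensor A V W (x ⊗ₜ y)) =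
      mulTensor ℂ V W ((Coalgebra.counit (R := ℂ) (A := A)).lTensor V x ⊗ₜ
        (Coalgebra.counit (R := ℂ) (A := A)).lTensor W y) := by
  induction x with
  | zero => simp
  | add x x' hx hx' => simp only [add_tmul, map_add, hx, hx']
  | tmul v a =>
    induction y with
    | zero => simp
    | add y y' hy hy' => simp only [tmul_add, map_add, hy, hy']
    | tmul w b => simp

theorem mulTensor_assoc {V W : Type} [AddCommGroup V] [Module ℂ V] [AddCommGroup W] [Module ℂ W]
    (x : (V ⊗[ℂ] A) ⊗[ℂ] A) (y : (W ⊗[ℂ] A) ⊗[ℂ] A) :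
    TensorProduct.assoc ℂ (V ⊗[ℂ] W) A A ((mulTensor A V W).rTensor A
      (mulTensor A (V ⊗[ℂ] A) (W ⊗[ℂ] A) (x ⊗ₜ y))) =
      mulTensor (A ⊗[ℂ] A) V W (TensorProduct.assoc ℂ V A A x ⊗ₜ TensorProduct.assoc ℂ W A A y) := by
  induction x with
  | zero => simp
  | add x x' hx hx' => simp only [add_tmul, map_add, hx, hx']
  | tmul x a =>
    induction x with
    | zero => simp
    | add x x' hx hx' => simp only [add_tmul, map_add, hx, hx']
    | tmul v a' =>
      induction y with
      | zero => simp
      | add y y' hy hy' => simp only [tmul_add, map_add, hy, hy']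
      | tmul y b =>
        induction y with
        | zero => simp
        | add y y' hy hy' => simp only [add_tmul, tmul_add, map_add, hy, hy']
        | tmul w b' => simp

theorem mulTensor_map {B V W V' W' : Type} [CommRing B] [Algebra ℂ B]
    [AddCommGroup V] [Module ℂ V] [AddCommGroup W] [Module ℂ W]
    [AddCommGroup V'] [Module ℂ V'] [AddCommGroup W'] [Module ℂ W']
    (f : V →ₗ[ℂ] V') (g : W →ₗ[ℂ] W') (x : V ⊗[ℂ] B) (y : W ⊗[ℂ] B) :
    mulTensor B V' W' (f.rTensor B x ⊗ₜ g.rTensor B y) =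
      (TensorProduct.map f g).rTensor B (mulTensor B V W (x ⊗ₜ y)) := by
  induction x with
  | zero => simp
  | add x x' hx hx' => simp only [add_tmul, map_add, hx, hx']
  | tmul v a =>
    induction y with
    | zero => simp
    | add y y' hy hy' => simp only [tmul_add, map_add, hy, hy']
    | tmul w b => simp

/-- The tensor product of representations. -/
def tensor (V W : FdComod A) : FdComod A where
  carrier := V ⊗[ℂ] W
  coact := mulTensor A V W ∘ₗ TensorProduct.map V.coact W.coact
  coassoc x := by
    induction x with
    | zero => simp
    | add x y hx hy => simp only [map_add, hx, hy]
    | tmul v w =>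
      rw [LinearMap.comp_apply, TensorProduct.map_tmul, mulTensor_comul, ← V.coassoc, ← W.coassoc,
        ← mulTensor_assoc, mulTensor_map, LinearMap.rTensor_comp, LinearMap.comp_apply]
  counit x := by
    induction x with
    | zero => simp
    | add x y hx hy => simp only [map_add, hx, hy, add_tmul]
    | tmul v w =>
      rw [LinearMap.comp_apply, TensorProduct.map_tmul, mulTensor_counit, V.counit, W.counit]
      simp

/-- The trivial one-dimensional representation. -/
def unit : FdComod A where
  carrier := ℂ
  coact := (TensorProduct.mk ℂ ℂ A).flip 1
  coassoc v := by simp [Algebra.TensorProduct.one_def]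
  counit v := by simp

/-- The tensor product of two morphisms. -/
def tensorMap {V V' W W' : FdComod A} (f : V ⟶ V') (g : W ⟶ W') : tensor V W ⟶ tensor V' W' where
  lin := TensorProduct.map (Hom.lin f) (Hom.lin g)
  map_coact := by
    change ∀ x : V ⊗[ℂ] W, mulTensor A V' W' (TensorProduct.map V'.coact W'.coact
        (TensorProduct.map f.lin g.lin x)) = (TensorProduct.map f.lin g.lin).rTensor A
          (mulTensor A V W (TensorProduct.map V.coact W.coact x))
    intro x
    induction x with
    | zero => simp
    | add x y hx hy => simp only [map_add, hx, hy]
    | tmul v w => simp [f.map_coact, g.map_coact, mulTensor_map]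

theorem mulTensor_mulTensor {U V W : Type} [AddCommGroup U] [Module ℂ U] [AddCommGroup V]
    [Module ℂ V] [AddCommGroup W] [Module ℂ W] (x : U ⊗[ℂ] A) (y : V ⊗[ℂ] A) (z : W ⊗[ℂ] A) :
    mulTensor A U (V ⊗[ℂ] W) (x ⊗ₜ mulTensor A V W (y ⊗ₜ z)) =
      (TensorProduct.assoc ℂ U V W).toLinearMap.rTensor A
        (mulTensor A (U ⊗[ℂ] V) W (mulTensor A U V (x ⊗ₜ y) ⊗ₜ z)) := by
  induction x with
  | zero => simp
  | add x x' hx hx' => simp only [add_tmul, map_add, hx, hx']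
  | tmul u a =>
    induction y with
    | zero => simp
    | add y y' hy hy' => simp only [add_tmul, tmul_add, map_add, hy, hy']
    | tmul v b =>
      induction z with
      | zero => simp
      | add z z' hz hz' => simp only [tmul_add, map_add, hz, hz']
      | tmul w c => simp [mul_assoc]

theorem mulTensor_comm {V W : Type} [AddCommGroup V] [Module ℂ V] [AddCommGroup W] [Module ℂ W]
    (x : V ⊗[ℂ] A) (y : W ⊗[ℂ] A) :
    mulTensor A W V (y ⊗ₜ x) =
      (TensorProduct.comm ℂ V W).toLinearMap.rTensor A (mulTensor A V W (x ⊗ₜ y)) := by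
  induction x with
  | zero => simp
  | add x x' hx hx' => simp only [add_tmul, tmul_add, map_add, hx, hx']
  | tmul v a =>
    induction y with
    | zero => simp
    | add y y' hy hy' => simp only [add_tmul, tmul_add, map_add, hy, hy']
    | tmul w b => simp [mul_comm]

theorem mulTensor_one_left {V : Type} [AddCommGroup V] [Module ℂ V] (c : ℂ) (x : V ⊗[ℂ] A) :
    (TensorProduct.lid ℂ V).toLinearMap.rTensor A
      (mulTensor A ℂ V ((c ⊗ₜ[ℂ] (1 : A)) ⊗ₜ x)) = c • x := by
  induction x with
  | zero => simp
  | add x x' hx hx' => simp only [tmul_add, map_add, hx, hx', smul_add]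
  | tmul v a => simp [smul_tmul']

theorem mulTensor_one_right {V : Type} [AddCommGroup V] [Module ℂ V] (c : ℂ) (x : V ⊗[ℂ] A) :
    (TensorProduct.rid ℂ V).toLinearMap.rTensor A
      (mulTensor A V ℂ (x ⊗ₜ (c ⊗ₜ[ℂ] (1 : A)))) = c • x := by
  induction x with
  | zero => simp
  | add x x' hx hx' => simp only [add_tmul, map_add, hx, hx', smul_add]
  | tmul v a => simp [smul_tmul']

/-- The associativity isomorphism. -/
def assocIso (U V W : FdComod A) : tensor (tensor U V) W ≅ tensor U (tensor V W) :=
  isoMk (V := tensor (tensor U V) W) (W := tensor U (tensor V W)) (TensorProduct.assoc ℂ U V W) (by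
    change ∀ x : (U ⊗[ℂ] V) ⊗[ℂ] W, mulTensor A U (V ⊗[ℂ] W)
      (TensorProduct.map U.coact (mulTensor A V W ∘ₗ TensorProduct.map V.coact W.coact)
        (TensorProduct.assoc ℂ U V W x)) = (TensorProduct.assoc ℂ U V W).toLinearMap.rTensor A
        (mulTensor A (U ⊗[ℂ] V) W (TensorProduct.map
          (mulTensor A U V ∘ₗ TensorProduct.map U.coact V.coact) W.coact x))
    intro x
    induction x with
    | zero => simp
    | add x y hx hy => simp only [map_add, hx, hy]
    | tmul x w =>
      induction x with
      | zero => simp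
      | add x y hx hy => simp only [map_add, add_tmul, hx, hy]
      | tmul u v => simp [mulTensor_mulTensor])

/-- The symmetry isomorphism. -/
def commIso (V W : FdComod A) : tensor V W ≅ tensor W V :=
  isoMk (V := tensor V W) (W := tensor W V) (TensorProduct.comm ℂ V W) (by
    change ∀ x : V ⊗[ℂ] W, mulTensor A W V (TensorProduct.map W.coact V.coact
      (TensorProduct.comm ℂ V W x)) = (TensorProduct.comm ℂ V W).toLinearMap.rTensor A
        (mulTensor A V W (TensorProduct.map V.coact W.coact x))
    intro x
    induction x with
    | zero => simp
    | add x y hx hy => simp only [map_add, hx, hy]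
    | tmul v w => exact mulTensor_comm (V.coact v) (W.coact w))

/-- The left unit isomorphism. -/
def leftUnitIso (V : FdComod A) : tensor unit V ≅ V :=
  isoMk (V := tensor unit V) (W := V) (TensorProduct.lid ℂ V) (by
    change ∀ x : ℂ ⊗[ℂ] V, V.coact (TensorProduct.lid ℂ V x) =
      (TensorProduct.lid ℂ V).toLinearMap.rTensor A (mulTensor A ℂ V
        (TensorProduct.map ((TensorProduct.mk ℂ ℂ A).flip 1) V.coact x))
    intro x
    induction x with
    | zero => simp
    | add x y hx hy => simp only [map_add, hx, hy]
    | tmul c v => simp [mulTensor_one_left])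

/-- The right unit isomorphism. -/
def rightUnitIso (V : FdComod A) : tensor V unit ≅ V :=
  isoMk (V := tensor V unit) (W := V) (TensorProduct.rid ℂ V) (by
    change ∀ x : V ⊗[ℂ] ℂ, V.coact (TensorProduct.rid ℂ V x) =
      (TensorProduct.rid ℂ V).toLinearMap.rTensor A (mulTensor A V ℂ
        (TensorProduct.map V.coact ((TensorProduct.mk ℂ ℂ A).flip 1) x))
    intro x
    induction x with
    | zero => simp
    | add x y hx hy => simp only [map_add, hx, hy]
    | tmul v c => simp [mulTensor_one_right])

instance : MonoidalCategoryStruct (FdComod A) where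
  tensorObj := tensor
  tensorUnit := unit
  tensorHom := tensorMap
  whiskerLeft V _ _ f := tensorMap (𝟙 V) f
  whiskerRight f W := tensorMap f (𝟙 W)
  associator := assocIso
  leftUnitor := leftUnitIso
  rightUnitor := rightUnitIso

/-- The forgetful functor to vector spaces preserves the tensor operations on the nose. -/
def inducingData : Monoidal.InducingFunctorData (forgetComod A) where
  μIso _ _ := Iso.refl _
  εIso := Iso.refl _
  whiskerLeft_eq _ _ _ _ := by ext1; exact TensorProduct.ext rfl
  whiskerRight_eq _ _ := by ext1; exact TensorProduct.ext rfl
  tensorHom_eq _ _ := by ext1; exact TensorProduct.ext rfl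
  associator_eq _ _ _ := by ext1; exact TensorProduct.ext (TensorProduct.ext rfl)
  leftUnitor_eq _ := by ext1; exact TensorProduct.ext rfl
  rightUnitor_eq _ := by ext1; exact TensorProduct.ext rfl

instance : MonoidalCategory (FdComod A) := Monoidal.induced (forgetComod A) inducingData

instance : (forgetComod A).Monoidal := Monoidal.fromInducedMonoidal (forgetComod A) inducingData

instance : BraidedCategory (FdComod A) :=
  BraidedCategory.ofFaithful (forgetComod A) commIso
    (fun V W => by ext1; exact TensorProduct.ext rfl)

end FdComod

end Comodule

/-- A function on the group `H` is representative if its right translates span a finite dimensional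
space, that is, if it is a matrix coefficient of a finite dimensional representation of `H`. -/
def IsRepresentative {H : Type} [Group H] (f : H → ℂ) : Prop :=
  Module.Finite ℂ (Submodule.span ℂ (Set.range fun h : H => fun x : H => f (x * h)))

/-- The commutative Hopf algebra `A`, with elements viewed as functions on `H` by means of `ev`, is
the coordinate ring of the algebraic hull of the group `H`: it is the algebra of all representative
functions on `H`, with the comultiplication and counit dual to the group structure of `H`. -/
structure IsAlgebraicHull (H : Type) [Group H] (A : Type) [CommRing A] [HopfAlgebra ℂ A]
    (ev : A →ₐ[ℂ] (H → ℂ)) : Prop where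
  injective : Function.Injective ev
  range : ∀ f : H → ℂ, f ∈ Set.range ev ↔ IsRepresentative f
  counit : ∀ a, Coalgebra.counit (R := ℂ) a = ev a 1
  comul : ∀ a g h, LinearMap.mul' ℂ ℂ (TensorProduct.map (LinearMap.proj g ∘ₗ ev.toLinearMap)
    (LinearMap.proj h ∘ₗ ev.toLinearMap) (Coalgebra.comul (R := ℂ) a)) = ev a (g * h)

end EquivariantRH

end

set_option linter.unusedSectionVars false

noncomputable section

namespace EquivariantRH

/-! Pull everything back along the universal cover `t ↦ z exp(2πit)` of `ℂ*`. There `τ w d/dw`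
becomes `(τ/2πi) d/dt` on the ring `Ent z` of entire functions. A linear equation with entire
coefficients has a full set of entire solutions (`exists_hasDerivAt_eq_mul`), so a module of rank
`n` acquires an `n`-dimensional space of solutions on the cover. Since `τ ≠ 0`, both entire
functions and germs have constants `ℂ`, and taking the germ at `t = 0` identifies this space with
`ω(M)`. The group `ℤ × θℤ` acts on the cover by translations: `ℤ` is the deck group and `θℤ` lifts
the rotations `α`. Combined with `σ`, which commutes with `∇`, this makes the solutions on the cover
a representation of `ℤ × θℤ`, the monodromy together with the equivariant structure (`toFDRep`).

The functor is fully faithful by descent. An equivariant map of solution spaces extends linearly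
over entire functions, and the extension commutes with `∇` and with translations. Functions
invariant under the deck group are functions on `ℂ*`, so the extension comes from a unique morphism
of the free modules below (`exists_hom_of_equivariant`).

It is essentially surjective because an invertible matrix has a logarithm. Given commuting operators
`ρ(m, g)` on `V`, write `T = ρ(1, 0)` as `E(1)` for a holomorphic one-parameter group `E` that
commutes with everything commuting with `T`. The functions `E(t) v` are then the solutions of an
equation with constant coefficients on `𝒪(ℂ*) ⊗ V`, which is visibly regular singular, and the
action of `g` on this module can be adjusted so that the given representation results
(`exists_objBqTau_of_rep`).

The tensor structure of `ω` is multiplication of solutions. It is bijective because products of two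
solution bases form a solution basis. A tensor structure on the equivalence needs no coherence
computation: the structure maps have to be lifted along the faithful forgetful functor, and all
axioms are then inherited (`exists_braided_of_lift`). The Tannakian properties of `B_q^τ` are
transported from representations, with `End 1 = ℂ` read off from `ω`.

Irrationality of `θ` enters only in comparing groups: `ℤ × θℤ` and `ℤ + θℤ` are both `ℤ²`. For the
algebraic hull, representative functions are the matrix coefficients. They form a Hopf algebra `A`
whose elements are separated by the points of the group, so an element of `V ⊗ A` is the same as a
certain `V`-valued function on the group, and a coaction is the same as a representation. -/

section

/-! ### Lifting tensor structures along a faithful functor -/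

section MonoidalLift

open Functor.LaxMonoidal Functor.OplaxMonoidal

variable {C D V : Type*} [Category* C] [Category* D] [Category* V] [MonoidalCategory C]
  [MonoidalCategory D] [MonoidalCategory V]

/-- A monoidal structure on `e ⋙ F'`, with `F'` faithful monoidal and reflecting isomorphisms, whose
structure morphisms lift along `F'`, comes from a monoidal structure on `e`. -/
theorem exists_coreMonoidal_of_lift (F' : D ⥤ V) [F'.Monoidal] [F'.Faithful]
    [F'.ReflectsIsomorphisms] (e : C ⥤ D) (c : (e ⋙ F').CoreMonoidal)
    (hε : ∃ m : 𝟙_ D ⟶ e.obj (𝟙_ C), F'.map m = η F' ≫ c.εIso.hom)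
    (hμ : ∀ X Y, ∃ m : e.obj X ⊗ e.obj Y ⟶ e.obj (X ⊗ Y),
      F'.map m = δ F' _ _ ≫ (c.μIso X Y).hom) :
    ∃ c' : e.CoreMonoidal, F'.map c'.εIso.hom = η F' ≫ c.εIso.hom ∧
      ∀ X Y, F'.map (c'.μIso X Y).hom = δ F' _ _ ≫ (c.μIso X Y).hom := by
  obtain ⟨ε', hε'⟩ := hε
  choose μ' hμ' using hμ
  -- The images of the lifts are composites of isomorphisms, and `F'` reflects isomorphisms.
  have hε'' : IsIso ε' := by
    have : IsIso (F'.map ε') := by rw [hε']; infer_instance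
    exact isIso_of_reflects_iso ε' F'
  have hμ'' : ∀ X Y, IsIso (μ' X Y) := fun X Y => by
    have : IsIso (F'.map (μ' X Y)) := by rw [hμ']; infer_instance
    exact isIso_of_reflects_iso (μ' X Y) F'
  refine ⟨{
    εIso := asIso ε'
    μIso X Y := asIso (μ' X Y)
    μIso_hom_natural_left := ?_
    μIso_hom_natural_right := ?_
    associativity := ?_
    left_unitality := ?_
    right_unitality := ?_ }, hε', hμ'⟩
  · intro X Y f Z
    apply F'.map_injective
    have := c.μIso_hom_natural_left f Z
    dsimp at this
    simp [hμ', ← this]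
  · intro X Y Z f
    apply F'.map_injective
    have := c.μIso_hom_natural_right Z f
    dsimp at this
    simp [hμ', ← this]
  · intro X Y Z
    apply F'.map_injective
    have := c.associativity X Y Z
    dsimp at this
    rw [Functor.map_comp, Functor.map_comp, Functor.map_comp, Functor.map_comp,
      Functor.Monoidal.map_whiskerRight, Functor.Monoidal.map_whiskerLeft,
      Functor.Monoidal.map_associator F', asIso_hom, asIso_hom, asIso_hom, asIso_hom, hμ', hμ',
      hμ', hμ']
    simp only [Category.assoc, Functor.Monoidal.μ_δ_assoc, MonoidalCategory.comp_whiskerRight,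
      MonoidalCategory.whiskerLeft_comp, this, Functor.Monoidal.whiskerLeft_μ_δ_assoc]
  · intro X
    apply F'.map_injective
    have := c.left_unitality X
    dsimp at this
    simp [hμ', hε', Functor.Monoidal.map_whiskerRight,
      Functor.Monoidal.map_leftUnitor, this]
  · intro X
    apply F'.map_injective
    have := c.right_unitality X
    dsimp at this
    simp [hμ', hε', Functor.Monoidal.map_whiskerLeft,
      Functor.Monoidal.map_rightUnitor, this]

/-- The axioms of a braided tensor functor are equations between morphisms, and a faithful `F'`
allows them to be checked after applying it, where they become the axioms of `F` transported along
`i`. Hence a symmetric tensor structure on `e` costs no more than lifting the unit map and the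
multiplication maps. -/
theorem exists_braided_of_lift [BraidedCategory C] [BraidedCategory D] [BraidedCategory V]
    (F : C ⥤ V) [F.Braided] (F' : D ⥤ V) [F'.Braided] [F'.Faithful]
    [F'.ReflectsIsomorphisms] (e : C ⥤ D) (i : e ⋙ F' ≅ F)
    (hε : ∃ m : 𝟙_ D ⟶ e.obj (𝟙_ C), ε F' ≫ F'.map m ≫ i.hom.app _ = ε F)
    (hμ : ∀ X Y, ∃ m : e.obj X ⊗ e.obj Y ⟶ e.obj (X ⊗ Y),
      μ F' _ _ ≫ F'.map m ≫ i.hom.app (X ⊗ Y) = (i.hom.app X ⊗ₘ i.hom.app Y) ≫ μ F X Y) :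
    ∃ _ : e.Braided, NatTrans.IsMonoidal i.hom := by
  obtain ⟨c', h1, h2⟩ := exists_coreMonoidal_of_lift F' e
    (Functor.Monoidal.coreMonoidalTransport i.symm)
    (by
      obtain ⟨m, hm⟩ := hε
      exact ⟨m, by simp [Functor.Monoidal.coreMonoidalTransport, ← hm]⟩)
    (fun X Y => by
      obtain ⟨m, hm⟩ := hμ X Y
      refine ⟨m, ?_⟩
      have hm' := (Iso.eq_comp_inv (i.app (X ⊗ Y))).2 ((Category.assoc _ _ _).trans hm)
      dsimp at hm'
      rw [Category.assoc] at hm'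
      simp [Functor.Monoidal.coreMonoidalTransport, ← hm'])
  simp [Functor.Monoidal.coreMonoidalTransport] at h1 h2
  let _ : e.Monoidal := c'.toMonoidal
  have k1 : ε e = c'.εIso.hom := rfl
  have k2 : ∀ X Y, μ e X Y = (c'.μIso X Y).hom := fun _ _ => rfl
  refine ⟨{ braided := fun X Y => ?_ }, ?_⟩
  · apply F'.map_injective
    rw [k2, k2]
    -- Naturality of `i` at the braiding; the rest of the square is the compatibility of `F` and of
    -- `F'` with braidings.
    have hb : μ F X Y ≫ i.inv.app (X ⊗ Y) ≫ F'.map (e.map (β_ X Y).hom) =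
        μ F X Y ≫ F.map (β_ X Y).hom ≫ i.inv.app (Y ⊗ X) := by
      have := i.inv.naturality (β_ X Y).hom
      dsimp at this
      rw [this]
    simp [h2, Functor.map_braiding, hb]
  · constructor
    · simp [k1, h1]
    · intro X Y
      simp [k2, h2]

end MonoidalLift

/-! ### Tensor equivalences over a base category -/

section TensorEquivalentOver

variable {C D E V : Type 1} [Category.{0} C] [Category.{0} D] [Category.{0} E] [Category.{0} V]
  [MonoidalCategory C] [MonoidalCategory D] [MonoidalCategory E] [MonoidalCategory V]
  [BraidedCategory C] [BraidedCategory D] [BraidedCategory E]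

theorem TensorEquivalentOver.trans {F : C ⥤ V} [F.Monoidal] {F' : D ⥤ V} [F'.Monoidal]
    {F'' : E ⥤ V} [F''.Monoidal] (h : TensorEquivalentOver F F') (h' : TensorEquivalentOver F' F'') :
    TensorEquivalentOver F F'' := by
  obtain ⟨e, he, i, hi⟩ := h
  obtain ⟨e', he', i', hi'⟩ := h'
  refine ⟨e.trans e', inferInstanceAs (e.functor ⋙ e'.functor).Braided,
    Functor.associator _ _ _ ≪≫ Functor.isoWhiskerLeft e.functor i' ≪≫ i, ?_⟩
  change NatTrans.IsMonoidal ((Functor.associator e.functor e'.functor F'').hom ≫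
    Functor.whiskerLeft e.functor i'.hom ≫ i.hom)
  infer_instance

/-- The common form of the three comparisons below: isomorphic groups, solutions against
representations, and representations against comodules. In each case the structure maps are known on
underlying spaces, and it remains to see that they are morphisms. -/
theorem TensorEquivalentOver.of_lift [BraidedCategory V] {F : C ⥤ V} [F.Braided] {F' : D ⥤ V}
    [F'.Braided] [F'.Faithful] [F'.ReflectsIsomorphisms] (e : C ⥤ D) [e.IsEquivalence]
    (i : e ⋙ F' ≅ F)
    (hε : ∃ m : 𝟙_ D ⟶ e.obj (𝟙_ C), Functor.LaxMonoidal.ε F' ≫ F'.map m ≫ i.hom.app _ =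
       Functor.LaxMonoidal.ε F)
    (hμ : ∀ X Y, ∃ m : e.obj X ⊗ e.obj Y ⟶ e.obj (X ⊗ Y),
      Functor.LaxMonoidal.μ F' _ _ ≫ F'.map m ≫ i.hom.app (X ⊗ Y) =
        (i.hom.app X ⊗ₘ i.hom.app Y) ≫ Functor.LaxMonoidal.μ F X Y) :
    TensorEquivalentOver F F' := by
  obtain ⟨h, hi⟩ := exists_braided_of_lift F F' e i hε hμ
  exact ⟨e.asEquivalence, h, i, hi⟩

end TensorEquivalentOver

/-! ### Representations of a group, and transport of the Tannakian properties -/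

section Representations

variable {H : Type} [Group H]

instance : (forgetRep H).Faithful := Functor.Faithful.comp _ _

theorem preservesFiniteLimits_forgetRep : Limits.PreservesFiniteLimits (forgetRep H) :=
  Limits.comp_preservesFiniteLimits _ _

theorem preservesFiniteColimits_forgetRep : Limits.PreservesFiniteColimits (forgetRep H) :=
  Limits.comp_preservesFiniteColimits _ _

instance : (forgetRep H).ReflectsIsomorphisms :=
  inferInstanceAs (Action.forget (FGModuleCat ℂ) H ⋙
    forget₂ (FGModuleCat ℂ) (ModuleCat ℂ)).ReflectsIsomorphisms

variable (H) in
/-- The forgetful functor from representations to vector spaces is a symmetric tensor functor. -/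
abbrev forgetRepBraided : (forgetRep H).Braided where
  braided V W :=
    let _ : (forget₂ (FGModuleCat ℂ) (ModuleCat ℂ)).Braided :=
      inferInstanceAs (ModuleCat.isFG ℂ).ι.Braided
    (inferInstance : (Action.forget (FGModuleCat ℂ) H ⋙
      forget₂ (FGModuleCat ℂ) (ModuleCat ℂ)).Braided).braided V W

/-- Isomorphic groups have tensor equivalent categories of representations. -/
theorem TensorEquivalentOver.of_mulEquiv {H' : Type} [Group H'] (f : H' ≃* H) :
    TensorEquivalentOver (forgetRep H) (forgetRep H') := by
  have : (Action.res (FGModuleCat ℂ) (f : H' →* H)).IsEquivalence :=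
    (Action.resEquiv (FGModuleCat ℂ) f).isEquivalence_functor
  let _ := forgetRepBraided H
  let _ := forgetRepBraided H'
  refine .of_lift (F := forgetRep H) (Action.res (FGModuleCat ℂ) (f : H' →* H)) (Iso.refl _) ?_ ?_
  · exact ⟨⟨𝟙 _, fun g => by simp; rfl⟩, by simp; rfl⟩
  · intro X Y
    exact ⟨⟨𝟙 _, fun g => by simp; rfl⟩, by ext1; exact TensorProduct.ext' fun x y => rfl⟩

/-- A linear symmetric tensor category over vector spaces that is tensor equivalent to the category
of representations of a group is neutral Tannakian. -/
theorem IsNeutralTannakian.of_tensorEquivalentOver {C : Type 1} [Category.{0} C] [Preadditive C]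
    [Linear ℂ C] [MonoidalCategory C] [SymmetricCategory C] [MonoidalPreadditive C]
    [MonoidalLinear ℂ C] (ω : C ⥤ ModuleCat.{0} ℂ) [ω.Braided] [ω.Additive] [ω.Linear ℂ]
    (h : TensorEquivalentOver ω (forgetRep H)) : IsNeutralTannakian ℂ ω := by
  obtain ⟨e, _, i, _⟩ := h
  have hprod : Limits.HasFiniteProducts C :=
    ⟨fun n => Adjunction.hasLimitsOfShape_of_equivalence e.functor⟩
  let _ : Abelian C := abelianOfEquivalence e.functor
  let _ := e.inverseMonoidal
  -- Right duals of representations are available; the braiding turns them into left duals.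
  let _ : RigidCategory (FDRep ℂ H) := BraidedCategory.rigidCategoryOfRightRigidCategory
  have hfaithful : ω.Faithful := Functor.Faithful.of_iso i
  have hlim : Limits.PreservesFiniteLimits (forgetRep H) := preservesFiniteLimits_forgetRep
  have hcolim : Limits.PreservesFiniteColimits (forgetRep H) := preservesFiniteColimits_forgetRep
  -- `ω` sends the unit object to a line, whose endomorphisms are scalars. Faithfulness and
  -- linearity of `ω` then give `End 1 = ℂ`.
  have hunit (f : ω.obj (𝟙_ C) ⟶ ω.obj (𝟙_ C)) : ∃ c : ℂ, f = c • 𝟙 _ := by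
    let f' : 𝟙_ (ModuleCat ℂ) ⟶ 𝟙_ (ModuleCat ℂ) :=
      Functor.LaxMonoidal.ε ω ≫ f ≫ Functor.OplaxMonoidal.η ω
    have hf : f = Functor.OplaxMonoidal.η ω ≫ f' ≫ Functor.LaxMonoidal.ε ω := by simp [f']
    refine ⟨f'.hom (1 : ℂ), ?_⟩
    have hf' : f' = (f'.hom (1 : ℂ) : ℂ) • 𝟙 _ := by
      ext1
      refine LinearMap.ext_ring ?_
      change f'.hom (1 : ℂ) = (f'.hom (1 : ℂ) : ℂ) * 1
      rw [mul_one]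
    rw [hf, hf']
    simp
  exact {
    hasFiniteProducts := hprod
    hasKernels := inferInstance
    hasCokernels := inferInstance
    isNormalMonoCategory := inferInstance
    isNormalEpiCategory := inferInstance
    monoidalPreadditive := inferInstance
    monoidalLinear := inferInstance
    rigid := ⟨rigidCategoryOfEquivalence e.toAdjunction⟩
    endUnit := by
      constructor
      · intro c d hcd
        have h1 : ω.map (c • 𝟙 (𝟙_ C)) = ω.map (d • 𝟙 (𝟙_ C)) := congrArg _ hcd
        have h2 : Functor.LaxMonoidal.ε ω ≫ ω.map (c • 𝟙 (𝟙_ C)) ≫ Functor.OplaxMonoidal.η ω =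
          Functor.LaxMonoidal.ε ω ≫ ω.map (d • 𝟙 (𝟙_ C)) ≫ Functor.OplaxMonoidal.η ω := by rw [h1]
        simp only [Functor.map_smul, CategoryTheory.Functor.map_id, Linear.smul_comp,
          Category.id_comp, Linear.comp_smul, Functor.Monoidal.ε_η] at h2
        have h3 := congrArg (fun f : 𝟙_ (ModuleCat.{0} ℂ) ⟶ 𝟙_ (ModuleCat ℂ) => f.hom (1 : ℂ)) h2
        change c * 1 = d * 1 at h3
        simpa using h3
      · intro f
        obtain ⟨c, hc⟩ := hunit (ω.map f)
        exact ⟨c, ω.map_injective (by simp [hc])⟩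
    additive := inferInstance
    linear := inferInstance
    faithful := hfaithful
    preservesFiniteLimits := Limits.preservesFiniteLimits_of_natIso i
    preservesFiniteColimits := Limits.preservesFiniteColimits_of_natIso i
    finite := fun X =>
      have : Module.Finite ℂ ((e.functor ⋙ forgetRep H).obj X) :=
        inferInstanceAs (Module.Finite ℂ (e.functor.obj X).V)
      Module.Finite.equiv (i.app X).toLinearEquiv }

end Representations

end

section

namespace EqDiffMod

variable {R G : Type} [CommRing R] [Algebra ℂ R] [Group G]
  {δ : Derivation ℂ R R} {α : G →* (R ≃ₐ[ℂ] R)}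

/-! ### Horizontal bases over a differential ring with constants `ℂ` -/

section HorizontalBasis

variable {S : Type} [CommRing S] [Algebra ℂ S] [Algebra R S] [IsScalarTower ℂ R S]
  (δS : Derivation ℂ S S) [ExtendsDerivation δ δS]

theorem extendedConnection_smul (M : EqDiffMod δ α) (s : S) (x : S ⊗[R] M) :
    extendedConnection δS M (s • x) = δS s • x + s • extendedConnection δS M x := by
  induction x with
  | zero => simp
  | add x y hx hy => simp only [smul_add, map_add, hx, hy]; abel
  | tmul t m => simp [smul_tmul', add_tmul, mul_comm t]; abel

/-- The constants of the derivation `δS` are the elements of `ℂ`. -/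
class HasTrivialConstants (δS : Derivation ℂ S S) : Prop extends Nontrivial S where
  exists_algebraMap : ∀ s : S, δS s = 0 → ∃ c : ℂ, algebraMap ℂ S c = s

variable {δS}

/-- A basis of `S ⊗ M` consisting of horizontal elements is a basis of the space of all horizontal
elements. -/
def kerBasis [HasTrivialConstants δS] {M : EqDiffMod δ α} {ι : Type} [Fintype ι]
    (b : Module.Basis ι S (S ⊗[R] M)) (hb : ∀ i, extendedConnection δS M (b i) = 0) :
    Module.Basis ι ℂ (LinearMap.ker (extendedConnection δS M)) :=
  Module.Basis.mk (v := fun i => ⟨b i, LinearMap.mem_ker.2 (hb i)⟩)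
    (by
      refine LinearIndependent.of_comp (Submodule.subtype _) ?_
      -- Independence over `S` gives independence over `ℂ` because `ℂ → S` is injective, `S` being
      -- nontrivial.
      refine b.linearIndependent.restrict_scalars ?_
      intro c d hcd
      simpa [← Algebra.algebraMap_eq_smul_one] using hcd)
    (by
      rintro ⟨x, hx⟩ -
      -- Applying the connection to `x = ∑ sᵢ bᵢ` with all `bᵢ` horizontal leaves `∑ δS(sᵢ) bᵢ = 0`.
      -- So the coordinates of a horizontal element are constants, hence complex numbers.
      have h0 : ∀ i, δS (b.repr x i) = 0 := by
        have h1 : extendedConnection δS M (∑ i, b.repr x i • b i) = 0 := by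
          rw [b.sum_repr]; exact hx
        rw [map_sum] at h1
        simp only [extendedConnection_smul, hb, smul_zero, add_zero] at h1
        exact Fintype.linearIndependent_iff.1 b.linearIndependent _ h1
      choose c hc using fun i => HasTrivialConstants.exists_algebraMap (δS := δS) _ (h0 i)
      have h2 : (⟨x, hx⟩ : LinearMap.ker (extendedConnection δS M)) =
          ∑ i, c i • ⟨b i, LinearMap.mem_ker.2 (hb i)⟩ := by
        apply Subtype.ext
        rw [Submodule.coe_sum]
        change x = _
        conv_lhs => rw [← b.sum_repr x]
        refine Finset.sum_congr rfl fun i _ => ?_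
        rw [← hc i, algebraMap_smul]
        rfl
      rw [h2]
      exact Submodule.sum_mem _ fun i _ => Submodule.smul_mem _ _ (Submodule.subset_span ⟨i, rfl⟩))

@[simp]
theorem coe_kerBasis [HasTrivialConstants δS] {M : EqDiffMod δ α} {ι : Type} [Fintype ι]
    (b : Module.Basis ι S (S ⊗[R] M)) (hb : ∀ i, extendedConnection δS M (b i) = 0) (i : ι) :
    (kerBasis b hb i : S ⊗[R] M) = b i := by
  simp [kerBasis]

variable (δS)

/-- `S ⊗ M` has a finite basis consisting of horizontal elements. -/
def HasHorizontalBasis (M : EqDiffMod δ α) : Prop :=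
  ∃ (n : ℕ) (b : Module.Basis (Fin n) S (S ⊗[R] M)), ∀ i, extendedConnection δS M (b i) = 0

variable {δS}

theorem HasHorizontalBasis.finite_ker [HasTrivialConstants δS] {M : EqDiffMod δ α}
    (h : HasHorizontalBasis δS M) : Module.Finite ℂ (LinearMap.ker (extendedConnection δS M)) := by
  obtain ⟨n, b, hb⟩ := h
  exact .of_basis (kerBasis b hb)

/-- Two `S`-linear maps out of `S ⊗ M` agree if they agree on horizontal elements. -/
theorem HasHorizontalBasis.linearMap_ext {M : EqDiffMod δ α} (h : HasHorizontalBasis δS M)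
    {P : Type*} [AddCommGroup P] [Module S P] {f g : S ⊗[R] M →ₗ[S] P}
    (hfg : ∀ x, extendedConnection δS M x = 0 → f x = g x) : f = g := by
  obtain ⟨n, b, hb⟩ := h
  exact b.ext fun i => hfg _ (hb i)

/-- A `ℂ`-linear map on horizontal elements extends to an `S`-linear map. -/
theorem HasHorizontalBasis.exists_extension [HasTrivialConstants δS] {M : EqDiffMod δ α}
    (h : HasHorizontalBasis δS M) {P : Type*} [AddCommGroup P] [Module ℂ P] [Module S P]
    [IsScalarTower ℂ S P] (φ : LinearMap.ker (extendedConnection δS M) →ₗ[ℂ] P) :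
    ∃ f : S ⊗[R] M →ₗ[S] P, ∀ x : LinearMap.ker (extendedConnection δS M), f x = φ x := by
  obtain ⟨n, b, hb⟩ := h
  refine ⟨b.constr S fun i => φ (kerBasis b hb i), fun x => ?_⟩
  have : ((b.constr S fun i => φ (kerBasis b hb i)).restrictScalars ℂ) ∘ₗ Submodule.subtype _ = φ :=
    (kerBasis b hb).ext fun i => by simp
  exact LinearMap.congr_fun this x

end HorizontalBasis

/-! ### Products of elements after extension of scalars -/

section TensorElements

variable {S : Type} [CommRing S] [Algebra ℂ S] [Algebra R S] [IsScalarTower ℂ R S]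

/-- The pure tensor `m ⊗ n`, as an element of the equivariant differential module `M ⊗ N`. -/
def pure {M N : EqDiffMod δ α} (m : M) (n : N) : tensor M N := m ⊗ₜ[R] n

/-- The product `(S ⊗ M) × (S ⊗ N) → S ⊗ (M ⊗ N)`, `(s ⊗ m, t ⊗ n) ↦ st ⊗ (m ⊗ n)`. -/
def mulElem {M N : EqDiffMod δ α} (x : S ⊗[R] M) (y : S ⊗[R] N) : S ⊗[R] tensor M N :=
  (TensorProduct.AlgebraTensorModule.distribBaseChange R S M N).symm (x ⊗ₜ[S] y)

variable {M N P : EqDiffMod δ α}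

@[simp]
theorem mulElem_tmul (s t : S) (m : M) (n : N) :
    mulElem (s ⊗ₜ[R] m) (t ⊗ₜ[R] n) = (s * t) ⊗ₜ[R] pure m n :=
  (TensorProduct.AlgebraTensorModule.distribBaseChange_symm_tmul _ _ _ _ _ _).trans rfl

@[simp]
theorem mulElem_zero_left (y : S ⊗[R] N) : mulElem (0 : S ⊗[R] M) y = 0 :=
  (congrArg _ (zero_tmul _ y)).trans (map_zero _)

@[simp]
theorem mulElem_zero_right (x : S ⊗[R] M) : mulElem x (0 : S ⊗[R] N) = 0 :=
  (congrArg _ (tmul_zero _ x)).trans (map_zero _)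

theorem mulElem_add_left (x x' : S ⊗[R] M) (y : S ⊗[R] N) :
    mulElem (x + x') y = mulElem x y + mulElem x' y :=
  (congrArg _ (add_tmul x x' y)).trans (map_add _ _ _)

theorem mulElem_add_right (x : S ⊗[R] M) (y y' : S ⊗[R] N) :
    mulElem x (y + y') = mulElem x y + mulElem x y' :=
  (congrArg _ (tmul_add x y y')).trans (map_add _ _ _)

/-- Induction on pairs of elements, for identities that are additive in both. -/
@[elab_as_elim]
theorem elem_induction₂ {p : S ⊗[R] M → S ⊗[R] N → Prop} (x : S ⊗[R] M) (y : S ⊗[R] N)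
    (zero_left : ∀ y, p 0 y) (zero_right : ∀ x, p x 0)
    (add_left : ∀ x x' y, p x y → p x' y → p (x + x') y)
    (add_right : ∀ x y y', p x y → p x y' → p x (y + y'))
    (tmul : ∀ s m t n, p (s ⊗ₜ m) (t ⊗ₜ n)) : p x y := by
  induction x with
  | zero => exact zero_left y
  | add x x' hx hx' => exact add_left _ _ _ hx hx'
  | tmul s m =>
    induction y with
    | zero => exact zero_right _
    | add y y' hy hy' => exact add_right _ _ _ hy hy'
    | tmul t n => exact tmul s m t n

theorem mulElem_smul_left (s : S) (x : S ⊗[R] M) (y : S ⊗[R] N) :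
    mulElem (s • x) y = s • mulElem x y := by
  induction x, y using elem_induction₂ with
  | zero_left y => simp
  | zero_right x => simp
  | add_left x x' y hx hx' => simp [mulElem_add_left, hx, hx']
  | add_right x y y' hx hx' => simp [mulElem_add_right, hx, hx']
  | tmul s m t n => simp [smul_tmul', mul_assoc]

theorem mulElem_smul_right (s : S) (x : S ⊗[R] M) (y : S ⊗[R] N) :
    mulElem x (s • y) = s • mulElem x y := by
  induction x, y using elem_induction₂ with
  | zero_left y => simp
  | zero_right x => simp
  | add_left x x' y hx hx' => simp [mulElem_add_left, hx, hx']
  | add_right x y y' hx hx' => simp [mulElem_add_right, hx, hx']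
  | tmul s m t n => simp [smul_tmul', mul_left_comm]

/-- The Leibniz rule for products. It is the reason why the product of two horizontal elements is
horizontal, which gives the fibre functor its tensor structure. -/
theorem extendedConnection_mulElem (δS : Derivation ℂ S S) [ExtendsDerivation δ δS]
    (x : S ⊗[R] M) (y : S ⊗[R] N) :
    extendedConnection δS (tensor M N) (mulElem x y) =
      mulElem (extendedConnection δS M x) y + mulElem x (extendedConnection δS N y) := by
  induction x, y using elem_induction₂ with
  | zero_left y => simp
  | zero_right x => simp
  | add_left x x' y hx hx' => simp only [mulElem_add_left, map_add, hx, hx']; abel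
  | add_right x y y' hx hx' => simp only [mulElem_add_right, map_add, hx, hx']; abel
  | tmul s m t n =>
    have h : (tensor M N).conn (pure m n) = pure (M.conn m) n + pure m (N.conn n) := rfl
    simp only [mulElem_tmul, Derivation.leibniz, smul_eq_mul, extendedConnection_tmul,
      mulElem_add_left, mulElem_add_right, add_tmul, tmul_add, mul_comm t, h]
    abel

@[simp]
theorem extendMap_id (x : S ⊗[R] M) : extendMap S (𝟙 M) x = x := by
  induction x with
  | zero => simp
  | add x y hx hy => simp only [map_add, hx, hy]
  | tmul s m => simp

theorem extendMap_tensorMap_mulElem {M' N' : EqDiffMod δ α} (f : M ⟶ M') (g : N ⟶ N')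
    (x : S ⊗[R] M) (y : S ⊗[R] N) :
    extendMap S (tensorMap f g) (mulElem x y) = mulElem (extendMap S f x) (extendMap S g y) := by
  induction x, y using elem_induction₂ with
  | zero_left y => simp
  | zero_right x => simp
  | add_left x x' y hx hx' => simp only [mulElem_add_left, map_add, hx, hx']
  | add_right x y y' hx hx' => simp only [mulElem_add_right, map_add, hx, hx']
  | tmul s m t n =>
    simp only [extendMap_tmul, mulElem_tmul]
    rfl

/-- Checked on pure tensors. This and the analogous identities for the symmetry and the units,
restricted to horizontal elements, are the axioms of a symmetric tensor functor. -/
theorem extendMap_assocIso_mulElem (x : S ⊗[R] M) (y : S ⊗[R] N) (w : S ⊗[R] P) :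
    extendMap S (assocIso M N P).hom (mulElem (mulElem x y) w) =
      mulElem x (mulElem y w) := by
  induction x, y using elem_induction₂ with
  | zero_left y => simp
  | zero_right x => simp
  | add_left x x' y hx hx' => simp only [mulElem_add_left, map_add, hx, hx']
  | add_right x y y' hx hx' => simp only [mulElem_add_left, mulElem_add_right, map_add, hx, hx']
  | tmul s m t n =>
    induction w with
    | zero => simp
    | add w w' hw hw' => simp only [mulElem_add_right, map_add, hw, hw']
    | tmul r p =>
      simp only [extendMap_tmul, mulElem_tmul, ← mul_assoc]
      rfl

theorem extendMap_commIso_mulElem (x : S ⊗[R] M) (y : S ⊗[R] N) :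
    extendMap S (commIso M N).hom (mulElem x y) = mulElem y x := by
  induction x, y using elem_induction₂ with
  | zero_left y => simp
  | zero_right x => simp
  | add_left x x' y hx hx' => simp only [mulElem_add_left, mulElem_add_right, map_add, hx, hx']
  | add_right x y y' hx hx' => simp only [mulElem_add_left, mulElem_add_right, map_add, hx, hx']
  | tmul s m t n =>
    rw [mulElem_tmul, mulElem_tmul, mul_comm t s]
    rfl

variable [IsEquivariantDerivation δ α]

/-- The element `1` of the unit object. -/
def unitOne (δ : Derivation ℂ R R) (α : G →* (R ≃ₐ[ℂ] R)) [IsEquivariantDerivation δ α] :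
    unit (δ := δ) (α := α) := (1 : R)

theorem conn_unitOne : (unit (δ := δ) (α := α)).conn (unitOne δ α) = 0 :=
  δ.map_one_eq_zero

theorem extendMap_leftUnitIso_mulElem (s : S) (x : S ⊗[R] M) :
    extendMap S (leftUnitIso M).hom (mulElem (s ⊗ₜ[R] unitOne δ α) x) = s • x := by
  induction x with
  | zero => simp
  | add x y hx hy => simp only [mulElem_add_right, map_add, hx, hy, smul_add]
  | tmul t m =>
    rw [mulElem_tmul, extendMap_tmul, smul_tmul', smul_eq_mul]
    exact congrArg _ (one_smul R m)

theorem extendMap_rightUnitIso_mulElem (s : S) (x : S ⊗[R] M) :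
    extendMap S (rightUnitIso M).hom (mulElem x (s ⊗ₜ[R] unitOne δ α)) = s • x := by
  induction x with
  | zero => simp
  | add x y hx hy => simp only [mulElem_add_left, map_add, hx, hy, smul_add]
  | tmul t m =>
    rw [mulElem_tmul, extendMap_tmul, smul_tmul', smul_eq_mul, mul_comm]
    exact congrArg _ (one_smul R m)

end TensorElements

/-! ### Horizontal elements as a symmetric tensor functor -/

section HorizontalMonoidal

variable {S : Type} [CommRing S] [Algebra ℂ S] [Algebra R S] [IsScalarTower ℂ R S]
  (δS : Derivation ℂ S S) [ExtendsDerivation δ δS]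

/-- The multiplication `ker ∇ ⊗ ker ∇' → ker (∇ ⊗ 1 + 1 ⊗ ∇')` of horizontal elements. -/
def horizontalMul (M N : EqDiffMod δ α) :
    LinearMap.ker (extendedConnection δS M) ⊗[ℂ] LinearMap.ker (extendedConnection δS N) →ₗ[ℂ]
      LinearMap.ker (extendedConnection δS (tensor M N)) :=
  TensorProduct.lift (LinearMap.mk₂ ℂ
    (fun x y => ⟨mulElem x.1 y.1, by
      rw [LinearMap.mem_ker, extendedConnection_mulElem, LinearMap.mem_ker.1 x.2,
        LinearMap.mem_ker.1 y.2, mulElem_zero_left, mulElem_zero_right, add_zero]⟩)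
    (fun x x' y => Subtype.ext (mulElem_add_left x.1 x'.1 y.1))
    (fun c x y => Subtype.ext (by
      simpa [algebraMap_smul] using mulElem_smul_left (algebraMap ℂ S c) x.1 y.1))
    (fun x y y' => Subtype.ext (mulElem_add_right x.1 y.1 y'.1))
    (fun c x y => Subtype.ext (by
      simpa [algebraMap_smul] using mulElem_smul_right (algebraMap ℂ S c) x.1 y.1)))

@[simp]
theorem coe_horizontalMul_tmul {M N : EqDiffMod δ α}
    (x : LinearMap.ker (extendedConnection δS M)) (y : LinearMap.ker (extendedConnection δS N)) :
    (horizontalMul δS M N (x ⊗ₜ y)).1 = mulElem x.1 y.1 := rfl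

variable {δS} in
-- The products of two horizontal bases are horizontal and form an `S`-basis of `S ⊗ (M ⊗ N)`, hence
-- a `ℂ`-basis of its horizontal elements. The map therefore carries a basis to a basis.
theorem horizontalMul_bijective [HasTrivialConstants δS] {M N : EqDiffMod δ α}
    (hM : HasHorizontalBasis δS M) (hN : HasHorizontalBasis δS N) :
    Function.Bijective (horizontalMul δS M N) := by
  obtain ⟨m, b, hb⟩ := hM
  obtain ⟨n, b', hb'⟩ := hN
  let B : Module.Basis (Fin m × Fin n) S (S ⊗[R] (tensor M N)) := (b.tensorProduct b').map
    (TensorProduct.AlgebraTensorModule.distribBaseChange R S M N).symm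
  have hB' : ∀ i, B i = mulElem (b i.1) (b' i.2) := fun i =>
    (Module.Basis.map_apply _ _ _).trans (congrArg _ (Module.Basis.tensorProduct_apply' _ _ _))
  have hB : ∀ i, extendedConnection δS (tensor M N) (B i) = 0 := fun i => by
    rw [hB', extendedConnection_mulElem, hb, hb', mulElem_zero_left, mulElem_zero_right, add_zero]
  let e := ((kerBasis b hb).tensorProduct (kerBasis b' hb')).equiv (kerBasis B hB)
    (Equiv.refl _)
  have he : (horizontalMul δS M N) = e.toLinearMap := by
    refine ((kerBasis b hb).tensorProduct (kerBasis b' hb')).ext fun i => Subtype.ext ?_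
    simp only [e, LinearEquiv.coe_coe, Module.Basis.equiv_apply, Equiv.refl_apply]
    rw [coe_kerBasis, hB', Module.Basis.tensorProduct_apply', coe_horizontalMul_tmul, coe_kerBasis,
      coe_kerBasis]
  rw [he]
  exact e.bijective

variable (δ α) [IsEquivariantDerivation δ α]

/-- The isomorphism of `ℂ` with the horizontal elements of the unit object. -/
def horizontalUnit : ℂ →ₗ[ℂ] LinearMap.ker (extendedConnection δS (unit (δ := δ) (α := α))) :=
  LinearMap.toSpanSingleton ℂ _ ⟨(1 : S) ⊗ₜ[R] unitOne δ α, by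
    rw [LinearMap.mem_ker, extendedConnection_tmul, conn_unitOne]
    simp⟩

theorem coe_horizontalUnit (c : ℂ) :
    (horizontalUnit δ α δS c).1 = algebraMap ℂ S c ⊗ₜ[R] unitOne δ α := by
  simp [horizontalUnit, smul_tmul', Algebra.algebraMap_eq_smul_one]

/-- Under `S ⊗ R = S` the horizontal elements are the constants of `δS`. -/
theorem horizontalUnit_bijective [HasTrivialConstants δS] :
    Function.Bijective (horizontalUnit δ α δS) := by
  let e : S ⊗[R] unit (δ := δ) (α := α) ≃ₗ[S] S := TensorProduct.AlgebraTensorModule.rid R S S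
  have he : ∀ s : S, e (s ⊗ₜ[R] unitOne δ α) = s := fun s =>
    (AlgebraTensorModule.rid_tmul _ _ _).trans (one_smul R s)
  constructor
  · intro c d h
    have h1 := congrArg (fun x => e x.1) h
    simp only [coe_horizontalUnit, he] at h1
    exact (algebraMap ℂ S).injective h1
  · rintro ⟨x, hx⟩
    have h0 : x = e x ⊗ₜ[R] unitOne δ α := e.injective (he _).symm
    rw [h0, LinearMap.mem_ker, extendedConnection_tmul, conn_unitOne, tmul_zero, add_zero] at hx
    have h2 := congrArg e hx
    rw [he, map_zero] at h2
    obtain ⟨c, hc⟩ := HasTrivialConstants.exists_algebraMap _ h2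
    refine ⟨c, Subtype.ext ?_⟩
    rw [coe_horizontalUnit, hc]
    exact h0.symm

variable {δ α} in
instance : (horizontal (α := α) (δ := δ) δS).Additive where
  map_add {M N f g} := by
    ext1
    refine LinearMap.ext fun x => Subtype.ext ?_
    change extendMap S (f + g) x.1 = extendMap S f x.1 + extendMap S g x.1
    induction x.1 with
    | zero => simp
    | add x y hx hy => simp only [map_add, hx, hy]; abel
    | tmul s m => simp [tmul_add]

variable {δ α} in
instance : (horizontal (α := α) (δ := δ) δS).Linear ℂ where
  map_smul {M N} f c := by
    ext1
    refine LinearMap.ext fun x => Subtype.ext ?_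
    change extendMap S (c • f) x.1 = c • extendMap S f x.1
    induction x.1 with
    | zero => simp
    | add x y hx hy => simp only [map_add, hx, hy, smul_add]
    | tmul s m => simp [smul_tmul']

variable (P : ObjectProperty (EqDiffMod δ α)) [P.IsMonoidal] [HasTrivialConstants δS]

/-- The tensor structure of the functor of horizontal elements, on a category of objects with
horizontal bases. -/
def horizontalCoreMonoidal (hP : ∀ M, P M → HasHorizontalBasis δS M) :
    (P.ι ⋙ horizontal δS).CoreMonoidal where
  εIso := (LinearEquiv.ofBijective _ (horizontalUnit_bijective δ α δS)).toModuleIso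
  μIso M N := (LinearEquiv.ofBijective _
    (horizontalMul_bijective (hP _ M.property) (hP _ N.property))).toModuleIso
  μIso_hom_natural_left f N := by
    ext1
    exact TensorProduct.ext' fun x y => Subtype.ext
      ((congrArg (mulElem _) (extendMap_id y.1)).symm.trans
        (extendMap_tensorMap_mulElem f.hom (𝟙 N.obj) x.1 y.1).symm)
  μIso_hom_natural_right M f := by
    ext1
    exact TensorProduct.ext' fun x y => Subtype.ext
      ((congrArg (fun z => mulElem z _) (extendMap_id x.1)).symm.trans
        (extendMap_tensorMap_mulElem (𝟙 M.obj) f.hom x.1 y.1).symm)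
  associativity M N L := by
    ext1
    refine TensorProduct.ext_threefold fun x y w => Subtype.ext ?_
    exact extendMap_assocIso_mulElem x.1 y.1 w.1
  left_unitality M := by
    ext1
    refine TensorProduct.ext' fun c x => Subtype.ext ?_
    refine Eq.trans ?_ (congrArg (fun z => extendMap S (leftUnitIso M.obj).hom (mulElem z x.1))
      (coe_horizontalUnit δ α δS c)).symm
    exact (algebraMap_smul S c x.1).symm.trans (extendMap_leftUnitIso_mulElem _ x.1).symm
  right_unitality M := by
    ext1
    refine TensorProduct.ext' fun x c => Subtype.ext ?_
    refine Eq.trans ?_ (congrArg (fun z => extendMap S (rightUnitIso M.obj).hom (mulElem x.1 z))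
      (coe_horizontalUnit δ α δS c)).symm
    exact (algebraMap_smul S c x.1).symm.trans (extendMap_rightUnitIso_mulElem _ x.1).symm

/-- The functor of horizontal elements, on a category of objects with horizontal bases, is a
symmetric tensor functor. -/
abbrev horizontalBraided (hP : ∀ M, P M → HasHorizontalBasis δS M) :
    (P.ι ⋙ horizontal δS).Braided where
  toMonoidal := (horizontalCoreMonoidal δ α δS P hP).toMonoidal
  braided M N := by
    have h : (horizontalCoreMonoidal δ α δS P hP).μIso M N ≪≫
        (P.ι ⋙ horizontal δS).mapIso (β_ M N) =
        β_ _ _ ≪≫ (horizontalCoreMonoidal δ α δS P hP).μIso N M := by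
      ext1
      ext1
      exact TensorProduct.ext' fun x y => Subtype.ext (extendMap_commIso_mulElem x.1 y.1)
    exact congrArg Iso.hom h

end HorizontalMonoidal

/-! ### Comparing horizontal elements over two differential rings -/

section ChangeOfRing

variable {S : Type} [CommRing S] [Algebra ℂ S] [Algebra R S] [IsScalarTower ℂ R S]
  {δS : Derivation ℂ S S} [ExtendsDerivation δ δS]
  {S' : Type} [CommRing S'] [Algebra ℂ S'] [Algebra R S'] [IsScalarTower ℂ R S']
  {δS' : Derivation ℂ S' S'} [ExtendsDerivation δ δS'] (φ : S →ₐ[R] S')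

/-- The map `φ ⊗ 1 : S ⊗ M → S' ⊗ M`. -/
def changeRing (M : EqDiffMod δ α) : S ⊗[R] M →ₗ[ℂ] S' ⊗[R] M :=
  (φ.toLinearMap.rTensor M).restrictScalars ℂ

variable {M N : EqDiffMod δ α}

@[simp]
theorem changeRing_tmul (s : S) (m : M) : changeRing φ M (s ⊗ₜ[R] m) = φ s ⊗ₜ[R] m := rfl

theorem changeRing_extendedConnection (hφ : ∀ s, φ (δS s) = δS' (φ s)) (x : S ⊗[R] M) :
    changeRing φ M (extendedConnection δS M x) = extendedConnection δS' M (changeRing φ M x) := by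
  induction x with
  | zero => simp
  | add x y hx hy => simp only [map_add, hx, hy]
  | tmul s m => simp [hφ]

theorem changeRing_extendMap (f : M ⟶ N) (x : S ⊗[R] M) :
    changeRing φ N (extendMap S f x) = extendMap S' f (changeRing φ M x) := by
  induction x with
  | zero => simp
  | add x y hx hy => simp only [map_add, hx, hy]
  | tmul s m => simp

theorem changeRing_mulElem (x : S ⊗[R] M) (y : S ⊗[R] N) :
    changeRing φ (tensor M N) (mulElem x y) = mulElem (changeRing φ M x) (changeRing φ N y) := by
  induction x, y using elem_induction₂ with
  | zero_left y => simp
  | zero_right x => simp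
  | add_left x x' y hx hx' => simp only [mulElem_add_left, map_add, hx, hx']
  | add_right x y y' hx hx' => simp only [mulElem_add_right, map_add, hx, hx']
  | tmul s m t n => simp

/-- The image of a basis of `S ⊗ M` in `S' ⊗ M`. -/
theorem exists_basis_changeRing {ι : Type} (b : Module.Basis ι S (S ⊗[R] M)) :
    ∃ b' : Module.Basis ι S' (S' ⊗[R] M), ∀ i, b' i = changeRing φ M (b i) := by
  let _ : Algebra S S' := φ.toRingHom.toAlgebra
  have : IsScalarTower R S S' := IsScalarTower.of_algebraMap_eq fun r => (φ.commutes r).symm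
  refine ⟨(b.baseChange S').map (AlgebraTensorModule.cancelBaseChange R S S' S' M), fun i => ?_⟩
  rw [Module.Basis.map_apply, Module.Basis.baseChange_apply]
  induction b i with
  | zero => simp
  | add x y hx hy => simp only [tmul_add, map_add, hx, hy]
  | tmul s m =>
    rw [AlgebraTensorModule.cancelBaseChange_tmul, changeRing_tmul, Algebra.smul_def, mul_one]
    rfl

theorem HasHorizontalBasis.changeRing (hφ : ∀ s, φ (δS s) = δS' (φ s))
    (h : HasHorizontalBasis δS M) : HasHorizontalBasis δS' M := by
  obtain ⟨n, b, hb⟩ := h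
  obtain ⟨b', hb'⟩ := exists_basis_changeRing φ b
  exact ⟨n, b', fun i => by rw [hb', ← changeRing_extendedConnection φ hφ, hb, map_zero]⟩

/-- The map induced by `φ` on horizontal elements. -/
def horizontalChangeRing (hφ : ∀ s, φ (δS s) = δS' (φ s)) (M : EqDiffMod δ α) :
    LinearMap.ker (extendedConnection δS M) →ₗ[ℂ] LinearMap.ker (extendedConnection δS' M) :=
  (changeRing φ M).restrict fun x hx => by
    rw [LinearMap.mem_ker] at hx ⊢
    rw [← changeRing_extendedConnection φ hφ, hx, map_zero]

/-- `φ` carries a horizontal basis to a horizontal basis, and over both rings the horizontal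
elements are the `ℂ`-span of such a basis. For the germ map on the universal cover, this says that
every germ of a solution continues uniquely to the whole cover. -/
theorem horizontalChangeRing_bijective [HasTrivialConstants δS] [HasTrivialConstants δS']
    (hφ : ∀ s, φ (δS s) = δS' (φ s)) (h : HasHorizontalBasis δS M) :
    Function.Bijective (horizontalChangeRing (δS := δS) (δS' := δS') φ hφ M) := by
  obtain ⟨n, b, hb⟩ := h
  obtain ⟨b', hb'⟩ := exists_basis_changeRing φ b
  have hb'' : ∀ i, extendedConnection δS' M (b' i) = 0 := fun i => by
    rw [hb', ← changeRing_extendedConnection φ hφ, hb, map_zero]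
  let e := (kerBasis b hb).equiv (kerBasis b' hb'') (Equiv.refl _)
  have he : horizontalChangeRing (δS := δS) (δS' := δS') φ hφ M = e.toLinearMap := by
    refine (kerBasis b hb).ext fun i => Subtype.ext ?_
    simp only [e, LinearEquiv.coe_coe, Module.Basis.equiv_apply, Equiv.refl_apply, coe_kerBasis,
      hb']
    exact congrArg _ (coe_kerBasis b hb i)
  rw [he]
  exact e.bijective

end ChangeOfRing

end EqDiffMod

end

/-! ### Group actions on horizontal elements, and descent of morphisms -/

section

namespace EqDiffMod

variable {R G : Type} [CommRing R] [Algebra ℂ R] [Group G]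
  {δ : Derivation ℂ R R} {α : G →* (R ≃ₐ[ℂ] R)}
  {S : Type} [CommRing S] [Algebra ℂ S] [Algebra R S] [IsScalarTower ℂ R S]
  {δS : Derivation ℂ S S} [ExtendsDerivation δ δS]
  {K : Type} [Group K]

/-- The action `β` of `K` on the differential algebra `S` extends the action of `G` on `R`. -/
structure ExtendsAction (α : G →* (R ≃ₐ[ℂ] R)) (δS : Derivation ℂ S S) (π : K →* G)
    (β : K →* (S ≃ₐ[ℂ] S)) : Prop where
  map_algebraMap : ∀ k r, β k (algebraMap R S r) = algebraMap R S (α (π k) r)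
  comm : ∀ k s, δS (β k s) = β k (δS s)

section Shift

variable {π : K →* G} {β : K →* (S ≃ₐ[ℂ] S)} (h : ExtendsAction α δS π β)

/-- The action of `k` on `S`, as a semilinear map. -/
def shiftBase (k : K) : S →ₛₗ[((α (π k) : R ≃ₐ[ℂ] R) : R →+* R)] S where
  toFun := β k
  map_add' := map_add _
  map_smul' r s := by
    rw [Algebra.smul_def, map_mul, h.map_algebraMap, Algebra.smul_def]
    rfl

/-- The action of `k ∈ K` on `S ⊗ M`. -/
def shift (k : K) (M : EqDiffMod δ α) : S ⊗[R] M →ₗ[ℂ] S ⊗[R] M where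
  toFun := TensorProduct.map (shiftBase h k) (M.σ (π k))
  map_add' := map_add _
  map_smul' c x := by
    induction x with
    | zero => simp
    | add x y hx hy => simp only [smul_add, map_add, hx, hy]
    | tmul s m => simp [smul_tmul', shiftBase]

variable {M N : EqDiffMod δ α}

@[simp]
theorem shift_tmul (k : K) (s : S) (m : M) :
    shift h k M (s ⊗ₜ[R] m) = β k s ⊗ₜ[R] M.σ (π k) m := rfl

theorem shift_smul (k : K) (s : S) (x : S ⊗[R] M) :
    shift h k M (s • x) = β k s • shift h k M x := by
  induction x with
  | zero => simp
  | add x y hx hy => simp only [smul_add, map_add, hx, hy]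
  | tmul s m => simp [smul_tmul']

theorem σ_eq_self {g : G} (hg : g = 1) (m : M) : M.σ g m = m := by
  subst hg
  exact M.σ_one m

theorem shift_one (x : S ⊗[R] M) : shift h 1 M x = x := by
  induction x with
  | zero => simp
  | add x y hx hy => simp only [map_add, hx, hy]
  | tmul s m => rw [shift_tmul, map_one, map_one, M.σ_one]; rfl

theorem shift_mul (k l : K) (x : S ⊗[R] M) :
    shift h (k * l) M x = shift h k M (shift h l M x) := by
  induction x with
  | zero => simp
  | add x y hx hy => simp only [map_add, hx, hy]
  | tmul s m => rw [shift_tmul, map_mul, map_mul, M.σ_mul]; rfl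

theorem extendedConnection_shift (k : K) (x : S ⊗[R] M) :
    extendedConnection δS M (shift h k M x) = shift h k M (extendedConnection δS M x) := by
  induction x with
  | zero => simp
  | add x y hx hy => simp only [map_add, hx, hy]
  | tmul s m => simp [h.comm, M.conn_σ]

theorem extendMap_shift (k : K) (f : M ⟶ N) (x : S ⊗[R] M) :
    extendMap S f (shift h k M x) = shift h k N (extendMap S f x) := by
  induction x with
  | zero => simp
  | add x y hx hy => simp only [map_add, hx, hy]
  | tmul s m => simp [f.map_σ]

theorem shift_mulElem (k : K) (x : S ⊗[R] M) (y : S ⊗[R] N) :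
    shift h k (tensor M N) (mulElem x y) = mulElem (shift h k M x) (shift h k N y) := by
  induction x, y using elem_induction₂ with
  | zero_left y => simp
  | zero_right x => simp
  | add_left x x' y hx hx' => simp only [mulElem_add_left, map_add, hx, hx']
  | add_right x y y' hx hx' => simp only [mulElem_add_right, map_add, hx, hx']
  | tmul s m t n =>
    rw [mulElem_tmul, shift_tmul, shift_tmul, shift_tmul, mulElem_tmul, map_mul]
    rfl

theorem shift_unitOne [IsEquivariantDerivation δ α] (k : K) (c : ℂ) :
    shift h k unit (algebraMap ℂ S c ⊗ₜ[R] unitOne δ α) =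
      algebraMap ℂ S c ⊗ₜ[R] unitOne δ α := by
  rw [shift_tmul, AlgEquiv.commutes]
  exact congrArg _ (map_one (α (π k)))

/-- The representation of `K` on the horizontal elements of `S ⊗ M`. -/
def shiftRep (M : EqDiffMod δ α) :
    Representation ℂ K (LinearMap.ker (extendedConnection δS M)) where
  toFun k := (shift h k M).restrict fun x hx => by
    rw [LinearMap.mem_ker] at hx ⊢
    rw [extendedConnection_shift, hx, map_zero]
  map_one' := LinearMap.ext fun x => Subtype.ext (shift_one h x.1)
  map_mul' k l := LinearMap.ext fun x => Subtype.ext (shift_mul h k l x.1)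

@[simp]
theorem coe_shiftRep_apply (k : K) (x : LinearMap.ker (extendedConnection δS M)) :
    (shiftRep h M k x).1 = shift h k M x.1 := rfl

/-- Horizontal elements span `S ⊗ M` over `S`, so additive properties only need to be checked on
their multiples. -/
theorem HasHorizontalBasis.induction {M : EqDiffMod δ α} (hM : HasHorizontalBasis δS M)
    {p : S ⊗[R] M → Prop} (x : S ⊗[R] M) (zero : p 0) (add : ∀ x y, p x → p y → p (x + y))
    (smul : ∀ (s : S) x, extendedConnection δS M x = 0 → p (s • x)) : p x := by
  obtain ⟨n, b, hb⟩ := hM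
  rw [← b.sum_repr x]
  exact Finset.sum_induction _ p add zero fun i _ => smul _ _ (hb i)

/-- Elements of `S ⊗ M` invariant under the kernel of `K → G` descend to `M` if the invariants
of `S` are `R`. -/
theorem exists_one_tmul_of_shift_eq [Module.Free R M]
    (hS : ∀ s : S, (∀ k, π k = 1 → β k s = s) → ∃ r, algebraMap R S r = s)
    (x : S ⊗[R] M) (hx : ∀ k, π k = 1 → shift h k M x = x) : ∃ m : M, 1 ⊗ₜ[R] m = x := by
  let b := Module.Free.chooseBasis R M
  let B := b.baseChange S
  have hB : ∀ i, B i = 1 ⊗ₜ[R] b i := fun i => Module.Basis.baseChange_apply _ _ _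
  have h1 : ∀ i, ∃ r, algebraMap R S r = B.repr x i := by
    intro i
    refine hS _ fun k hk => ?_
    -- For `k` in the kernel of `π` the basis vectors `1 ⊗ bᵢ` are fixed, so the shift acts on
    -- coordinates by `β k`. Invariance of `x` is then invariance of each coordinate, and these lie
    -- in `R`.
    have h2 : shift h k M x = (B.repr x).sum fun i s => β k s • B i := by
      conv_lhs => rw [← B.linearCombination_repr x, Finsupp.linearCombination_apply,
        Finsupp.sum, map_sum]
      refine Finset.sum_congr rfl fun i _ => ?_
      simp only [shift_smul, hB, shift_tmul, map_one, σ_eq_self hk]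
    have h3 : B.repr (shift h k M x) = (B.repr x).mapRange (β k) (map_zero _) := by
      rw [h2, Finsupp.sum, map_sum]
      ext j
      simp only [map_smul, Module.Basis.repr_self, Finsupp.smul_single, smul_eq_mul, mul_one,
        Finsupp.finsetSum_apply, Finsupp.single_apply, Finset.sum_ite_eq', Finsupp.mem_support_iff,
        Finsupp.mapRange_apply]
      split_ifs with hj
      · rfl
      · rw [Finsupp.notMem_support_iff.1 hj, map_zero]
    rw [hx k hk] at h3
    conv_rhs => rw [h3]
    rfl
  choose r hr using h1
  refine ⟨(B.repr x).sum fun i _ => r i • b i, ?_⟩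
  conv_rhs => rw [← B.linearCombination_repr x, Finsupp.linearCombination_apply]
  rw [Finsupp.sum, tmul_sum]
  refine Finset.sum_congr rfl fun i _ => ?_
  simp only [tmul_smul, hB, ← hr, algebraMap_smul]

/-- A free module is flat, so tensoring with it keeps `R → S` injective. -/
theorem one_tmul_injective [Module.Free R M] (hinj : Function.Injective (algebraMap R S)) :
    Function.Injective fun m : M => (1 : S) ⊗ₜ[R] m := by
  have := Module.Flat.rTensor_preserves_injective_linearMap (M := M) (Algebra.linearMap R S) hinj
  intro m m' hm
  have h1 : (Algebra.linearMap R S).rTensor M ((1 : R) ⊗ₜ m) =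
      (Algebra.linearMap R S).rTensor M ((1 : R) ⊗ₜ m') := by simpa using hm
  have h2 := congrArg (TensorProduct.lid R M) (this h1)
  simpa using h2

/-- An equivariant linear map between spaces of horizontal elements comes from a morphism. -/
theorem exists_hom_of_equivariant [HasTrivialConstants δS] [Module.Free R M] [Module.Free R N]
    (hM : HasHorizontalBasis δS M) (hπ : Function.Surjective π)
    (hS : ∀ s : S, (∀ k, π k = 1 → β k s = s) → ∃ r, algebraMap R S r = s)
    (hinj : Function.Injective (algebraMap R S))
    (φ : LinearMap.ker (extendedConnection δS M) →ₗ[ℂ] LinearMap.ker (extendedConnection δS N))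
    (hφ : ∀ k x, φ (shiftRep h M k x) = shiftRep h N k (φ x)) :
    ∃ f : M ⟶ N, ∀ x : LinearMap.ker (extendedConnection δS M), extendMap S f x.1 = (φ x).1 := by
  -- `F` is the extension of `φ` to an `S`-linear map `S ⊗ M → S ⊗ N`. As horizontal elements span,
  -- compatibility of `F` with the connection and the shifts follows from the behaviour of `φ`.
  obtain ⟨F, hF⟩ := hM.exists_extension (Submodule.subtype _ ∘ₗ φ)
  have hF' : ∀ x (hx : extendedConnection δS M x = 0), F x = (φ ⟨x, hx⟩).1 :=
    fun x hx => hF ⟨x, hx⟩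
  have hconn : ∀ x, F (extendedConnection δS M x) = extendedConnection δS N (F x) := by
    intro x
    induction x using HasHorizontalBasis.induction hM with
    | zero => simp
    | add x y hx hy => simp only [map_add, hx, hy]
    | smul s x hx =>
      have : extendedConnection δS N (F x) = 0 := by rw [hF' x hx]; exact (φ _).2
      rw [extendedConnection_smul, map_smul, extendedConnection_smul, hx, this]
      simp
  have hshift : ∀ k x, F (shift h k M x) = shift h k N (F x) := by
    intro k x
    induction x using HasHorizontalBasis.induction hM with
    | zero => simp
    | add x y hx hy => simp only [map_add, hx, hy]
    | smul s x hx =>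
      rw [shift_smul, map_smul, map_smul, shift_smul, hF' x hx]
      have h1 := congrArg Subtype.val (hφ k ⟨x, hx⟩)
      rw [coe_shiftRep_apply] at h1
      rw [← h1]
      exact congrArg _ (hF (shiftRep h M k ⟨x, hx⟩))
  -- Descent: `1 ⊗ m` is fixed by the kernel of `π`, hence so is its image under the equivariant
  -- `F`, which therefore comes from an element of `N`.
  have hinv : ∀ m : M, ∃ n : N, (1 : S) ⊗ₜ[R] n = F (1 ⊗ₜ m) := fun m => by
    refine exists_one_tmul_of_shift_eq h hS _ fun k hk => ?_
    rw [← hshift, shift_tmul, map_one, σ_eq_self hk]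
  choose g hg using hinv
  have inj := one_tmul_injective (M := N) hinj
  let f : M ⟶ N :=
    { lin :=
        { toFun := g
          map_add' := fun m m' => inj (by simp only [tmul_add, hg, map_add])
          map_smul' := fun r m => inj (by
            simp only [RingHom.id_apply]
            rw [hg, tmul_smul, tmul_smul, ← algebraMap_smul S, map_smul, ← hg, algebraMap_smul]) }
      map_σ := fun γ m => inj (by
        -- Equivariance is known only for shifts by `K`; surjectivity of `π` reaches every element
        -- of `G`.
        obtain ⟨k, rfl⟩ := hπ γ
        change (1 : S) ⊗ₜ[R] g (M.σ (π k) m) = 1 ⊗ₜ[R] N.σ (π k) (g m)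
        have e1 : ∀ m, (1 : S) ⊗ₜ[R] M.σ (π k) m = shift h k M (1 ⊗ₜ m) := by simp
        have e2 : ∀ m, (1 : S) ⊗ₜ[R] N.σ (π k) m = shift h k N (1 ⊗ₜ m) := by simp
        rw [hg, e1, hshift, e2, hg])
      map_conn := fun m => inj (by
        change (1 : S) ⊗ₜ[R] g (M.conn m) = 1 ⊗ₜ[R] N.conn (g m)
        have e1 : ∀ m, (1 : S) ⊗ₜ[R] M.conn m = extendedConnection δS M (1 ⊗ₜ m) := by simp
        have e2 : ∀ m, (1 : S) ⊗ₜ[R] N.conn m = extendedConnection δS N (1 ⊗ₜ m) := by simp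
        rw [hg, e1, hconn, e2, hg]) }
  refine ⟨f, fun x => ?_⟩
  refine Eq.trans ?_ (hF x)
  induction x.1 with
  | zero => simp
  | add x y hx hy => simp only [map_add, hx, hy]
  | tmul s m =>
    have : s ⊗ₜ[R] m = s • (1 : S) ⊗ₜ[R] m := by simp [smul_tmul']
    rw [extendMap_tmul, this, map_smul, ← hg, smul_tmul', smul_eq_mul, mul_one]
    rfl

/-- Morphisms are determined by their effect on horizontal elements. -/
theorem hom_ext_of_horizontal [Module.Free R N] (hM : HasHorizontalBasis δS M)
    (hinj : Function.Injective (algebraMap R S)) {f g : M ⟶ N}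
    (hfg : ∀ x, extendedConnection δS M x = 0 → extendMap S f x = extendMap S g x) : f = g := by
  have h1 : (Hom.lin f).baseChange S = (Hom.lin g).baseChange S := hM.linearMap_ext hfg
  ext m
  exact one_tmul_injective (M := N) hinj (LinearMap.congr_fun h1 (1 ⊗ₜ m))

end Shift

end EqDiffMod

end

/-! ### The functor from modules to representations -/

section

namespace EqDiffMod

variable {R G : Type} [CommRing R] [Algebra ℂ R] [Group G]
  {δ : Derivation ℂ R R} {α : G →* (R ≃ₐ[ℂ] R)}
  {S : Type} [CommRing S] [Algebra ℂ S] [Algebra R S] [IsScalarTower ℂ R S]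
  {δS : Derivation ℂ S S} [ExtendsDerivation δ δS]
  {K : Type} [Group K] {π : K →* G} {β : K →* (S ≃ₐ[ℂ] S)} (h : ExtendsAction α δS π β)
  [HasTrivialConstants δS] (P : ObjectProperty (EqDiffMod δ α))
  (hP : ∀ M, P M → HasHorizontalBasis δS M)

/-- The functor to finite dimensional representations of `K` given by the action of `K` on
horizontal elements. -/
def toFDRep : P.FullSubcategory ⥤ FDRep ℂ K where
  obj M :=
    haveI := (hP _ M.property).finite_ker
    FDRep.of (shiftRep h M.obj)
  map {M N} f :=
    { hom := InducedCategory.homMk ((horizontal δS).map f.hom)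
      comm := fun k => by
        refine InducedCategory.hom_ext (ModuleCat.hom_ext (LinearMap.ext fun x => Subtype.ext ?_))
        exact extendMap_shift h k f.hom
          (show LinearMap.ker (extendedConnection δS M.obj) from x).1 }
  map_id M := by
    exact Action.Hom.ext (InducedCategory.hom_ext ((horizontal δS).map_id M.obj))
  map_comp f g := by
    exact Action.Hom.ext (InducedCategory.hom_ext ((horizontal δS).map_comp f.hom g.hom))

variable {S' : Type} [CommRing S'] [Algebra ℂ S'] [Algebra R S'] [IsScalarTower ℂ R S']
  {δS' : Derivation ℂ S' S'} [ExtendsDerivation δ δS'] [HasTrivialConstants δS'] (φ : S →ₐ[R] S')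
  (hφ : ∀ s, φ (δS s) = δS' (φ s))

/-- Under the functor `toFDRep`, horizontal elements over `S'` correspond to underlying spaces. -/
def toFDRepCompForgetIso : toFDRep h P hP ⋙ forgetRep K ≅ P.ι ⋙ horizontal δS' :=
  NatIso.ofComponents
    (fun M => (LinearEquiv.ofBijective _
      (horizontalChangeRing_bijective φ hφ (hP _ M.property))).toModuleIso)
    (fun f => by
      ext1
      exact LinearMap.ext fun x => Subtype.ext (changeRing_extendMap φ f.hom x.1))

theorem toFDRep_faithful (hfree : ∀ M, P M → Module.Free R M)
    (hinj : Function.Injective (algebraMap R S)) : (toFDRep h P hP).Faithful where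
  map_injective {M N f g} hfg := by
    have := hfree _ N.property
    ext1
    refine hom_ext_of_horizontal (hP _ M.property) hinj fun x hx => ?_
    have h1 := congrArg (fun f => (f.hom.hom.hom :
      LinearMap.ker (extendedConnection δS M.obj) →ₗ[ℂ] LinearMap.ker (extendedConnection δS N.obj))
        ⟨x, hx⟩) hfg
    exact congrArg Subtype.val h1

theorem toFDRep_full (hfree : ∀ M, P M → Module.Free R M) (hπ : Function.Surjective π)
    (hS : ∀ s : S, (∀ k, π k = 1 → β k s = s) → ∃ r, algebraMap R S r = s)
    (hinj : Function.Injective (algebraMap R S)) : (toFDRep h P hP).Full where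
  map_surjective {M N} f := by
    have := hfree _ M.property
    have := hfree _ N.property
    obtain ⟨g, hg⟩ := exists_hom_of_equivariant h (hP _ M.property) hπ hS hinj
      ((forgetRep K).map f).hom (fun k x => by
        have h1 := congrArg (fun f => (f.hom.hom x)) (f.comm k)
        exact h1)
    refine ⟨ObjectProperty.homMk g, ?_⟩
    exact Action.Hom.ext (InducedCategory.hom_ext (ModuleCat.hom_ext
      (LinearMap.ext fun x => Subtype.ext (hg x))))

theorem toFDRep_essSurj
    (hess : ∀ V : FDRep ℂ K, ∃ M, P M ∧ ∃ e : LinearMap.ker (extendedConnection δS M) ≃ₗ[ℂ] V,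
      ∀ k x, e (shiftRep h M k x) = V.ρ k (e x)) : (toFDRep h P hP).EssSurj where
  mem_essImage V := by
    obtain ⟨M, hM, e, he⟩ := hess V
    have := (hP M hM).finite_ker
    refine ⟨⟨M, hM⟩, ⟨Action.mkIso (LinearEquiv.toFGModuleCatIso e) fun k => ?_⟩⟩
    exact InducedCategory.hom_ext (ModuleCat.hom_ext (LinearMap.ext fun x => he k x))

variable [IsEquivariantDerivation δ α] [P.IsMonoidal]

/-- Two rings are needed: `K` acts on `S` but not on `S'`, whereas the fibre functor is defined over
`S'`. What remains to be seen is that the unit and multiplication maps over `S` are `K`-equivariant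
and correspond, under `φ`, to those over `S'`. -/
theorem tensorEquivalentOver_forgetRep (φ : S →ₐ[R] S')
    (hφ : ∀ s, φ (δS s) = δS' (φ s)) (hP' : ∀ M, P M → HasHorizontalBasis δS' M)
    [(toFDRep h P hP).IsEquivalence] :
    let _ := horizontalBraided δ α δS' P hP'
    TensorEquivalentOver (P.ι ⋙ horizontal δS') (forgetRep K) := by
  let _ := horizontalBraided δ α δS' P hP'
  let _ := forgetRepBraided K
  refine .of_lift (toFDRep h P hP) (toFDRepCompForgetIso h P hP φ hφ) ?_ ?_
  · refine ⟨⟨InducedCategory.homMk (ModuleCat.ofHom (horizontalUnit δ α δS)), fun k => ?_⟩, ?_⟩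
    · refine InducedCategory.hom_ext (ModuleCat.hom_ext (LinearMap.ext fun (c : ℂ) =>
        Subtype.ext ?_))
      have h1 := coe_horizontalUnit δ α δS c
      refine Eq.trans ?_ ((congrArg (shift h k unit) h1).trans (shift_unitOne h k c)).symm
      exact h1
    · refine ModuleCat.hom_ext (LinearMap.ext fun (c : ℂ) => Subtype.ext ?_)
      refine (congrArg (changeRing φ unit) (coe_horizontalUnit δ α δS c)).trans ?_
      refine Eq.trans ?_ (coe_horizontalUnit δ α δS' c).symm
      rw [changeRing_tmul, ← AlgHom.coe_restrictScalars' ℂ φ, AlgHom.commutes]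
  · intro M N
    refine ⟨⟨InducedCategory.homMk (ModuleCat.ofHom (horizontalMul δS M.obj N.obj)), fun k => ?_⟩,
      ?_⟩
    · refine InducedCategory.hom_ext (ModuleCat.hom_ext ?_)
      refine TensorProduct.ext' fun x y => Subtype.ext ?_
      exact (shift_mulElem h k (show LinearMap.ker (extendedConnection δS M.obj) from x).1
        (show LinearMap.ker (extendedConnection δS N.obj) from y).1).symm
    · refine ModuleCat.hom_ext ?_
      refine TensorProduct.ext' fun x y => Subtype.ext ?_
      exact changeRing_mulElem φ (show LinearMap.ker (extendedConnection δS M.obj) from x).1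
        (show LinearMap.ker (extendedConnection δS N.obj) from y).1

end EqDiffMod

end

section

/-! ### Linear differential equations with entire coefficients -/

section LinearODE

variable {𝔸 : Type*} [NormedRing 𝔸] [NormedAlgebra ℂ 𝔸]

/-- The coefficients of the power series solution of `y' = a y`, `y 0 = 1`. -/
def odeCoeff (a : ℕ → 𝔸) : ℕ → 𝔸
  | 0 => 1
  | k + 1 => ((k + 1 : ℂ))⁻¹ • ∑ j : Fin (k + 1), a j * odeCoeff a (k - j)
decreasing_by omega

theorem odeCoeff_succ (a : ℕ → 𝔸) (k : ℕ) :
    (k + 1 : ℂ) • odeCoeff a (k + 1) = ∑ j ∈ Finset.range (k + 1), a j * odeCoeff a (k - j) := by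
  have hk : (k + 1 : ℂ) ≠ 0 := by exact_mod_cast k.succ_ne_zero
  rw [odeCoeff, smul_smul, mul_inv_cancel₀ hk, one_smul,
    Finset.sum_range fun j => a j * odeCoeff a (k - j)]

/-- Let `‖a j‖ (2r)^j ≤ C`, and suppose that `D` bounds `‖y j‖ r^j` for `j ≤ m`, where `y = odeCoeff
a`. The recursion gives `(m+1) ‖y (m+1)‖ r^(m+1) ≤ r ∑ C 2^(-j) D ≤ 2CrD`. So the bound `D` persists
as soon as `m + 1 ≥ 2Cr`, and it is enough to choose `D` large enough for the finitely many earlier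
indices. -/
theorem exists_bound_odeCoeff (a : ℕ → 𝔸) (ha : ∀ r : ℝ, 0 < r → ∃ C, ∀ k, ‖a k‖ * r ^ k ≤ C)
    (r : ℝ) (hr : 0 < r) : ∃ D, ∀ k, ‖odeCoeff a k‖ * r ^ k ≤ D := by
  -- The radius `2r` instead of `r` yields the geometric factor `(1/2)^j`, whose sum is at most `2`.
  obtain ⟨C, hC⟩ := ha (2 * r) (by positivity)
  have hC0 : 0 ≤ C := le_trans (by positivity) (hC 0)
  obtain ⟨N, hN⟩ := exists_nat_ge (2 * C * r)
  let D := ∑ j ∈ Finset.range (N + 1), ‖odeCoeff a j‖ * r ^ j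
  have hD0 : 0 ≤ D := Finset.sum_nonneg fun j _ => by positivity
  refine ⟨D, fun k => ?_⟩
  induction k using Nat.strong_induction_on with
  | _ k ih =>
    rcases le_or_gt k N with hk | hk
    · exact Finset.single_le_sum (f := fun j => ‖odeCoeff a j‖ * r ^ j)
        (fun j _ => by positivity) (Finset.mem_range.2 (Nat.lt_succ_of_le hk))
    · obtain ⟨m, rfl⟩ : ∃ m, k = m + 1 := ⟨k - 1, by omega⟩
      have hm : (N : ℝ) ≤ m + 1 := by exact_mod_cast hk.le
      have hpos : (0 : ℝ) < m + 1 := by positivity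
      have h1 : (m + 1 : ℝ) * ‖odeCoeff a (m + 1)‖ ≤
          ∑ j ∈ Finset.range (m + 1), ‖a j‖ * ‖odeCoeff a (m - j)‖ := by
        have := congrArg norm (odeCoeff_succ a m)
        rw [norm_smul] at this
        have h2 : ‖(m + 1 : ℂ)‖ = m + 1 := by
          exact_mod_cast Complex.norm_natCast (m + 1)
        rw [h2] at this
        rw [this]
        exact (norm_sum_le _ _).trans (Finset.sum_le_sum fun j _ => norm_mul_le _ _)
      have h3 : (m + 1 : ℝ) * (‖odeCoeff a (m + 1)‖ * r ^ (m + 1)) ≤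
          ∑ j ∈ Finset.range (m + 1), r * (C * D * (1 / 2) ^ j) := by
        rw [← mul_assoc]
        refine (mul_le_mul_of_nonneg_right h1 (by positivity)).trans ?_
        rw [Finset.sum_mul]
        refine Finset.sum_le_sum fun j hj => ?_
        have hj' : j ≤ m := Nat.lt_succ_iff.1 (Finset.mem_range.1 hj)
        have e1 : ‖a j‖ * r ^ j ≤ C * (1 / 2) ^ j := by
          have := hC j
          rw [mul_pow] at this
          rw [one_div, inv_pow, ← div_eq_mul_inv, le_div_iff₀ (by positivity)]
          linarith
        have e2 := ih (m - j) (by omega)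
        calc ‖a j‖ * ‖odeCoeff a (m - j)‖ * r ^ (m + 1)
            = r * ((‖a j‖ * r ^ j) * (‖odeCoeff a (m - j)‖ * r ^ (m - j))) := by
              have : r ^ (m + 1) = r * (r ^ j * r ^ (m - j)) := by
                rw [← pow_add, ← pow_succ']
                congr 1
                omega
              rw [this]; ring
          _ ≤ r * ((C * (1 / 2) ^ j) * D) := by gcongr
          _ = r * (C * D * (1 / 2) ^ j) := by ring
      have h4 : ∑ j ∈ Finset.range (m + 1), r * (C * D * (1 / 2) ^ j) ≤ 2 * C * r * D := by
        rw [← Finset.mul_sum, ← Finset.mul_sum]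
        have := sum_geometric_two_le (m + 1)
        calc r * (C * D * ∑ j ∈ Finset.range (m + 1), (1 / 2 : ℝ) ^ j) ≤ r * (C * D * 2) := by
              gcongr
          _ = 2 * C * r * D := by ring
      have h5 : 2 * C * r * D ≤ (m + 1) * D := by gcongr; linarith
      exact le_of_mul_le_mul_left (h3.trans (h4.trans h5)) hpos

theorem summable_of_bound {y : ℕ → 𝔸} (hy : ∀ r : ℝ, 0 < r → ∃ C, ∀ k, ‖y k‖ * r ^ k ≤ C)
    (r : ℝ) (hr : 0 < r) : Summable fun k => ‖y k‖ * r ^ k := by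
  -- A bound at twice the radius gives comparison with a geometric series of ratio `1/2`.
  obtain ⟨C, hC⟩ := hy (2 * r) (by positivity)
  refine Summable.of_nonneg_of_le (fun k => by positivity) (fun k => ?_)
    (summable_geometric_two.mul_left C)
  have := hC k
  rw [mul_pow] at this
  rw [one_div, inv_pow, ← div_eq_mul_inv, le_div_iff₀ (by positivity)]
  linarith

theorem summable_mul_of_bound {y : ℕ → 𝔸} (hy : ∀ r : ℝ, 0 < r → ∃ C, ∀ k, ‖y k‖ * r ^ k ≤ C)
    (r : ℝ) (hr : 0 < r) : Summable fun k : ℕ => k * r ^ (k - 1) * ‖y k‖ := by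
  refine Summable.of_nonneg_of_le (fun k => by positivity) (fun k => ?_)
    ((summable_of_bound hy (2 * r) (by positivity)).mul_left (1 / r))
  -- The factor `k` from differentiation is absorbed by doubling the radius once more.
  have h1 : (k : ℝ) ≤ 2 ^ k := by exact_mod_cast Nat.lt_two_pow_self.le
  rcases k with _ | k
  · simp; positivity
  · rw [Nat.add_sub_cancel, mul_pow, pow_succ r]
    calc ((k + 1 : ℕ) : ℝ) * r ^ k * ‖y (k + 1)‖ ≤ 2 ^ (k + 1) * r ^ k * ‖y (k + 1)‖ := by gcongr
      _ = 1 / r * (‖y (k + 1)‖ * (2 ^ (k + 1) * (r ^ k * r))) := by field_simp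

theorem hasDerivAt_powerSeries [CompleteSpace 𝔸] {y : ℕ → 𝔸}
    (hy : ∀ r : ℝ, 0 < r → ∃ C, ∀ k, ‖y k‖ * r ^ k ≤ C) (t : ℂ) :
    HasDerivAt (fun t : ℂ => ∑' k, t ^ k • y k) (∑' k : ℕ, t ^ k • ((k + 1 : ℂ) • y (k + 1))) t := by
  have hR : (0 : ℝ) < ‖t‖ + 1 := by positivity
  have h := hasDerivAt_tsum_of_isPreconnected (t := Metric.ball (0 : ℂ) (‖t‖ + 1)) (y₀ := 0) (y := t)
    (g := fun (k : ℕ) (t : ℂ) => t ^ k • y k)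
    (g' := fun (k : ℕ) (t : ℂ) => ((k : ℂ) * t ^ (k - 1)) • y k)
    (summable_mul_of_bound hy (‖t‖ + 1) hR) Metric.isOpen_ball
    (convex_ball _ _).isPreconnected (fun k s _ => (hasDerivAt_pow k s).smul_const (y k))
    (fun k s hs => by
      rw [norm_smul, norm_mul, Complex.norm_natCast, norm_pow]
      have : ‖s‖ ≤ ‖t‖ + 1 := (mem_ball_zero_iff.1 hs).le
      gcongr)
    (by simpa using hR)
    (summable_of_ne_finset_zero (s := {0}) fun k hk => by
      rw [Finset.mem_singleton] at hk
      simp [hk])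
    (by simp)
  have hsum : Summable fun k : ℕ => ((k : ℂ) * t ^ (k - 1)) • y k := by
    refine Summable.of_norm_bounded (summable_mul_of_bound hy (‖t‖ + 1) hR) fun k => ?_
    rw [norm_smul, norm_mul, Complex.norm_natCast, norm_pow]
    gcongr
    linarith
  -- The term `k = 0` of the differentiated series vanishes, so the index can be shifted by one.
  rw [hsum.tsum_eq_zero_add] at h
  simpa [smul_smul, mul_comm] using h

/-- A linear differential equation with entire coefficients has an entire solution. -/
theorem exists_hasDerivAt_eq_mul [CompleteSpace 𝔸] (A : ℂ → 𝔸) (hA : Differentiable ℂ A) :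
    ∃ Y : ℂ → 𝔸, Y 0 = 1 ∧ ∀ t, HasDerivAt Y (A t * Y t) t := by
  obtain ⟨a, ha, hsum⟩ : ∃ a : ℕ → 𝔸, (∀ r : ℝ, 0 < r → ∃ C, ∀ k, ‖a k‖ * r ^ k ≤ C) ∧
      ∀ t, A t = ∑' k, t ^ k • a k := by
    -- The radius `1` only fixes the circle of the Cauchy integrals; as `A` is entire, the resulting
    -- series converges everywhere.
    have h := hA.hasFPowerSeriesOnBall 0 (R := 1) one_pos
    refine ⟨(cauchyPowerSeries A 0 1).coeff, fun r hr => ?_, fun t => ?_⟩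
    · obtain ⟨C, -, hC⟩ := (cauchyPowerSeries A 0 1).norm_mul_pow_le_of_lt_radius
        (r := ⟨r, hr.le⟩) (lt_of_lt_of_le ENNReal.coe_lt_top h.r_le)
      exact ⟨C, fun k => by
        have := hC k
        rw [FormalMultilinearSeries.norm_apply_eq_norm_coef] at this
        exact this⟩
    · have := h.hasSum (y := t) (by simp)
      simp only [FormalMultilinearSeries.apply_eq_pow_smul_coeff, zero_add] at this
      exact this.tsum_eq.symm
  have hy := exists_bound_odeCoeff a ha
  refine ⟨fun t => ∑' k, t ^ k • odeCoeff a k, ?_, fun t => ?_⟩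
  · dsimp only
    rw [tsum_eq_single 0 fun k hk => by simp [hk]]
    simp [odeCoeff]
  · have h := hasDerivAt_powerSeries hy t
    convert h using 1
    have hn : ∀ {y : ℕ → 𝔸}, (∀ r : ℝ, 0 < r → ∃ C, ∀ k, ‖y k‖ * r ^ k ≤ C) →
        Summable fun k => ‖t ^ k • y k‖ := fun hy => by
      refine Summable.of_nonneg_of_le (fun k => by positivity) (fun k => ?_)
        (summable_of_bound hy (‖t‖ + 1) (by positivity))
      rw [norm_smul, norm_pow, mul_comm]
      gcongr
      linarith
    -- By the Cauchy product, `A Y` has the coefficients that the recursion for `odeCoeff`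
    -- prescribes for `Y'`.
    rw [hsum, tsum_mul_tsum_eq_tsum_sum_range_of_summable_norm (hn ha) (hn hy)]
    refine tsum_congr fun k => ?_
    rw [odeCoeff_succ, Finset.smul_sum]
    refine Finset.sum_congr rfl fun j hj => ?_
    have hj' : j ≤ k := Nat.lt_succ_iff.1 (Finset.mem_range.1 hj)
    rw [smul_mul_smul_comm, ← pow_add, Nat.add_sub_cancel' hj']

/-- Fundamental solutions of `Y' = -Y A`, for a matrix `A` of entire functions. -/
theorem exists_fundamentalMatrix {n : ℕ} (A : Matrix (Fin n) (Fin n) (ℂ → ℂ))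
    (hA : ∀ i j, Differentiable ℂ (A i j)) :
    ∃ Y W : Matrix (Fin n) (Fin n) (ℂ → ℂ), Y * W = 1 ∧ (∀ i j, Differentiable ℂ (W i j)) ∧
      ∀ i j t, HasDerivAt (Y i j) (-(Y * A) i j t) t := by
  let _ : NormedRing (Matrix (Fin n) (Fin n) ℂ) := Matrix.linftyOpNormedRing
  let _ : NormedAlgebra ℂ (Matrix (Fin n) (Fin n) ℂ) := Matrix.linftyOpNormedAlgebra
  have : CompleteSpace (Matrix (Fin n) (Fin n) ℂ) := FiniteDimensional.complete ℂ _
  let ent (i j : Fin n) : Matrix (Fin n) (Fin n) ℂ →L[ℂ] ℂ :=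
    LinearMap.toContinuousLinearMap (Matrix.entryLinearMap ℂ ℂ i j)
  let B : ℂ → Matrix (Fin n) (Fin n) ℂ := fun t => Matrix.of fun i j => A i j t
  have hB : Differentiable ℂ B := by
    have : B = fun t => ∑ i, ∑ j, A i j t • Matrix.single i j (1 : ℂ) := by
      funext t
      conv_lhs => rw [Matrix.matrix_eq_sum_single (B t)]
      simp [B, Matrix.smul_single]
    rw [this]
    exact Differentiable.fun_sum fun i _ => Differentiable.fun_sum fun j _ =>
      (hA i j).smul_const _
  -- The existence theorem multiplies by the coefficient on the left. Solving `V' = -Bᵀ V` and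
  -- transposing gives `Y = Vᵀ` with `Y' = -Y B`.
  have hBT : Differentiable ℂ fun t => -(B t).transpose :=
    ((LinearMap.toContinuousLinearMap
      (Matrix.transposeLinearEquiv (Fin n) (Fin n) ℂ ℂ).toLinearMap).differentiable.comp hB).neg
  obtain ⟨W, hW0, hW⟩ := exists_hasDerivAt_eq_mul B hB
  obtain ⟨V, hV0, hV⟩ := exists_hasDerivAt_eq_mul _ hBT
  have hY : ∀ t, HasDerivAt (fun t => (V t).transpose) (-((V t).transpose * B t)) t := fun t => by
    have := (LinearMap.toContinuousLinearMap
      (Matrix.transposeLinearEquiv (Fin n) (Fin n) ℂ ℂ).toLinearMap).hasFDerivAt.comp_hasDerivAt t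
      (hV t)
    refine this.congr_deriv ?_
    change (-(B t).transpose * V t).transpose = _
    rw [Matrix.transpose_mul, Matrix.transpose_neg, Matrix.transpose_transpose, Matrix.mul_neg]
  -- `(Y W)' = -Y B W + Y B W = 0` and `Y W = 1` at `0`. Thus `W`, a solution of `W' = B W`,
  -- provides the inverse.
  have hYW : ∀ t, (V t).transpose * W t = 1 := by
    intro t
    have hd : ∀ t, HasDerivAt (fun t => (V t).transpose * W t) 0 t := fun t => by
      refine ((hY t).mul (hW t)).congr_deriv ?_
      rw [neg_mul, mul_assoc, neg_add_cancel]
    have := is_const_of_deriv_eq_zero (fun t => (hd t).differentiableAt) (fun t => (hd t).deriv) t 0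
    rw [this, hV0, hW0, Matrix.transpose_one, one_mul]
  refine ⟨Matrix.of fun i j t => V t j i, Matrix.of fun i j t => W t i j, ?_, ?_, ?_⟩
  · ext i j t
    have := congrFun (congrFun (hYW t) i) j
    rw [Matrix.mul_apply] at this
    rw [Matrix.mul_apply, Finset.sum_apply]
    refine this.trans ?_
    rw [Matrix.one_apply, Matrix.one_apply]
    split_ifs <;> rfl
  · intro i j t
    exact ((ent i j).hasFDerivAt.comp_hasDerivAt t (hW t)).differentiableAt
  · intro i j t
    refine ((ent i j).hasFDerivAt.comp_hasDerivAt t (hY t)).congr_deriv ?_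
    change -((V t).transpose * B t) i j = _
    rw [Matrix.mul_apply, Matrix.mul_apply, Finset.sum_apply]
    rfl

end LinearODE

end

section

/-! ### The universal cover of `ℂ*` -/

open Complex in
/-- The point `exp (2πit)` of `ℂ*`. -/
def expUnit (t : ℂ) : ℂˣ := Units.mk0 (exp (2 * Real.pi * I * t)) (exp_ne_zero _)

theorem coe_expUnit (t : ℂ) :
    (expUnit t : ℂ) = Complex.exp (2 * Real.pi * Complex.I * t) := rfl

theorem expUnit_add (s t : ℂ) : expUnit (s + t) = expUnit s * expUnit t := by
  ext; simp [coe_expUnit, mul_add, Complex.exp_add]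

theorem two_pi_I_ne_zero : (2 * Real.pi * Complex.I : ℂ) ≠ 0 := Complex.two_pi_I_ne_zero

theorem expUnit_log (w : ℂˣ) : expUnit (Complex.log w / (2 * Real.pi * Complex.I)) = w := by
  ext
  rw [coe_expUnit, mul_div_cancel₀ _ two_pi_I_ne_zero, Complex.exp_log w.ne_zero]

theorem expUnit_eq_iff (s t : ℂ) : expUnit s = expUnit t ↔ ∃ n : ℤ, s = t + n := by
  rw [Units.ext_iff, coe_expUnit, coe_expUnit, Complex.exp_eq_exp_iff_exists_int]
  refine exists_congr fun n => ?_
  rw [show (2 * Real.pi * Complex.I * t + n * (2 * Real.pi * Complex.I) : ℂ) =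
    2 * Real.pi * Complex.I * (t + n) by ring]
  exact ⟨fun h => mul_left_cancel₀ two_pi_I_ne_zero h, fun h => by rw [h]⟩

theorem hasDerivAt_expUnit (t : ℂ) :
    HasDerivAt (fun t => (expUnit t : ℂ)) (2 * Real.pi * Complex.I * expUnit t) t := by
  have := ((hasDerivAt_id t).const_mul (2 * Real.pi * Complex.I : ℂ)).cexp
  simpa [coe_expUnit, mul_comm] using this

/-- The algebra of holomorphic functions on the universal cover `t ↦ z exp (2πit)` of `ℂ*`. -/
def Ent (_z : ℂˣ) : Subalgebra ℂ (ℂ → ℂ) where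
  carrier := {f | Differentiable ℂ f}
  mul_mem' hf hg := Differentiable.mul hf hg
  add_mem' hf hg := Differentiable.add hf hg
  algebraMap_mem' c := differentiable_const c

namespace Ent

variable {z : ℂˣ}

variable (z) in
/-- The derivation `τ w d/dw`, in the coordinate `t` with `w = z exp (2πit)`. -/
def derivation (τ : ℂ) : Derivation ℂ (Ent z) (Ent z) where
  toFun f := ⟨fun t => τ / (2 * Real.pi * Complex.I) * deriv (f : ℂ → ℂ) t, fun t =>
    ((f.2.analyticAt t).deriv.differentiableAt).const_mul _⟩
  map_add' f g := by
    ext t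
    change _ * deriv ((f : ℂ → ℂ) + (g : ℂ → ℂ)) t = _ * deriv (f : ℂ → ℂ) t + _ * deriv (g : ℂ → ℂ) t
    rw [deriv_add (f.2 t) (g.2 t), mul_add]
  map_smul' c f := by
    ext t
    change _ * deriv (c • (f : ℂ → ℂ)) t = c * (_ * deriv (f : ℂ → ℂ) t)
    rw [deriv_const_smul c (f.2 t), smul_eq_mul]
    ring
  map_one_eq_zero' := by
    ext t
    change _ * deriv (fun _ => (1 : ℂ)) t = 0
    simp
  leibniz' f g := by
    ext t
    change _ * deriv ((f : ℂ → ℂ) * (g : ℂ → ℂ)) t = f.1 t * (_ * deriv (g : ℂ → ℂ) t) + g.1 t * (_ * deriv (f : ℂ → ℂ) t)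
    rw [deriv_mul (f.2 t) (g.2 t)]
    ring

theorem derivation_apply (τ : ℂ) (f : Ent z) (t : ℂ) :
    (derivation z τ f : ℂ → ℂ) t = τ / (2 * Real.pi * Complex.I) * deriv (f : ℂ → ℂ) t := rfl

theorem hasDerivAt_pullback (f : Hol) (t : ℂ) :
    HasDerivAt (fun t => (f : ℂˣ → ℂ) (z * expUnit t))
      (deriv (extZero f) (z * expUnit t : ℂˣ) *
        (2 * Real.pi * Complex.I * (z * expUnit t : ℂˣ))) t := by
  have h1 : (fun t => (f : ℂˣ → ℂ) (z * expUnit t)) =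
      extZero f ∘ fun t => (z : ℂ) * expUnit t := by
    funext t
    have := extZero_coe f (z * expUnit t)
    rw [Units.val_mul] at this
    exact this.symm
  rw [h1]
  have h2 := (f.2 (z * expUnit t)).hasDerivAt
  rw [Units.val_mul] at h2 ⊢
  refine (h2.comp t ((hasDerivAt_expUnit t).const_mul (z : ℂ))).congr_deriv ?_
  ring

variable (z) in
/-- Pullback of functions to the universal cover. -/
def pullback : Hol →ₐ[ℂ] Ent z where
  toFun f := ⟨fun t => (f : ℂˣ → ℂ) (z * expUnit t), fun t =>
    (hasDerivAt_pullback f t).differentiableAt⟩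
  map_one' := rfl
  map_mul' _ _ := rfl
  map_zero' := rfl
  map_add' _ _ := rfl
  commutes' _ := rfl

/-- This algebra structure depends on the base point of the covering, which is why `Ent` is indexed
by `z` although its functions are the same for all `z`. -/
instance : Algebra Hol (Ent z) := (pullback z).toAlgebra

theorem algebraMap_apply (f : Hol) (t : ℂ) :
    (algebraMap Hol (Ent z) f : ℂ → ℂ) t = (f : ℂˣ → ℂ) (z * expUnit t) := rfl

instance : IsScalarTower ℂ Hol (Ent z) :=
  IsScalarTower.of_algebraMap_eq fun c => ((pullback z).commutes c).symm

/-- For `w = z exp(2πit)` one has `dw/dt = 2πi w`, so `τ w d/dw` pulls back to `(τ/2πi) d/dt`. -/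
instance (τ : ℂ) : EqDiffMod.ExtendsDerivation (eulerDerivation τ) (derivation z τ) where
  map_algebraMap f := by
    ext t
    rw [derivation_apply, algebraMap_apply, eulerDerivation_apply]
    have h := (hasDerivAt_pullback (z := z) f t).deriv
    change _ * deriv (fun t => (f : ℂˣ → ℂ) (z * expUnit t)) t = _
    rw [h]
    field_simp [two_pi_I_ne_zero]

theorem algebraMap_injective : Function.Injective (algebraMap Hol (Ent z)) := by
  intro f g h
  ext w
  have := congrFun (congrArg Subtype.val h) (Complex.log (z⁻¹ * w : ℂˣ) / (2 * Real.pi * Complex.I))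
  change (f : ℂˣ → ℂ) _ = (g : ℂˣ → ℂ) _ at this
  rwa [expUnit_log, mul_inv_cancel_left] at this

theorem hasTrivialConstants {τ : ℂ} (hτ : τ ≠ 0) :
    EqDiffMod.HasTrivialConstants (derivation z τ) where
  exists_algebraMap f hf := by
    refine ⟨(f : ℂ → ℂ) 0, ?_⟩
    ext t
    have h : ∀ t, deriv (f : ℂ → ℂ) t = 0 := fun t => by
      have := congrFun (congrArg Subtype.val hf) t
      rw [derivation_apply] at this
      exact (mul_eq_zero.1 this).resolve_left (div_ne_zero hτ two_pi_I_ne_zero)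
    exact is_const_of_deriv_eq_zero f.2 h 0 t

/-- Translation by `a` on the universal cover. -/
def translateHom (a : ℂ) : Ent z →ₐ[ℂ] Ent z where
  toFun f := ⟨fun t => (f : ℂ → ℂ) (t + a), f.2.comp (differentiable_id.add_const a)⟩
  map_one' := rfl
  map_mul' _ _ := rfl
  map_zero' := rfl
  map_add' _ _ := rfl
  commutes' _ := rfl

@[simp]
theorem translateHom_apply (a : ℂ) (f : Ent z) (t : ℂ) :
    (translateHom a f : ℂ → ℂ) t = (f : ℂ → ℂ) (t + a) := rfl

variable (z) in
/-- The action of `ℂ` on functions on the universal cover by translations. -/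
def translate : Multiplicative ℂ →* (Ent z ≃ₐ[ℂ] Ent z) where
  toFun a := AlgEquiv.ofAlgHom (translateHom a.toAdd) (translateHom (-a.toAdd))
    (by ext f t; simp) (by ext f t; simp)
  map_one' := by ext f t; simp
  map_mul' a b := by ext f t; simp [add_comm, add_left_comm]

/-- Functions of period `1` on the universal cover are functions on `ℂ*`. -/
theorem exists_algebraMap_of_periodic (f : Ent z)
    (hf : ∀ t, (f : ℂ → ℂ) (t + 1) = (f : ℂ → ℂ) t) : ∃ g : Hol, algebraMap Hol (Ent z) g = f := by
  have hper : ∀ s t : ℂ, expUnit s = expUnit t → (f : ℂ → ℂ) s = (f : ℂ → ℂ) t := by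
    intro s t hst
    obtain ⟨n, rfl⟩ := (expUnit_eq_iff s t).1 hst
    have : Function.Periodic (f : ℂ → ℂ) 1 := hf
    simpa using this.int_mul n t
  -- The principal logarithm is discontinuous along a ray, but its jumps change the argument of `f`
  -- by an integer, which periodicity ignores.
  let g : ℂˣ → ℂ := fun w => (f : ℂ → ℂ)
    (Complex.log (z⁻¹ * w : ℂˣ) / (2 * Real.pi * Complex.I))
  have hg : ∀ t, g (z * expUnit t) = (f : ℂ → ℂ) t := fun t => by
    refine hper _ _ ?_
    rw [expUnit_log, inv_mul_cancel_left]
  have hol : IsHol g := by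
    intro w
    let t₀ := Complex.log (z⁻¹ * w : ℂˣ) / (2 * Real.pi * Complex.I)
    -- Near `w` another branch is used: `log (u / w)` is holomorphic at `u = w`, because `1` lies in
    -- the slit plane. The two branches give the same values by periodicity.
    let G : ℂ → ℂ := fun u => (f : ℂ → ℂ)
      (t₀ + Complex.log (u / w) / (2 * Real.pi * Complex.I))
    have hG : ∀ u : ℂˣ, g u = G u := fun u => by
      have h1 : z * expUnit (t₀ + Complex.log (u / w : ℂˣ) / (2 * Real.pi * Complex.I)) = u := by
        rw [expUnit_add, expUnit_log, expUnit_log]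
        simp
      have := hg (t₀ + Complex.log (u / w : ℂˣ) / (2 * Real.pi * Complex.I))
      rw [h1] at this
      rw [this]
      simp only [G, Units.val_div_eq_div_val]
    refine DifferentiableAt.congr_of_eventuallyEq ?_ (extZero_eventuallyEq hG w)
    refine (f.2 _).comp _ (((DifferentiableAt.clog ?_ ?_).div_const _).const_add t₀)
    · exact differentiableAt_id.div_const _
    · rw [div_self w.ne_zero]
      exact Complex.one_mem_slitPlane
  exact ⟨⟨g, hol⟩, by ext t; exact hg t⟩

theorem analyticAt_log_div (z : ℂˣ) :
    AnalyticAt ℂ (fun w : ℂ => Complex.log (w / z) / (2 * Real.pi * Complex.I)) z := by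
  refine (AnalyticAt.clog (analyticAt_id.div analyticAt_const z.ne_zero) ?_).div analyticAt_const
    two_pi_I_ne_zero
  change (z : ℂ) / (z : ℂ) ∈ _
  rw [div_self z.ne_zero]
  exact Complex.one_mem_slitPlane

variable (z) in
/-- The germ at `z` of a function on the universal cover, by means of the local inverse of the
covering that sends `z` to `0`. -/
def germ : Ent z →ₐ[Hol] HolGerm (z : ℂ) where
  toFun f := HolGerm.mk
    (fun w => (f : ℂ → ℂ) (Complex.log (w / z) / (2 * Real.pi * Complex.I)))
    ((f.2.analyticAt _).comp (analyticAt_log_div z))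
  map_one' := rfl
  map_mul' _ _ := rfl
  map_zero' := rfl
  map_add' _ _ := rfl
  commutes' f := Subtype.ext (Filter.Germ.coe_eq.2 (by
    refine (extZero_eventuallyEq (fun w => ?_) z).symm
    rw [algebraMap_apply]
    have h := expUnit_log (w / z)
    rw [Units.val_div_eq_div_val] at h
    rw [h, mul_div_cancel]))

theorem germ_derivation (τ : ℂ) (f : Ent z) :
    germ z (derivation z τ f) = eulerDerivationGerm τ z (germ z f) := by
  refine Subtype.ext (Filter.Germ.coe_eq.2 ?_)
  have hslit : ∀ᶠ w : ℂ in nhds (z : ℂ), w / (z : ℂ) ∈ Complex.slitPlane := by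
    have hc : ContinuousAt (fun w : ℂ => w / (z : ℂ)) z := continuousAt_id.div_const _
    refine hc.eventually_mem (Complex.isOpen_slitPlane.mem_nhds ?_)
    rw [div_self z.ne_zero]
    exact Complex.one_mem_slitPlane
  filter_upwards [hslit, isOpen_ne.mem_nhds (show (z : ℂ) ≠ 0 from z.ne_zero)] with w hw hw0
  have hl : HasDerivAt (fun w : ℂ => Complex.log (w / z) / (2 * Real.pi * Complex.I))
      (w⁻¹ / (2 * Real.pi * Complex.I)) w := by
    refine ((((hasDerivAt_id w).div_const (z : ℂ)).clog hw).div_const _).congr_deriv ?_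
    have := z.ne_zero
    simp only [id]
    field_simp
  have hd := (f.2 _).hasDerivAt.comp w hl
  change τ / (2 * Real.pi * Complex.I) * deriv (f : ℂ → ℂ) (Complex.log (w / z) / (2 * Real.pi * Complex.I)) =
    τ * w * deriv (fun w => (f : ℂ → ℂ) (Complex.log (w / z) / (2 * Real.pi * Complex.I))) w
  have hd' := hd.deriv
  simp only [Function.comp_def] at hd'
  rw [hd']
  have hw0' : w ≠ 0 := hw0
  field_simp

end Ent

/-- Near `z` the factor `τ w` does not vanish, so the derivative vanishes on a ball. Convexity of
the ball makes the function constant there. -/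
theorem HolGerm.hasTrivialConstants {τ : ℂ} (hτ : τ ≠ 0) (z : ℂˣ) :
    EqDiffMod.HasTrivialConstants (eulerDerivationGerm τ (z : ℂ)) where
  exists_pair_ne := exists_pair_ne (HolGerm (z : ℂ))
  exists_algebraMap := by
    rintro ⟨_, f, hf, rfl⟩ h
    have h1 : ∀ᶠ w in nhds (z : ℂ), τ * w * deriv f w = 0 :=
      Filter.Germ.coe_eq.1 (congrArg Subtype.val h)
    have h2 : ∀ᶠ w in nhds (z : ℂ), DifferentiableAt ℂ f w ∧ deriv f w = 0 := by
      filter_upwards [h1, hf.eventually_analyticAt, isOpen_ne.mem_nhds (show (z : ℂ) ≠ 0 from z.ne_zero)] with w hw hw' hw0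
      exact ⟨hw'.differentiableAt, (mul_eq_zero.1 hw).resolve_left (mul_ne_zero hτ hw0)⟩
    obtain ⟨ε, hε, hball⟩ := Metric.eventually_nhds_iff_ball.1 h2
    refine ⟨f z, Subtype.ext ?_⟩
    rw [Algebra.algebraMap_eq_smul_one]
    refine Filter.Germ.coe_eq.2 ?_
    filter_upwards [Metric.ball_mem_nhds (z : ℂ) hε] with w hw
    have hconst : f z = f w := (convex_ball (z : ℂ) ε).is_const_of_fderivWithin_eq_zero (𝕜 := ℂ)
      (fun x hx => (hball x hx).1.differentiableWithinAt)
      (fun x hx => by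
        rw [fderivWithin_of_isOpen Metric.isOpen_ball hx]
        ext
        simpa using (hball x hx).2)
      (Metric.mem_ball_self hε) hw
    change f z * 1 = f w
    rw [mul_one, hconst]

end

/-! ### Solution bases from fundamental matrices -/

section

namespace EqDiffMod

/-- The rows of `Y` are the coordinates of the solutions. With `A` the connection matrix and `vᵢ = ∑
Yᵢⱼ eⱼ`, the `j`-th coordinate of `∇ vᵢ` is `δ(Yᵢⱼ) + ∑ₖ Yᵢₖ Aₖⱼ = 0`. As `det Y` is a unit, the
`vᵢ` form a basis. -/
theorem hasHorizontalBasis_of_fundamentalMatrix {R S G : Type} [CommRing R] [Algebra ℂ R] [Group G]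
    {δ : Derivation ℂ R R} {α : G →* (R ≃ₐ[ℂ] R)} [CommRing S] [Algebra ℂ S] [Algebra R S]
    [IsScalarTower ℂ R S] (δS : Derivation ℂ S S) [ExtendsDerivation δ δS]
    (M : EqDiffMod δ α) {n : ℕ} (e : Module.Basis (Fin n) R M)
    (Y W : Matrix (Fin n) (Fin n) S) (hYW : Y * W = 1)
    (hY : ∀ i j, δS (Y i j) = -∑ k, Y i k * algebraMap R S (e.repr (M.conn (e k)) j)) :
    HasHorizontalBasis δS M := by
  let b₀ : Module.Basis (Fin n) S (S ⊗[R] M) := e.baseChange S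
  let v : Fin n → S ⊗[R] M := fun i => ∑ j, Y i j • b₀ j
  have hdet : IsUnit (b₀.det v) := by
    have h1 : b₀.toMatrix v = Y.transpose := by
      ext i j
      simp [Module.Basis.toMatrix_apply, v, Finsupp.single_apply]
    rw [Module.Basis.det_apply, h1, Matrix.det_transpose]
    exact IsUnit.of_mul_eq_one (W.det) (by rw [← Matrix.det_mul, hYW, Matrix.det_one])
  obtain ⟨hli, hsp⟩ := (Module.Basis.is_basis_iff_det b₀).2 hdet
  refine ⟨n, Module.Basis.mk hli hsp.ge, fun i => ?_⟩
  rw [Module.Basis.mk_apply]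
  have hb : ∀ j, extendedConnection δS M (b₀ j) =
      ∑ k, algebraMap R S (e.repr (M.conn (e j)) k) • b₀ k := fun j => by
    simp only [b₀, Module.Basis.baseChange_apply, extendedConnection_tmul,
      Derivation.map_one_eq_zero, zero_tmul, zero_add]
    conv_lhs => rw [← e.sum_repr (M.conn (e j)), tmul_sum]
    refine Finset.sum_congr rfl fun k _ => ?_
    rw [tmul_smul, smul_tmul', smul_tmul', Algebra.smul_def, smul_eq_mul]
  simp only [v, map_sum]
  have h3 : ∀ j, extendedConnection δS M (Y i j • b₀ j) =
      -∑ k, (Y i k * algebraMap R S (e.repr (M.conn (e k)) j)) • b₀ j +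
        ∑ k, (Y i j * algebraMap R S (e.repr (M.conn (e j)) k)) • b₀ k := fun j => by
    rw [extendedConnection_smul, hb, hY, Finset.smul_sum]
    have h4 : ∀ (s : S) (x : S ⊗[R] M), (-s) • x = -(s • x) := fun s x => neg_smul s x
    rw [h4, Finset.sum_smul]
    simp only [smul_smul]
  rw [Finset.sum_congr rfl fun j _ => h3 j, Finset.sum_add_distrib, Finset.sum_neg_distrib,
    Finset.sum_comm, neg_add_cancel]

end EqDiffMod

theorem Ent.exists_fundamentalMatrix {τ : ℂ} (hτ : τ ≠ 0) (z : ℂˣ) {n : ℕ}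
    (A : Matrix (Fin n) (Fin n) (Ent z)) : ∃ Y W : Matrix (Fin n) (Fin n) (Ent z),
      Y * W = 1 ∧ ∀ i j, Ent.derivation z τ (Y i j) = -∑ k, Y i k * A k j := by
  -- The derivation is `c d/dt`, so the equation is solved with `c⁻¹ A` in place of `A`.
  let c : ℂ := τ / (2 * Real.pi * Complex.I)
  have hc : c ≠ 0 := div_ne_zero hτ two_pi_I_ne_zero
  obtain ⟨Y, W, hYW, hW, hY⟩ := EquivariantRH.exists_fundamentalMatrix
    (Matrix.of fun i j => c⁻¹ • ((A i j : Ent z) : ℂ → ℂ)) (fun i j => (A i j).2.const_smul c⁻¹)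
  refine ⟨Matrix.of fun i j => ⟨Y i j, fun t => (hY i j t).differentiableAt⟩,
    Matrix.of fun i j => ⟨W i j, hW i j⟩,
    ?_, fun i j => ?_⟩
  · ext i j t
    have := congrFun (congrFun (congrFun hYW i) j) t
    simp only [Matrix.mul_apply, Matrix.one_apply, AddSubmonoidClass.coe_finsetSum,
      Finset.sum_apply] at this ⊢
    refine Eq.trans ?_ (this.trans ?_)
    · simp
    · split_ifs <;> rfl
  · ext t
    rw [Ent.derivation_apply]
    have h1 := (hY i j t).deriv
    change c * deriv (Y i j) t = _
    rw [h1]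
    simp only [Matrix.mul_apply, Pi.neg_apply, Finset.sum_apply, Pi.mul_apply,
      Pi.smul_apply, smul_eq_mul, NegMemClass.coe_neg, AddSubmonoidClass.coe_finsetSum,
      MulMemClass.coe_mul, Matrix.of_apply]
    rw [mul_neg, Finset.mul_sum]
    congr 1
    refine Finset.sum_congr rfl fun k _ => ?_
    field_simp

theorem Ent.hasHorizontalBasis {θ : ℝ} {τ : ℂ} (hτ : τ ≠ 0) (z : ℂˣ)
    (M : EqDiffMod (eulerDerivation τ) (thetaAction θ)) {n : ℕ} (e : Module.Basis (Fin n) Hol M) :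
    EqDiffMod.HasHorizontalBasis (Ent.derivation z τ) M := by
  obtain ⟨Y, W, hYW, hY⟩ := Ent.exists_fundamentalMatrix hτ z
    (Matrix.of fun i j => algebraMap Hol (Ent z) (e.repr (M.conn (e i)) j))
  exact EqDiffMod.hasHorizontalBasis_of_fundamentalMatrix _ M e Y W hYW hY

/-- The local solutions are the germs of the global ones on the cover; no separate local existence
theorem is needed. -/
theorem HolGerm.hasHorizontalBasis {θ : ℝ} {τ : ℂ} (hτ : τ ≠ 0) (z : ℂˣ)
    (M : EqDiffMod (eulerDerivation τ) (thetaAction θ)) {n : ℕ} (e : Module.Basis (Fin n) Hol M) :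
    EqDiffMod.HasHorizontalBasis (eulerDerivationGerm τ (z : ℂ)) M :=
  (Ent.hasHorizontalBasis hτ z M e).changeRing (Ent.germ z) (Ent.germ_derivation τ)

end

/-! ### Logarithms and holomorphic one-parameter groups -/

section

/-- If `1 + c (a - 1)` is invertible for all but countably many `c ∈ ℂ`, then the invertible
element `a` of a commutative complex Banach algebra is an exponential. -/
theorem exists_exp_eq_of_countable {A : Type} [NormedCommRing A] [NormedAlgebra ℂ A]
    [CompleteSpace A] (a : A) (ha : IsUnit a)
    (hc : {c : ℂ | ¬IsUnit (1 + c • (a - 1))}.Countable) : ∃ b : A, NormedSpace.exp b = a := by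
  let _ : NormedAlgebra ℚ A := NormedAlgebra.restrictScalars ℚ ℂ A
  -- The derivative of `exp` at `0` is the identity, so by the inverse function theorem every
  -- element near `1` is an exponential.
  have hexp : Set.range (NormedSpace.exp : A → A) ∈ nhds (1 : A) := by
    have h := (hasStrictFDerivAt_exp_zero (𝕂 := ℂ) (𝔸 := A)).map_nhds_eq_of_surj
      (LinearMap.range_eq_top.2 fun x => ⟨x, rfl⟩)
    rw [NormedSpace.exp_zero] at h
    rw [← h]
    exact Filter.range_mem_map
  -- The complex line through `1 = g 0` and `a = g 1`. The parameters where `g` is invertible form a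
  -- connected set, on which being an exponential is an open and closed condition.
  let g : ℂ → A := fun c => 1 + c • (a - 1)
  have hg : Continuous g := by fun_prop
  have hnear : ∀ c (x : A), x * g c = 1 →
      ∀ᶠ c' in nhds c, ∃ b : A, x * g c' = NormedSpace.exp b := by
    intro c x hx
    have h1 : Filter.Tendsto (fun c' => x * g c') (nhds c) (nhds 1) := by
      rw [← hx]
      exact (continuous_const.mul hg).tendsto c
    filter_upwards [h1 hexp] with c' ⟨b, hb⟩
    exact ⟨b, hb.symm⟩
  -- The complement of a countable set in `ℂ` is path connected, the real dimension being greater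
  -- than one.
  have hs : IsPreconnected {c | IsUnit (g c)} := by
    have := (hc.isPathConnected_compl_of_one_lt_rank (by simp)).isConnected.isPreconnected
    simpa [Set.compl_ofPred, g] using this
  have hu : IsOpen {c | ∃ b, NormedSpace.exp b = g c} := by
    rw [isOpen_iff_mem_nhds]
    rintro c ⟨b, hb⟩
    filter_upwards [hnear c (NormedSpace.exp (-b)) (by
      rw [← hb, ← NormedSpace.exp_add, neg_add_cancel, NormedSpace.exp_zero])] with c' ⟨b', hb'⟩
    refine ⟨b + b', ?_⟩
    rw [NormedSpace.exp_add, ← hb', ← mul_assoc, ← NormedSpace.exp_add, add_neg_cancel,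
      NormedSpace.exp_zero, one_mul]
  have hv : IsOpen {c | IsUnit (g c) ∧ ¬∃ b, NormedSpace.exp b = g c} := by
    rw [isOpen_iff_mem_nhds]
    rintro c ⟨hcu, hc'⟩
    obtain ⟨x, hx⟩ := hcu.exists_left_inv
    filter_upwards [hnear c x hx, hg.continuousAt.preimage_mem_nhds
      (Units.isOpen.mem_nhds hcu)] with c' ⟨b', hb'⟩ hcu'
    refine ⟨hcu', fun ⟨b, hb⟩ => hc' ⟨b - b', ?_⟩⟩
    have h2 : g c' = g c * NormedSpace.exp b' := by
      rw [← hb', ← mul_assoc, mul_comm (g c), hx, one_mul]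
    rw [sub_eq_add_neg, NormedSpace.exp_add, hb, h2, mul_assoc, ← NormedSpace.exp_add,
      add_neg_cancel, NormedSpace.exp_zero, mul_one]
  have hmem : (1 : ℂ) ∈ {c | ∃ b, NormedSpace.exp b = g c} := by
    refine IsPreconnected.subset_left_of_subset_union hu hv ?_ ?_ ⟨0, ?_, 0, ?_⟩ hs ?_
    · rw [Set.disjoint_left]
      exact fun c h1 h2 => h2.2 h1
    · intro c h
      by_cases h' : ∃ b, NormedSpace.exp b = g c
      · exact Or.inl h'
      · exact Or.inr ⟨h, h'⟩
    · simp [g]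
    · simp [g]
    · simpa [g] using ha
  simpa [g] using hmem

/-- In a finite dimensional complex Banach algebra, every invertible element `a` has a logarithm
that commutes with everything that commutes with `a`. -/
theorem exists_exp_eq {A : Type} [NormedRing A] [NormedAlgebra ℂ A] [FiniteDimensional ℂ A] (a : A)
    (ha : IsUnit a) : ∃ b : A, NormedSpace.exp b = a ∧ ∀ s, Commute s a → Commute s b := by
  have : CompleteSpace A := FiniteDimensional.complete ℂ A
  -- The closed subalgebra generated by `a` is commutative, and a logarithm found in it commutes
  -- with everything that commutes with `a`.
  let B := Algebra.elemental ℂ a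
  let _ : NormedCommRing B :=
    { (inferInstance : NormedRing B) with mul_comm := (inferInstance : CommRing B).mul_comm }
  -- Inverses stay in `B`: it is Artinian, so its non-zero-divisors are units.
  have hunit : ∀ x : B, IsUnit (x : A) → IsUnit x := fun x hx => by
    have : IsArtinianRing B := IsArtinianRing.of_finite ℂ B
    refine IsArtinianRing.isUnit_of_mem_nonZeroDivisors (mem_nonZeroDivisors_iff_right.2 ?_)
    intro y hy
    refine Subtype.ext (hx.mul_left_eq_zero.1 ?_)
    exact congrArg Subtype.val hy
  -- The spectrum is contained in that of left multiplication by `a - 1`, an endomorphism of a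
  -- finite dimensional space.
  have hspec : (spectrum ℂ (a - 1)).Finite := by
    have h := Module.End.finite_spectrum (Algebra.lmul ℂ A (a - 1))
    refine h.subset fun c hc hu => hc ?_
    have hu' : IsUnit (Algebra.lmul ℂ A (algebraMap ℂ A c - (a - 1))) := by
      rw [map_sub, AlgHom.commutes]
      exact hu
    obtain ⟨hinj, hsurj⟩ := (Module.End.isUnit_iff _).1 hu'
    obtain ⟨y, hy⟩ := hsurj 1
    change (algebraMap ℂ A c - (a - 1)) * y = 1 at hy
    refine ⟨⟨_, y, hy, hinj ?_⟩, rfl⟩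
    change (algebraMap ℂ A c - (a - 1)) * (y * (algebraMap ℂ A c - (a - 1))) =
      (algebraMap ℂ A c - (a - 1)) * 1
    rw [← mul_assoc, hy, one_mul, mul_one]
  obtain ⟨b, hb⟩ := exists_exp_eq_of_countable (⟨a, Algebra.elemental.self_mem ℂ a⟩ : B)
    (hunit _ ha) (by
      -- If `1 + c (a - 1)` is not invertible, then `c ≠ 0` and `-c⁻¹` lies in the spectrum of `a -
      -- 1`, which leaves finitely many `c`.
      refine ((hspec.image fun c => -c⁻¹).subset fun c hc => ?_).countable
      have hc' : ¬ IsUnit (1 + c • (a - 1)) := fun h => hc (hunit _ h)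
      have hc0 : c ≠ 0 := by
        rintro rfl
        simp at hc'
      refine ⟨-c⁻¹, fun h => hc' ?_, by simp⟩
      have h2 : 1 + c • (a - 1) = Units.mk0 (-c) (neg_ne_zero.2 hc0) •
          (algebraMap ℂ A (-c⁻¹) - (a - 1)) := by
        rw [Units.smul_mk0, smul_sub (-c), Algebra.algebraMap_eq_smul_one, smul_smul,
          neg_mul_neg, mul_inv_cancel₀ hc0, one_smul, neg_smul, sub_neg_eq_add]
      rw [h2]
      exact h.smul _)
  refine ⟨b, ?_, fun s hs => ?_⟩
  · let _ : NormedAlgebra ℚ B := NormedAlgebra.restrictScalars ℚ ℂ B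
    let _ : NormedAlgebra ℚ A := NormedAlgebra.restrictScalars ℚ ℂ A
    have h := congrArg Subtype.val hb
    have h2 := NormedSpace.map_exp (f := B.val) continuous_subtype_val b
    exact h2.symm.trans h
  -- `b` lies in the double centralizer of `a`.
  · have := Algebra.elemental.le_centralizer_centralizer ℂ a b.2
    rw [Subalgebra.mem_centralizer_iff] at this
    exact this s (by
      rw [SetLike.mem_coe, Subalgebra.mem_centralizer_iff]
      rintro _ rfl
      exact hs.symm)

/-- `E(t) = exp(t b)` for a logarithm `b` of `T`. The algebra `A` is a normed copy of `End V`, in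
which the exponential series makes sense. Linear functionals transfer the derivative back to `V`, so
no topology on `V` is used. -/
theorem exists_oneParameterGroup_of_algEquiv {V A : Type} [AddCommGroup V] [Module ℂ V]
    [NormedRing A] [NormedAlgebra ℂ A] [FiniteDimensional ℂ A] (e : Module.End ℂ V ≃ₐ[ℂ] A)
    (T : Module.End ℂ V) (hT : IsUnit T) :
    ∃ (E : Multiplicative ℂ →* Module.End ℂ V) (B : Module.End ℂ V),
      E (Multiplicative.ofAdd 1) = T ∧ (∀ S, Commute S T → Commute S B) ∧
      (∀ S, Commute S T → ∀ t, Commute S (E t)) ∧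
      ∀ (l : V →ₗ[ℂ] ℂ) (v : V) (t : ℂ), HasDerivAt (fun t => l (E (Multiplicative.ofAdd t) v))
        (l (B (E (Multiplicative.ofAdd t) v))) t := by
  let _ : NormedAlgebra ℚ A := NormedAlgebra.restrictScalars ℚ ℂ A
  have : CompleteSpace A := FiniteDimensional.complete ℂ A
  obtain ⟨b, hb, hcomm⟩ := exists_exp_eq (e T) (hT.map e)
  have hcomm' : ∀ S, Commute S T → Commute (e S) b := fun S hS => hcomm _ (hS.map e)
  let E : Multiplicative ℂ →* Module.End ℂ V :=
    { toFun := fun t => e.symm (NormedSpace.exp (t.toAdd • b))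
      map_one' := by simp
      map_mul' := fun s t => by
        rw [toAdd_mul, add_smul, NormedSpace.exp_add_of_commute, map_mul]
        exact ((Commute.refl b).smul_left _).smul_right _ }
  have hE : ∀ t : ℂ, E (Multiplicative.ofAdd t) = e.symm (NormedSpace.exp (t • b)) := fun _ => rfl
  refine ⟨E, e.symm b, ?_, fun S hS => ?_, fun S hS t => ?_, fun l v t => ?_⟩
  · rw [hE, one_smul, hb, e.symm_apply_apply]
  · simpa using (hcomm' S hS).map e.symm
  · have := (((hcomm' S hS).smul_right t.toAdd).exp_right).map e.symm
    rwa [e.symm_apply_apply] at this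
  · let L : A →ₗ[ℂ] ℂ :=
      l ∘ₗ LinearMap.applyₗ v ∘ₗ e.symm.toLinearMap
    have h := (LinearMap.toContinuousLinearMap L).hasFDerivAt.comp_hasDerivAt t
      (hasDerivAt_exp_smul_const' (𝕂 := ℂ) b t)
    refine h.congr_deriv ?_
    change l (e.symm (b * NormedSpace.exp (t • b)) v) = _
    rw [map_mul, hE]
    rfl

/-- An invertible endomorphism `T` of a finite dimensional vector space is the value at `1` of a
holomorphic one-parameter group commuting with everything that commutes with `T`. -/
theorem exists_oneParameterGroup {V : Type} [AddCommGroup V] [Module ℂ V] [Module.Finite ℂ V]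
    (T : Module.End ℂ V) (hT : IsUnit T) :
    ∃ (E : Multiplicative ℂ →* Module.End ℂ V) (B : Module.End ℂ V),
      E (Multiplicative.ofAdd 1) = T ∧ (∀ S, Commute S T → Commute S B) ∧
      (∀ S, Commute S T → ∀ t, Commute S (E t)) ∧
      ∀ (l : V →ₗ[ℂ] ℂ) (v : V) (t : ℂ), HasDerivAt (fun t => l (E (Multiplicative.ofAdd t) v))
        (l (B (E (Multiplicative.ofAdd t) v))) t := by
  let _ : NormedRing (Matrix (Fin (Module.finrank ℂ V)) (Fin (Module.finrank ℂ V)) ℂ) :=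
    Matrix.linftyOpNormedRing
  let _ : NormedAlgebra ℂ (Matrix (Fin (Module.finrank ℂ V)) (Fin (Module.finrank ℂ V)) ℂ) :=
    Matrix.linftyOpNormedAlgebra
  exact exists_oneParameterGroup_of_algEquiv (LinearMap.toMatrixAlgEquiv (Module.finBasis ℂ V)) T hT

end

/-! ### Equivariant modules with constant coefficients -/

section

theorem surjective_of_injective_of_finrank_eq {V W : Type} [AddCommMonoid V] [Module ℂ V]
    [AddCommMonoid W] [Module ℂ W] [Module.Finite ℂ V] [Module.Finite ℂ W] {L : V →ₗ[ℂ] W}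
    (h : Module.finrank ℂ V = Module.finrank ℂ W) (hL : Function.Injective L) :
    Function.Surjective L := by
  let _ : AddCommGroup V := Module.addCommMonoidToAddCommGroup ℂ
  let _ : AddCommGroup W := Module.addCommMonoidToAddCommGroup ℂ
  exact (LinearMap.injective_iff_surjective_of_finrank_eq_finrank h).1 hL

namespace EqDiffMod

variable {R G : Type} [CommRing R] [Algebra ℂ R] [Group G]
  (δ : Derivation ℂ R R) (α : G →* (R ≃ₐ[ℂ] R))
  {V : Type} [AddCommGroup V] [Module ℂ V] (N : Module.End ℂ V) (C : Representation ℂ G V)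

/-- The connection `δ ⊗ 1 + 1 ⊗ N` on `R ⊗ V`. -/
def constConn : R ⊗[ℂ] V →ₗ[ℂ] R ⊗[ℂ] V :=
  TensorProduct.map δ.toLinearMap LinearMap.id + TensorProduct.map LinearMap.id N

@[simp]
theorem constConn_tmul (r : R) (v : V) : constConn δ N (r ⊗ₜ v) = δ r ⊗ₜ v + r ⊗ₜ N v := rfl

/-- The equivariant differential module `R ⊗ V`, with connection `δ ⊗ 1 + 1 ⊗ N` and action
`α ⊗ C`. -/
def ofConst [IsEquivariantDerivation δ α] (hNC : ∀ g v, N (C g v) = C g (N v)) :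
    EqDiffMod δ α where
  carrier := R ⊗[ℂ] V
  σ g :=
    { toFun := TensorProduct.map (α g).toLinearMap (C g)
      map_add' := map_add _
      map_smul' := fun r x => by
        induction x with
        | zero => simp
        | add x y hx hy => simp only [smul_add, map_add, hx, hy]
        | tmul s v => simp [smul_tmul'] }
  σ_one x := by
    change TensorProduct.map (α 1).toLinearMap (C 1) x = x
    induction x with
    | zero => simp
    | add x y hx hy => simp only [map_add, hx, hy]
    | tmul s v => simp
  σ_mul g h x := by
    change TensorProduct.map (α (g * h)).toLinearMap (C (g * h)) x =
      TensorProduct.map (α g).toLinearMap (C g) (TensorProduct.map (α h).toLinearMap (C h) x)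
    induction x with
    | zero => simp
    | add x y hx hy => simp only [map_add, hx, hy]
    | tmul s v => simp
  conn := (constConn δ N).toAddMonoidHom
  isConnection r x := by
    change constConn δ N (r • x) = r • constConn δ N x + δ r • x
    induction x with
    | zero => simp
    | add x y hx hy => simp only [smul_add, map_add, hx, hy]; abel
    | tmul s v => simp [smul_tmul', add_tmul, mul_comm s]; abel
  conn_σ g x := by
    change constConn δ N (TensorProduct.map (α g).toLinearMap (C g) x) =
      TensorProduct.map (α g).toLinearMap (C g) (constConn δ N x)
    induction x with
    | zero => simp
    | add x y hx hy => simp only [map_add, hx, hy]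
    | tmul s v => simp [IsEquivariantDerivation.comm, hNC]

variable {δ α N C} [IsEquivariantDerivation δ α] {hNC : ∀ g v, N (C g v) = C g (N v)}
  {S : Type} [CommRing S] [Algebra ℂ S] [Algebra R S] [IsScalarTower ℂ R S]
  {δS : Derivation ℂ S S} [ExtendsDerivation δ δS]
  {K : Type} [Group K] {π : K →* G} {β : K →* (S ≃ₐ[ℂ] S)} (h : ExtendsAction α δS π β)

/-- The basis of `R ⊗ V` given by a basis of `V`. -/
def ofConstBasis {n : ℕ} (b : Module.Basis (Fin n) ℂ V) :
    Module.Basis (Fin n) R (ofConst δ α N C hNC) :=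
  b.baseChange R

/-- A constant connection matrix makes the regular singular condition immediate. -/
theorem conn_ofConstBasis {n : ℕ} (b : Module.Basis (Fin n) ℂ V) (i j : Fin n) :
    (ofConstBasis (hNC := hNC) b).repr ((ofConst δ α N C hNC).conn (ofConstBasis b i)) j =
      algebraMap ℂ R (b.repr (N (b i)) j) := by
  have h1 : (ofConst δ α N C hNC).conn (ofConstBasis b i) = (1 : R) ⊗ₜ[ℂ] N (b i) := by
    change constConn δ N (b.baseChange R i) = _
    rw [Module.Basis.baseChange_apply, constConn_tmul, Derivation.map_one_eq_zero, zero_tmul,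
      zero_add]
  rw [h1]
  refine (Module.Basis.baseChange_repr_tmul R b (1 : R) (N (b i)) j).trans ?_
  exact (Algebra.algebraMap_eq_smul_one _).symm

/-- The element `∑ c (b_i^*) ⊗ b_i` of `S ⊗ V = S ⊗ (R ⊗ V)`, which depends only on `c`. -/
def dualElem (hNC : ∀ g v, N (C g v) = C g (N v)) {n : ℕ} (b : Module.Basis (Fin n) ℂ V) :
    (Module.Dual ℂ V →ₗ[ℂ] S) →ₗ[ℂ] S ⊗[R] ofConst δ α N C hNC where
  toFun c := ∑ j, c (b.coord j) ⊗ₜ[R] ofConstBasis (hNC := hNC) b j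
  map_add' c c' := by simp [add_tmul, Finset.sum_add_distrib]
  map_smul' c c' := by simp [smul_tmul', Finset.smul_sum]

theorem dualElem_apply {n : ℕ} (b : Module.Basis (Fin n) ℂ V) (c : Module.Dual ℂ V →ₗ[ℂ] S) :
    dualElem hNC b c = ∑ j, c (b.coord j) ⊗ₜ[R] ofConstBasis (hNC := hNC) (δ := δ) (α := α) b j :=
  rfl

/-- The canonical element `∑ bⱼ* ⊗ bⱼ` of `V* ⊗ V` allows an endomorphism of `V` to be moved to its
transpose on `V*`. In this way the connection and the shifts on `S ⊗ V` become operations on the map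
`c`. -/
theorem sum_tmul_map {n : ℕ} (b : Module.Basis (Fin n) ℂ V) (c : Module.Dual ℂ V →ₗ[ℂ] S)
    (L : Module.End ℂ V) :
    ∑ j, c (b.coord j) ⊗ₜ[R] (show ofConst δ α N C hNC from (1 : R) ⊗ₜ[ℂ] L (b j)) =
      dualElem hNC b (c ∘ₗ L.dualMap) := by
  have h1 : ∀ j, c (b.coord j) ⊗ₜ[R] (show ofConst δ α N C hNC from (1 : R) ⊗ₜ[ℂ] L (b j)) =
      ∑ i, (b.coord i (L (b j)) • c (b.coord j)) ⊗ₜ[R] ofConstBasis (hNC := hNC) b i := fun j => by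
    have h2 : (show ofConst δ α N C hNC from (1 : R) ⊗ₜ[ℂ] L (b j)) =
        ∑ i, algebraMap ℂ R (b.coord i (L (b j))) • ofConstBasis (hNC := hNC) b i := by
      conv_lhs => rw [← b.sum_repr (L (b j))]
      refine (TensorProduct.tmul_sum _ _ _).trans (Finset.sum_congr rfl fun i _ => ?_)
      refine Eq.trans ?_ (congrArg _ (Module.Basis.baseChange_apply R b i)).symm
      change (1 : R) ⊗ₜ[ℂ] (b.repr (L (b j)) i • b i) =
        (algebraMap ℂ R (b.repr (L (b j)) i) • (1 : R) ⊗ₜ[ℂ] b i : R ⊗[ℂ] V)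
      rw [algebraMap_smul, tmul_smul]
    rw [h2, tmul_sum]
    refine Finset.sum_congr rfl fun i _ => ?_
    rw [tmul_smul, smul_tmul', algebraMap_smul]
  rw [Finset.sum_congr rfl fun j _ => h1 j, Finset.sum_comm, dualElem_apply]
  refine Finset.sum_congr rfl fun i _ => ?_
  rw [← sum_tmul]
  congr 1
  have h3 := b.sum_dual_apply_smul_coord (b.coord i ∘ₗ L)
  rw [LinearMap.comp_apply, LinearMap.dualMap_apply', ← h3, map_sum]
  simp only [map_smul, LinearMap.comp_apply]

theorem extendedConnection_dualElem {n : ℕ} (b : Module.Basis (Fin n) ℂ V)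
    (c : Module.Dual ℂ V →ₗ[ℂ] S) :
    extendedConnection δS (ofConst δ α N C hNC) (dualElem hNC b c) =
      dualElem hNC b (δS.toLinearMap ∘ₗ c + c ∘ₗ N.dualMap) := by
  rw [map_add, ← sum_tmul_map, dualElem_apply, dualElem_apply, map_sum, ← Finset.sum_add_distrib]
  refine Finset.sum_congr rfl fun j _ => ?_
  rw [extendedConnection_tmul]
  congr 2
  change constConn δ N (b.baseChange R j) = _
  rw [Module.Basis.baseChange_apply, constConn_tmul, Derivation.map_one_eq_zero, zero_tmul,
    zero_add]

theorem shift_dualElem (k : K) {n : ℕ} (b : Module.Basis (Fin n) ℂ V)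
    (c : Module.Dual ℂ V →ₗ[ℂ] S) :
    shift h k (ofConst δ α N C hNC) (dualElem hNC b c) =
      dualElem hNC b ((β k).toLinearMap ∘ₗ c ∘ₗ (C (π k)).dualMap) := by
  rw [← LinearMap.comp_assoc, ← sum_tmul_map, dualElem_apply, map_sum]
  refine Finset.sum_congr rfl fun j _ => ?_
  rw [shift_tmul]
  refine congrArg _ ?_
  change TensorProduct.map (α (π k)).toLinearMap (C (π k)) (b.baseChange R j) = _
  rw [Module.Basis.baseChange_apply, TensorProduct.map_tmul]
  simp

theorem dualElem_injective {n : ℕ} (b : Module.Basis (Fin n) ℂ V) :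
    Function.Injective (dualElem (δ := δ) (α := α) (S := S) hNC b) := by
  rw [injective_iff_map_eq_zero]
  intro c hc
  have h1 : ∑ j, c (b.coord j) • (ofConstBasis (hNC := hNC) (δ := δ) (α := α) b).baseChange S j
      = 0 := by
    rw [← hc, dualElem_apply]
    refine Finset.sum_congr rfl fun j _ => ?_
    rw [Module.Basis.baseChange_apply, smul_tmul', smul_eq_mul, mul_one]
  have h2 := Fintype.linearIndependent_iff.1
    ((ofConstBasis (hNC := hNC) (δ := δ) (α := α) b).baseChange S).linearIndependent _ h1
  refine LinearMap.ext fun l => ?_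
  rw [← b.sum_dual_apply_smul_coord l, map_sum]
  simp [h2]

/-- If `c v` are the coordinate functions of horizontal sections of `R ⊗ V` that transform
under `K` as the vectors `v` of a representation `V`, then `V` is the representation on all
horizontal sections. -/
theorem exists_equiv_ker_ofConst [HasTrivialConstants δS] [Module.Finite ℂ V]
    (hM : HasHorizontalBasis δS (ofConst δ α N C hNC)) (ρ : Representation ℂ K V)
    (c : V →ₗ[ℂ] Module.Dual ℂ V →ₗ[ℂ] S) (hc : Function.Injective c)
    (h1 : ∀ v l, δS (c v l) = -c v (l ∘ₗ N))
    (h2 : ∀ k v l, β k (c v (l ∘ₗ C (π k))) = c (ρ k v) l) :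
    ∃ e : LinearMap.ker (extendedConnection δS (ofConst δ α N C hNC)) ≃ₗ[ℂ] V,
      ∀ k x, e (shiftRep h (ofConst δ α N C hNC) k x) = ρ k (e x) := by
  let b := Module.finBasis ℂ V
  let L : V →ₗ[ℂ] LinearMap.ker (extendedConnection δS (ofConst δ α N C hNC)) :=
    (dualElem hNC b ∘ₗ c).codRestrict _ fun v => by
      rw [LinearMap.mem_ker, LinearMap.comp_apply, extendedConnection_dualElem]
      have : δS.toLinearMap ∘ₗ c v + c v ∘ₗ N.dualMap = 0 := by
        ext l
        exact (congrArg (· + c v (l ∘ₗ N)) (h1 v l)).trans (neg_add_cancel _)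
      rw [this, map_zero]
  have hL : Function.Injective L := fun v w hvw =>
    hc (dualElem_injective b (congrArg Subtype.val hvw))
  -- The horizontal elements have complex dimension equal to the `S`-rank of `S ⊗ (R ⊗ V)`, which is
  -- `dim V`. Hence the injective map `L` is bijective.
  have hrank : Module.finrank ℂ V =
      Module.finrank ℂ (LinearMap.ker (extendedConnection δS (ofConst δ α N C hNC))) := by
    obtain ⟨n, b', hb'⟩ := hM
    have : Nontrivial S := HasTrivialConstants.toNontrivial δS
    rw [Module.finrank_eq_card_basis (kerBasis b' hb'), ← Module.finrank_eq_card_basis b',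
      Module.finrank_eq_card_basis ((ofConstBasis (hNC := hNC) (δ := δ) (α := α) b).baseChange S),
      Fintype.card_fin]
  have := hM.finite_ker
  have hL' : Function.Surjective L :=
    surjective_of_injective_of_finrank_eq hrank hL
  let e := (LinearEquiv.ofBijective L ⟨hL, hL'⟩).symm
  refine ⟨e, fun k x => ?_⟩
  obtain ⟨v, rfl⟩ := e.symm.surjective x
  rw [LinearEquiv.apply_symm_apply, ← LinearEquiv.eq_symm_apply]
  refine Subtype.ext ?_
  change shift h k _ (dualElem hNC b (c v)) = dualElem hNC b (c (ρ k v))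
  rw [shift_dualElem]
  congr 1
  ext l
  exact h2 k v l

end EqDiffMod

end

/-! ### The category `B_q^τ` and representations of `ℤ × θℤ` -/

section

/-- The group `ℤ × θℤ`, which acts on the universal cover of `ℂ*` by translations. -/
abbrev CoverGroup (θ : ℝ) : Type := Multiplicative ℤ × ThetaZ θ

/-- The homomorphism `(m, g) ↦ m + g`. -/
def coverShift (θ : ℝ) : CoverGroup θ →* Multiplicative ℂ where
  toFun k := Multiplicative.ofAdd ((k.1.toAdd : ℂ) + ((k.2.toAdd : ℝ) : ℂ))
  map_one' := by simp
  map_mul' k l := by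
    rw [← ofAdd_add]
    congr 1
    simp
    ring

theorem expUnit_coverShift {θ : ℝ} (k : CoverGroup θ) :
    expUnit (coverShift θ k).toAdd = expTwoPiI θ k.2 := by
  change expUnit ((k.1.toAdd : ℂ) + ((k.2.toAdd : ℝ) : ℂ)) = _
  rw [(expUnit_eq_iff _ ((k.2.toAdd : ℝ) : ℂ)).2 ⟨k.1.toAdd, add_comm _ _⟩]
  rfl

/-- The action of `ℤ × θℤ` on functions on the universal cover. -/
def coverAction (θ : ℝ) (z : ℂˣ) : CoverGroup θ →* (Ent z ≃ₐ[ℂ] Ent z) :=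
  (Ent.translate z).comp (coverShift θ)

theorem coverAction_apply {θ : ℝ} {z : ℂˣ} (k : CoverGroup θ) (f : Ent z) (t : ℂ) :
    (coverAction θ z k f : ℂ → ℂ) t = (f : ℂ → ℂ) (t + (coverShift θ k).toAdd) := rfl

/-- Translation by an integer fixes functions pulled back from `ℂ*`, and translation by `nθ` lifts
the rotation by `qⁿ`. Translations commute with `d/dt`. -/
theorem extendsAction_coverAction (θ : ℝ) (τ : ℂ) (z : ℂˣ) :
    EqDiffMod.ExtendsAction (thetaAction θ) (Ent.derivation z τ)
      (MonoidHom.snd (Multiplicative ℤ) (ThetaZ θ)) (coverAction θ z) where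
  map_algebraMap k f := by
    ext t
    rw [coverAction_apply, Ent.algebraMap_apply, Ent.algebraMap_apply, expUnit_add,
      expUnit_coverShift]
    change _ = (f : ℂˣ → ℂ) (expTwoPiI θ k.2 * (z * expUnit t))
    rw [mul_comm (expTwoPiI θ k.2), mul_assoc]
  comm k f := by
    ext t
    rw [coverAction_apply, Ent.derivation_apply, Ent.derivation_apply]
    exact congrArg _ (deriv_comp_add_const (f : ℂ → ℂ) _ t)

/-- The kernel of the projection to `θℤ` is the deck group, so invariance under it contains
periodicity with period `1`. -/
theorem exists_algebraMap_of_coverAction {θ : ℝ} {z : ℂˣ} (f : Ent z)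
    (hf : ∀ k, MonoidHom.snd (Multiplicative ℤ) (ThetaZ θ) k = 1 → coverAction θ z k f = f) :
    ∃ g, algebraMap Hol (Ent z) g = f := by
  refine Ent.exists_algebraMap_of_periodic f fun t => ?_
  have h1 := congrFun (congrArg Subtype.val (hf (Multiplicative.ofAdd 1, 1) rfl)) t
  rw [coverAction_apply] at h1
  simpa [coverShift] using h1

theorem objBqTau.exists_basis {θ : ℝ} {τ : ℂ}
    {M : EqDiffMod (eulerDerivation τ) (thetaAction θ)} (hM : objBqTau θ τ M) :
    ∃ n, Nonempty (Module.Basis (Fin n) Hol M) :=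
  let ⟨_, n, e, _⟩ := hM
  ⟨n, ⟨e⟩⟩

theorem objBqTau.free {θ : ℝ} {τ : ℂ}
    {M : EqDiffMod (eulerDerivation τ) (thetaAction θ)} (hM : objBqTau θ τ M) :
    Module.Free Hol M :=
  let ⟨_, ⟨e⟩⟩ := hM.exists_basis
  .of_basis e

theorem objBqTau.hasHorizontalBasis_ent {θ : ℝ} {τ : ℂ} (hτ : τ ≠ 0) (z : ℂˣ)
    {M : EqDiffMod (eulerDerivation τ) (thetaAction θ)} (hM : objBqTau θ τ M) :
    EqDiffMod.HasHorizontalBasis (Ent.derivation z τ) M :=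
  let ⟨_, ⟨e⟩⟩ := hM.exists_basis
  Ent.hasHorizontalBasis hτ z M e

theorem objBqTau.hasHorizontalBasis_holGerm {θ : ℝ} {τ : ℂ} (hτ : τ ≠ 0) (z : ℂˣ)
    {M : EqDiffMod (eulerDerivation τ) (thetaAction θ)} (hM : objBqTau θ τ M) :
    EqDiffMod.HasHorizontalBasis (eulerDerivationGerm τ (z : ℂ)) M :=
  let ⟨_, ⟨e⟩⟩ := hM.exists_basis
  HolGerm.hasHorizontalBasis hτ z M e

theorem atMostSimplePole_const (a : ℂ) :
    AtMostSimplePole fun z => z⁻¹ * extZero (algebraMap ℂ Hol a : Hol) z := by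
  have h1 : (fun z : ℂ => z⁻¹ * extZero (algebraMap ℂ Hol a : Hol) z) =
      (id : ℂ → ℂ)⁻¹ * fun _ => a := by
    funext w
    rcases eq_or_ne w 0 with rfl | hw
    · simp
    · have := extZero_coe (algebraMap ℂ Hol a : Hol) (Units.mk0 w hw)
      rw [Units.val_mk0] at this
      rw [this]
      rfl
  have hid : MeromorphicAt (id : ℂ → ℂ) 0 := analyticAt_id.meromorphicAt
  rw [h1]
  refine ⟨hid.inv.mul (.const a 0), ?_⟩
  rw [meromorphicOrderAt_mul hid.inv (.const a 0), meromorphicOrderAt_inv, meromorphicOrderAt_id]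
  -- Only an inequality, since the order is infinite for `a = 0`.
  have h2 : 0 ≤ meromorphicOrderAt (fun _ : ℂ => a) 0 :=
    (analyticAt_const : AnalyticAt ℂ (fun _ : ℂ => a) 0).meromorphicOrderAt_nonneg
  simpa using add_le_add_right h2 (-1)

theorem objBqTau_ofConst {θ : ℝ} {τ : ℂ} {V : Type} [AddCommGroup V] [Module ℂ V]
    [Module.Finite ℂ V] {N : Module.End ℂ V} {C : Representation ℂ (ThetaZ θ) V}
    (hNC : ∀ g v, N (C g v) = C g (N v)) :
    objBqTau θ τ (EqDiffMod.ofConst (eulerDerivation τ) (thetaAction θ) N C hNC) := by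
  refine ⟨finitePresentation_of_basis (EqDiffMod.ofConstBasis (Module.finBasis ℂ V)), _,
    EqDiffMod.ofConstBasis (Module.finBasis ℂ V), fun i j => ?_⟩
  rw [EqDiffMod.conn_ofConstBasis]
  exact atMostSimplePole_const _

/-- The function `t ↦ l (E t v)` on the universal cover, for a one-parameter group `E`. -/
def Ent.coeff (z : ℂˣ) {V : Type} [AddCommGroup V] [Module ℂ V] (E : ℂ → Module.End ℂ V)
    (hE : ∀ (l : V →ₗ[ℂ] ℂ) v, Differentiable ℂ fun t => l (E t v)) :
    V →ₗ[ℂ] Module.Dual ℂ V →ₗ[ℂ] Ent z :=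
  LinearMap.mk₂ ℂ (fun v l => ⟨fun t => l (E t v), hE l v⟩)
    (fun v w l => by ext t; simp) (fun c v l => by ext t; simp)
    (fun v l l' => by ext t; simp) (fun c v l => by ext t; simp)

/-- The solutions are prescribed as `t ↦ E(t) v`, where `E(1) = T = ρ(1, 0)` and `E' = B E`.
Translation by `1` then multiplies by `T`, as monodromy should. Since the group is commutative, `B`
and `E` commute with all operators of the representation, so the connection `N` and the action `C`
defined from them are compatible. The action on solutions is `E(t) v ↦ C(g) E(t + m + g) v = E(t)
ρ(m, g) v`. -/
theorem exists_objBqTau_of_rep {θ : ℝ} {τ : ℂ} (hτ : τ ≠ 0) (z : ℂˣ) {V : Type} [AddCommGroup V]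
    [Module ℂ V] [Module.Finite ℂ V] (ρ : Representation ℂ (CoverGroup θ) V) :
    ∃ M, objBqTau θ τ M ∧
      ∃ e : LinearMap.ker (EqDiffMod.extendedConnection (Ent.derivation z τ) M) ≃ₗ[ℂ] V,
      ∀ k x, e (EqDiffMod.shiftRep (extendsAction_coverAction θ τ z) M k x) = ρ k (e x) := by
  have := Ent.hasTrivialConstants (z := z) hτ
  have hcomm : ∀ k l, Commute (ρ k) (ρ l) := fun k l => by
    rw [commute_iff_eq, ← map_mul, ← map_mul, mul_comm]
  obtain ⟨E, B, hE1, hB, hE, hderiv⟩ := exists_oneParameterGroup (ρ (Multiplicative.ofAdd 1, 1))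
    ((Group.isUnit _).map ρ)
  have hEint : ∀ m : Multiplicative ℤ, E (Multiplicative.ofAdd (m.toAdd : ℂ)) = ρ (m, 1) := by
    have h1 : E.comp (AddMonoidHom.toMultiplicative (Int.castAddHom ℂ)) =
        ρ.comp (MonoidHom.inl _ _) := MonoidHom.ext_mint (by simpa using hE1)
    exact fun m => DFunLike.congr_fun h1 m
  have hEE : ∀ s t, Commute (E s) (E t) := fun s t => by
    rw [commute_iff_eq, ← map_mul, ← map_mul, mul_comm]
  have hBE : ∀ t, Commute B (E t) := fun t => by
    have := hB (E t) (by rw [← hE1]; exact hEE _ _)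
    exact this.symm
  let c : ℂ := τ / (2 * Real.pi * Complex.I)
  -- The derivation is `c d/dt` and `c (E v)' = c B E v`, so `E v` is horizontal exactly for this
  -- `N`.
  let N : Module.End ℂ V := -(c • B)
  -- The factor `E(-g)` compensates the translation by `g` on the cover, which turns `E(t)` into
  -- `E(t + g)`.
  let C : Representation ℂ (ThetaZ θ) V :=
    { toFun := fun g => ρ (1, g) * E (Multiplicative.ofAdd (-((g.toAdd : ℝ) : ℂ)))
      map_one' := by
        have : ((1 : Multiplicative ℤ), (1 : ThetaZ θ)) = 1 := rfl
        simp [this]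
      map_mul' := fun g h => by
        have h1 : ((1 : Multiplicative ℤ), g * h) = (1, g) * (1, h) := by simp
        have h2 : Multiplicative.ofAdd (-(((g * h).toAdd : ℝ) : ℂ)) =
            Multiplicative.ofAdd (-((g.toAdd : ℝ) : ℂ)) *
              Multiplicative.ofAdd (-((h.toAdd : ℝ) : ℂ)) := by
          rw [← ofAdd_add]
          congr 1
          simp
          ring
        rw [h1, h2, map_mul, map_mul]
        exact (hE _ (hcomm _ _) _).mul_mul_mul_comm _ _ }
  have hCN : ∀ g v, N (C g v) = C g (N v) := fun g v => by
    have h1 : Commute B (C g) := ((hB _ (hcomm _ _)).symm.mul_right (hBE _))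
    exact LinearMap.congr_fun ((h1.smul_left c).neg_left.eq) v
  have hobj := objBqTau_ofConst (τ := τ) hCN
  refine ⟨_, hobj, EqDiffMod.exists_equiv_ker_ofConst _ (hobj.hasHorizontalBasis_ent hτ z) ρ
    (Ent.coeff z (fun t => E (Multiplicative.ofAdd t))
      fun l v t => (hderiv l v t).differentiableAt) ?_ ?_ ?_⟩
  · rw [injective_iff_map_eq_zero]
    intro v hv
    rw [← Module.forall_dual_apply_eq_zero_iff ℂ]
    intro l
    -- At `t = 0` the coordinate function is `l(v)`, because `E(0) = 1`.
    have h1 := congrFun (congrArg Subtype.val (LinearMap.congr_fun hv l)) 0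
    change l (E (Multiplicative.ofAdd 0) v) = 0 at h1
    simpa using h1
  · intro v l
    ext t
    rw [Ent.derivation_apply]
    change c * deriv (fun t => l (E (Multiplicative.ofAdd t) v)) t =
      -(l (-(c • B (E (Multiplicative.ofAdd t) v))))
    rw [(hderiv l v t).deriv, map_neg, neg_neg, map_smul, smul_eq_mul]
  · rintro ⟨m, g⟩ v l
    ext t
    rw [coverAction_apply]
    change l ((C g * E (Multiplicative.ofAdd (t + (coverShift θ (m, g)).toAdd))) v) =
      l ((E (Multiplicative.ofAdd t) * ρ (m, g)) v)
    have h1 : Multiplicative.ofAdd (-((g.toAdd : ℝ) : ℂ)) *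
        Multiplicative.ofAdd (t + (coverShift θ (m, g)).toAdd) =
          Multiplicative.ofAdd (m.toAdd : ℂ) * Multiplicative.ofAdd t := by
      rw [← ofAdd_add, ← ofAdd_add]
      congr 1
      simp [coverShift]
      ring
    have h2 : ρ (m, g) = ρ (1, g) * ρ (m, 1) := by
      rw [← map_mul]
      simp
    have h3 : C g * E (Multiplicative.ofAdd (t + (coverShift θ (m, g)).toAdd)) =
        E (Multiplicative.ofAdd t) * ρ (m, g) := by
      change ρ (1, g) * E _ * E _ = _
      rw [mul_assoc, ← map_mul, h1, map_mul, hEint, ← mul_assoc, ← h2]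
      exact (hE _ (hcomm _ _) _).eq
    rw [h3]

/-- The category `B_q^τ` is equivalent to the category of finite dimensional representations of
`ℤ × θℤ`. -/
theorem tensorEquivalentOver_coverGroup {θ : ℝ} {τ : ℂ} (hτ : τ ≠ 0) (z : ℂˣ) :
    let _ := HolGerm.hasTrivialConstants hτ z
    let _ : (fibreFunctor θ τ z).Braided := EqDiffMod.horizontalBraided (eulerDerivation τ)
      (thetaAction θ) (eulerDerivationGerm τ (z : ℂ)) (objBqTau θ τ)
      fun _ hM => hM.hasHorizontalBasis_holGerm hτ z
    TensorEquivalentOver (fibreFunctor θ τ z) (forgetRep (CoverGroup θ)) := by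
  have := HolGerm.hasTrivialConstants hτ z
  have := Ent.hasTrivialConstants (z := z) hτ
  let h := extendsAction_coverAction θ τ z
  let F := EqDiffMod.toFDRep h (objBqTau θ τ) fun _ hM => hM.hasHorizontalBasis_ent hτ z
  have : F.Faithful := EqDiffMod.toFDRep_faithful _ _ _ (fun _ hM => hM.free)
    Ent.algebraMap_injective
  have : F.Full := EqDiffMod.toFDRep_full _ _ _ (fun _ hM => hM.free) Prod.snd_surjective
    exists_algebraMap_of_coverAction Ent.algebraMap_injective
  have : F.EssSurj := EqDiffMod.toFDRep_essSurj _ _ _ fun V => exists_objBqTau_of_rep hτ z V.ρ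
  have : F.IsEquivalence := {}
  exact EqDiffMod.tensorEquivalentOver_forgetRep h _ _ (Ent.germ z) (Ent.germ_derivation τ)
    fun _ hM => hM.hasHorizontalBasis_holGerm hτ z

end

/-! ### The groups `ℤ + θℤ`, `ℤ × θℤ` and `ℤ²` -/

section

variable {θ : ℝ}

/-- The isomorphism of `θℤ` with `ℤ`. -/
def zmultiplesEquivInt (hθ : θ ≠ 0) : AddSubgroup.zmultiples θ ≃+ ℤ :=
  (AddEquiv.ofBijective (zmultiplesHom ℝ θ).rangeRestrict
    ⟨by
      rw [AddMonoidHom.rangeRestrict_injective_iff]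
      intro m n h
      simpa [hθ] using h, (zmultiplesHom ℝ θ).rangeRestrict_surjective⟩).symm

/-- The isomorphism of `ℤ + θℤ` with `ℤ²`, for irrational `θ`. -/
def zPlusThetaZEquiv (hθ : Irrational θ) : ZPlusThetaZ θ ≃+ ℤ × ℤ :=
  let f : ℤ × ℤ →+ ZPlusThetaZ θ :=
    ((zmultiplesHom ℝ (1 : ℝ)).coprod (zmultiplesHom ℝ θ)).codRestrict _ (by
      rintro ⟨m, n⟩
      exact AddSubgroup.add_mem_sup ⟨m, rfl⟩ ⟨n, rfl⟩)
  (AddEquiv.ofBijective f (by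
    constructor
    · rw [injective_iff_map_eq_zero]
      rintro ⟨m, n⟩ h
      have h1 : (m : ℝ) + n * θ = 0 := by
        have := congrArg Subtype.val h
        simpa [f] using this
      -- Irrationality of `θ`: for `n ≠ 0` the number `m + nθ` is irrational, hence nonzero.
      have hn : n = 0 := by
        by_contra hn
        have := ((hθ.intCast_mul hn).intCast_add m)
        exact this.ne_zero h1
      subst hn
      simpa using h1
    · rintro ⟨x, hx⟩
      obtain ⟨_, ⟨m, rfl⟩, _, ⟨n, rfl⟩, rfl⟩ := AddSubgroup.mem_sup.1 hx
      exact ⟨(m, n), rfl⟩)).symm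

/-- The isomorphism of `ℤ × θℤ` with `ℤ²`. -/
def coverGroupEquiv (hθ : θ ≠ 0) : CoverGroup θ ≃* Multiplicative (ℤ × ℤ) :=
  ((MulEquiv.refl (Multiplicative ℤ)).prodCongr
    (AddEquiv.toMultiplicative (zmultiplesEquivInt hθ))).trans
      (MulEquiv.prodMultiplicative ℤ ℤ).symm

end

section

/-! ### Separating families of functionals on tensor products -/

/-- A family of linear functionals that separates points. -/
def IsSeparating {ι B : Type} [AddCommGroup B] [Module ℂ B] (φ : ι → B →ₗ[ℂ] ℂ) : Prop :=
  ∀ b, (∀ i, φ i b = 0) → b = 0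

section Separating

variable {ι κ B B' V : Type} [AddCommGroup B] [Module ℂ B] [AddCommGroup B'] [Module ℂ B']
  [AddCommGroup V] [Module ℂ V]

theorem IsSeparating.ext {φ : ι → B →ₗ[ℂ] ℂ} (hφ : IsSeparating φ) {b b' : B}
    (h : ∀ i, φ i b = φ i b') : b = b' :=
  sub_eq_zero.1 (hφ _ fun i => by rw [map_sub, h, sub_self])

/-- The map `1 ⊗ φ : V ⊗ B → V`. -/
def evalRight (V : Type) [AddCommGroup V] [Module ℂ V] (φ : B →ₗ[ℂ] ℂ) : V ⊗[ℂ] B →ₗ[ℂ] V :=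
  (TensorProduct.rid ℂ V).toLinearMap ∘ₗ φ.lTensor V

@[simp]
theorem evalRight_tmul (φ : B →ₗ[ℂ] ℂ) (v : V) (b : B) : evalRight V φ (v ⊗ₜ b) = φ b • v := rfl

/-- The functional `φ ⊗ ψ` on `B ⊗ B'`. -/
def tensorFunctional (φ : B →ₗ[ℂ] ℂ) (ψ : B' →ₗ[ℂ] ℂ) : B ⊗[ℂ] B' →ₗ[ℂ] ℂ :=
  LinearMap.mul' ℂ ℂ ∘ₗ TensorProduct.map φ ψ

@[simp]
theorem tensorFunctional_tmul (φ : B →ₗ[ℂ] ℂ) (ψ : B' →ₗ[ℂ] ℂ) (b : B) (b' : B') :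
    tensorFunctional φ ψ (b ⊗ₜ b') = φ b * ψ b' := rfl

/-- With a basis of `V`, an element of `V ⊗ B` is a finite family of elements of `B`, and `1 ⊗ φ`
applies `φ` to each of them. -/
theorem IsSeparating.ext_evalRight {φ : ι → B →ₗ[ℂ] ℂ} (hφ : IsSeparating φ) {x y : V ⊗[ℂ] B}
    (h : ∀ i, evalRight V (φ i) x = evalRight V (φ i) y) : x = y := by
  let b := Module.Free.chooseBasis ℂ V
  let e := TensorProduct.equivFinsuppOfBasisLeft (N := B) b
  have key : ∀ (i) (x : V ⊗[ℂ] B) j, φ i (e x j) = b.repr (evalRight V (φ i) x) j := by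
    intro i x j
    induction x with
    | zero => simp
    | add x y hx hy => simp only [map_add, Finsupp.add_apply, hx, hy]
    | tmul v c => simp [e, mul_comm]
  refine e.injective (Finsupp.ext fun j => hφ.ext fun i => ?_)
  rw [key, key, h]

/-- Separate one factor at a time: the maps `1 ⊗ ψ` separate points of `B ⊗ B'` with values in `B`,
which the `φ` separate. -/
theorem IsSeparating.tensorFunctional {φ : ι → B →ₗ[ℂ] ℂ} (hφ : IsSeparating φ)
    {ψ : κ → B' →ₗ[ℂ] ℂ} (hψ : IsSeparating ψ) :
    IsSeparating fun i : ι × κ => tensorFunctional (φ i.1) (ψ i.2) := by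
  intro x hx
  refine hψ.ext_evalRight fun k => ?_
  rw [map_zero]
  refine hφ _ fun i => ?_
  rw [← hx (i, k)]
  clear hx
  induction x with
  | zero => simp
  | add x y hx hy => simp only [map_add, hx, hy]
  | tmul b b' => simp [mul_comm]

end Separating

theorem tensorFunctional_eq_productMap {B B' : Type} [CommRing B] [Algebra ℂ B] [CommRing B']
    [Algebra ℂ B'] (φ : B →ₐ[ℂ] ℂ) (ψ : B' →ₐ[ℂ] ℂ) :
    tensorFunctional φ.toLinearMap ψ.toLinearMap =
      (Algebra.TensorProduct.productMap φ ψ).toLinearMap :=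
  TensorProduct.ext' fun _ _ => by simp

theorem IsSeparating.productMap {ι κ B B' : Type} [CommRing B] [Algebra ℂ B] [CommRing B']
    [Algebra ℂ B'] {φ : ι → B →ₐ[ℂ] ℂ} (hφ : IsSeparating fun i => (φ i).toLinearMap)
    {ψ : κ → B' →ₐ[ℂ] ℂ} (hψ : IsSeparating fun i => (ψ i).toLinearMap) :
    IsSeparating fun i : ι × κ =>
      (Algebra.TensorProduct.productMap (φ i.1) (ψ i.2)).toLinearMap := by
  simpa only [tensorFunctional_eq_productMap] using hφ.tensorFunctional hψ

/-! ### Hopf algebras of functions on a group -/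

section FunctionHopfAlgebra

variable {H A : Type} [CommRing A] [Algebra ℂ A] {ev : H → A →ₐ[ℂ] ℂ}

/-- Elements of `A ⊗ A` are determined by their values as functions on `H × H`. The Hopf algebra
axioms thereby reduce to the group axioms, evaluated pointwise. -/
theorem IsSeparating.productMap_ext (hev : IsSeparating fun x => (ev x).toLinearMap)
    {c d : A ⊗[ℂ] A}
    (h : ∀ x y, Algebra.TensorProduct.productMap (ev x) (ev y) c =
      Algebra.TensorProduct.productMap (ev x) (ev y) d) : c = d :=
  (hev.productMap hev).ext fun i => h i.1 i.2

theorem IsSeparating.productMap_ext₂ (hev : IsSeparating fun x => (ev x).toLinearMap)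
    {c d : A ⊗[ℂ] (A ⊗[ℂ] A)}
    (h : ∀ x y z, Algebra.TensorProduct.productMap (ev x)
        (Algebra.TensorProduct.productMap (ev y) (ev z)) c =
      Algebra.TensorProduct.productMap (ev x)
        (Algebra.TensorProduct.productMap (ev y) (ev z)) d) : c = d :=
  (hev.productMap (ψ := fun i : H × H => Algebra.TensorProduct.productMap (ev i.1) (ev i.2))
    (hev.productMap hev)).ext fun i => h i.1 i.2.1 i.2.2

variable [Group H] (hev : IsSeparating fun x => (ev x).toLinearMap)
  (hcomul : ∀ a, ∃ c : A ⊗[ℂ] A, ∀ x y,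
    Algebra.TensorProduct.productMap (ev x) (ev y) c = ev (x * y) a)

/-- The comultiplication dual to the multiplication of `H`. -/
def comulOfEval : A →ₐ[ℂ] A ⊗[ℂ] A where
  toFun a := (hcomul a).choose
  map_one' := hev.productMap_ext fun x y => by rw [(hcomul _).choose_spec]; simp
  map_mul' f g := hev.productMap_ext fun x y => by
    rw [map_mul, (hcomul _).choose_spec, (hcomul _).choose_spec, (hcomul _).choose_spec, map_mul]
  map_zero' := hev.productMap_ext fun x y => by rw [(hcomul _).choose_spec]; simp
  map_add' f g := hev.productMap_ext fun x y => by
    rw [map_add, (hcomul _).choose_spec, (hcomul _).choose_spec, (hcomul _).choose_spec, map_add]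
  commutes' c := hev.productMap_ext fun x y => by
    rw [(hcomul _).choose_spec, AlgHom.commutes, AlgHom.commutes]

theorem productMap_comulOfEval (f : A) (x y : H) :
    Algebra.TensorProduct.productMap (ev x) (ev y) (comulOfEval hev hcomul f) = ev (x * y) f :=
  (hcomul f).choose_spec x y

/-- Together with its mirror image, this reduces coassociativity to `(xy)z = x(yz)`. -/
theorem productMap_assoc_map_comulOfEval (x y z : H) (c : A ⊗[ℂ] A) :
    Algebra.TensorProduct.productMap (ev x) (Algebra.TensorProduct.productMap (ev y) (ev z))
      (Algebra.TensorProduct.assoc ℂ ℂ ℂ A A A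
        (Algebra.TensorProduct.map (comulOfEval hev hcomul) (AlgHom.id ℂ A) c)) =
      Algebra.TensorProduct.productMap (ev (x * y)) (ev z) c := by
  induction c with
  | zero => simp
  | add c d hc hd => simp only [map_add, hc, hd]
  | tmul a b =>
    rw [Algebra.TensorProduct.map_tmul, Algebra.TensorProduct.productMap_apply_tmul,
      ← productMap_comulOfEval hev hcomul]
    induction comulOfEval hev hcomul a with
    | zero => simp
    | add c d hc hd => simp only [map_add, add_tmul, hc, hd, add_mul]
    | tmul a a' => simp [mul_assoc]

theorem productMap_map_comulOfEval (x y z : H) (c : A ⊗[ℂ] A) :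
    Algebra.TensorProduct.productMap (ev x) (Algebra.TensorProduct.productMap (ev y) (ev z))
      (Algebra.TensorProduct.map (AlgHom.id ℂ A) (comulOfEval hev hcomul) c) =
      Algebra.TensorProduct.productMap (ev x) (ev (y * z)) c := by
  induction c with
  | zero => simp
  | add c d hc hd => simp only [map_add, hc, hd]
  | tmul a b =>
    rw [Algebra.TensorProduct.map_tmul, Algebra.TensorProduct.productMap_apply_tmul,
      Algebra.TensorProduct.productMap_apply_tmul, productMap_comulOfEval]
    rfl

/-- The bialgebra structure on an algebra of functions on `H` dual to the multiplication of `H`. -/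
abbrev bialgebraOfEval : Bialgebra ℂ A :=
  Bialgebra.ofAlgHom (comulOfEval hev hcomul) (ev 1)
    (by
      refine AlgHom.ext fun f => hev.productMap_ext₂ fun x y z => ?_
      refine (productMap_assoc_map_comulOfEval hev hcomul x y z _).trans
        (Eq.trans ?_ (productMap_map_comulOfEval hev hcomul x y z _).symm)
      refine (productMap_comulOfEval hev hcomul f _ _).trans
        ((productMap_comulOfEval hev hcomul f _ _).trans ?_).symm
      rw [mul_assoc])
    (by
      refine AlgHom.ext fun f => (Algebra.TensorProduct.lid ℂ A).injective (hev.ext fun x => ?_)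
      have h1 : ∀ c : A ⊗[ℂ] A, ev x (Algebra.TensorProduct.lid ℂ A
          (Algebra.TensorProduct.map (ev 1) (AlgHom.id ℂ A) c)) =
          Algebra.TensorProduct.productMap (ev 1) (ev x) c := by
        intro c
        induction c with
        | zero => simp
        | add c d hc hd => simp only [map_add, hc, hd]
        | tmul a b => simp
      refine (h1 _).trans ((productMap_comulOfEval hev hcomul f _ _).trans ?_)
      simp)
    (by
      refine AlgHom.ext fun f => (Algebra.TensorProduct.rid ℂ ℂ A).injective
        (hev.ext fun x => ?_)
      have h1 : ∀ c : A ⊗[ℂ] A, ev x (Algebra.TensorProduct.rid ℂ ℂ A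
          (Algebra.TensorProduct.map (AlgHom.id ℂ A) (ev 1) c)) =
          Algebra.TensorProduct.productMap (ev x) (ev 1) c := by
        intro c
        induction c with
        | zero => simp
        | add c d hc hd => simp only [map_add, hc, hd]
        | tmul a b => simp [mul_comm]
      refine (h1 _).trans ((productMap_comulOfEval hev hcomul f _ _).trans ?_)
      simp)

variable (antipode : A →ₗ[ℂ] A) (hantipode : ∀ x a, ev x (antipode a) = ev x⁻¹ a)

/-- The Hopf algebra structure on an algebra of functions on `H` dual to the group structure
of `H`. -/
abbrev hopfAlgebraOfEval : HopfAlgebra ℂ A :=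
  { bialgebraOfEval hev hcomul with
    antipode := antipode
    mul_antipode_rTensor_comul := by
      refine LinearMap.ext fun f => hev.ext fun x => ?_
      have h1 : ∀ c : A ⊗[ℂ] A, ev x (LinearMap.mul' ℂ A (antipode.rTensor A c)) =
          Algebra.TensorProduct.productMap (ev x⁻¹) (ev x) c := by
        intro c
        induction c with
        | zero => simp
        | add c d hc hd => simp only [map_add, hc, hd]
        | tmul a b => simp [hantipode]
      refine (h1 _).trans ((productMap_comulOfEval hev hcomul f _ _).trans ?_)
      rw [inv_mul_cancel]
      exact ((ev x).commutes _).symm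
    mul_antipode_lTensor_comul := by
      refine LinearMap.ext fun f => hev.ext fun x => ?_
      have h1 : ∀ c : A ⊗[ℂ] A, ev x (LinearMap.mul' ℂ A (antipode.lTensor A c)) =
          Algebra.TensorProduct.productMap (ev x) (ev x⁻¹) c := by
        intro c
        induction c with
        | zero => simp
        | add c d hc hd => simp only [map_add, hc, hd]
        | tmul a b => simp [hantipode]
      refine (h1 _).trans ((productMap_comulOfEval hev hcomul f _ _).trans ?_)
      rw [mul_inv_cancel]
      exact ((ev x).commutes _).symm }

theorem exists_isAlgebraicHull_of_eval {H A : Type} [CommRing A] [Algebra ℂ A]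
    {ev : H → A →ₐ[ℂ] ℂ} [Group H] (hev : IsSeparating fun x => (ev x).toLinearMap)
    (hcomul : ∀ a, ∃ c : A ⊗[ℂ] A, ∀ x y,
      Algebra.TensorProduct.productMap (ev x) (ev y) c = ev (x * y) a)
    (antipode : A →ₗ[ℂ] A) (hantipode : ∀ x a, ev x (antipode a) = ev x⁻¹ a)
    (e : A →ₐ[ℂ] (H → ℂ)) (he : ∀ x a, e a x = ev x a)
    (hrange : ∀ f : H → ℂ, f ∈ Set.range e ↔ IsRepresentative f) :
    ∃ (B : Type) (_ : CommRing B) (_ : HopfAlgebra ℂ B) (e : B →ₐ[ℂ] (H → ℂ)),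
      IsAlgebraicHull H B e := by
  let h := hopfAlgebraOfEval hev hcomul antipode hantipode
  refine ⟨A, ‹CommRing A›, h, e, ?_, hrange, fun a => (he 1 a).symm, fun a x y => ?_⟩
  · exact fun a b hab => hev.ext fun x => by
      rw [AlgHom.toLinearMap_apply, AlgHom.toLinearMap_apply, ← he, ← he, hab]
  · have h1 : ∀ x, LinearMap.proj x ∘ₗ e.toLinearMap = (ev x).toLinearMap :=
      fun x => LinearMap.ext (he x)
    rw [he, ← productMap_comulOfEval hev hcomul, ← AlgHom.toLinearMap_apply,
      ← tensorFunctional_eq_productMap, ← h1, ← h1]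
    rfl

end FunctionHopfAlgebra

/-! ### Representative functions -/

variable {H : Type} [Group H]

/-- All right translates of `f` lie in the span of the finitely many `u i`. -/
theorem isRepresentative_of_eq_sum {ι : Type} [Fintype ι] {f : H → ℂ} (u w : ι → H → ℂ)
    (h : ∀ x y, f (x * y) = ∑ i, u i x * w i y) : IsRepresentative f := by
  have hle : Submodule.span ℂ (Set.range fun h : H => fun x : H => f (x * h)) ≤
      Submodule.span ℂ (Set.range u) := by
    rw [Submodule.span_le]
    rintro _ ⟨y, rfl⟩
    have : (fun x => f (x * y)) = ∑ i, w i y • u i := by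
      funext x
      simp [h, mul_comm]
    change (fun x => f (x * y)) ∈ _
    rw [this]
    exact Submodule.sum_mem _ fun i _ => Submodule.smul_mem _ _ (Submodule.subset_span ⟨i, rfl⟩)
  have : Module.Finite ℂ (Submodule.span ℂ (Set.range u)) :=
    Module.Finite.span_of_finite ℂ (Set.finite_range u)
  exact Submodule.finiteDimensional_of_le hle

/-- Matrix coefficients of finite dimensional representations are representative. -/
theorem isRepresentative_coeff {V : Type} [AddCommGroup V] [Module ℂ V] [Module.Finite ℂ V]
    (ρ : Representation ℂ H V) (l : V →ₗ[ℂ] ℂ) (v : V) :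
    IsRepresentative fun x => l (ρ x v) := by
  let b := Module.finBasis ℂ V
  refine isRepresentative_of_eq_sum (fun i x => l (ρ x (b i))) (fun i y => b.repr (ρ y v) i)
    fun x y => ?_
  rw [map_mul, Module.End.mul_apply]
  conv_lhs => rw [← b.sum_repr (ρ y v), map_sum, map_sum]
  simp [mul_comm]

/-- The representation by right translations on the span of the right translates of `f`. -/
def translateRep (f : H → ℂ) : Representation ℂ H
    (Submodule.span ℂ (Set.range fun h : H => fun x : H => f (x * h))) where
  toFun h := (LinearMap.funLeft ℂ ℂ (· * h)).restrict fun g hg => by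
    have hle : Submodule.span ℂ (Set.range fun h : H => fun x : H => f (x * h)) ≤
        (Submodule.span ℂ (Set.range fun h : H => fun x : H => f (x * h))).comap
          (LinearMap.funLeft ℂ ℂ (· * h)) := by
      rw [Submodule.span_le]
      rintro _ ⟨k, rfl⟩
      refine Submodule.subset_span ⟨h * k, ?_⟩
      funext x
      simp [LinearMap.funLeft_apply, mul_assoc]
    exact hle hg
  map_one' := by
    ext f x
    simp [LinearMap.funLeft_apply]
  map_mul' h k := by
    ext f x
    simp [LinearMap.funLeft_apply, mul_assoc]

/-- A representative function is a matrix coefficient. -/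
theorem IsRepresentative.exists_rep {f : H → ℂ} (hf : IsRepresentative f) :
    ∃ (V : Type) (_ : AddCommGroup V) (_ : Module ℂ V) (_ : Module.Finite ℂ V)
      (ρ : Representation ℂ H V) (l : V →ₗ[ℂ] ℂ) (v : V), f = fun x => l (ρ x v) := by
  -- `f(x)` is the value at `1` of the translate of `f` by `x`; so `f` is the vector and evaluation
  -- at `1` the functional.
  refine ⟨_, _, _, hf, translateRep f, LinearMap.proj 1 ∘ₗ Submodule.subtype _,
    ⟨f, Submodule.subset_span ⟨1, by simp⟩⟩, ?_⟩
  funext x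
  simp [translateRep, LinearMap.funLeft_apply]

/-- The decomposition of `f(xy)` comes from inserting a basis between `ρ x` and `ρ y`. That its
factors are again matrix coefficients, hence representative, is what puts the comultiplication into
`A ⊗ A`. -/
theorem isRepresentative_iff {f : H → ℂ} : IsRepresentative f ↔
    ∃ (n : ℕ) (u w : Fin n → H → ℂ), (∀ i, IsRepresentative (u i)) ∧
      (∀ i, IsRepresentative (w i)) ∧ ∀ x y, f (x * y) = ∑ i, u i x * w i y := by
  constructor
  · intro hf
    obtain ⟨V, _, _, _, ρ, l, v, rfl⟩ := hf.exists_rep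
    let b := Module.finBasis ℂ V
    refine ⟨_, fun i x => l (ρ x (b i)), fun i y => b.coord i (ρ y v),
      fun i => isRepresentative_coeff ρ _ _, fun i => isRepresentative_coeff ρ _ _, fun x y => ?_⟩
    change l (ρ (x * y) v) = ∑ i, l (ρ x (b i)) * b.coord i (ρ y v)
    rw [map_mul, Module.End.mul_apply]
    conv_lhs => rw [← b.sum_repr (ρ y v), map_sum, map_sum]
    simp [mul_comm]
  · rintro ⟨n, u, w, -, -, h⟩
    exact isRepresentative_of_eq_sum u w h

variable (H) in
/-- The algebra of representative functions. -/
def repFun : Subalgebra ℂ (H → ℂ) where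
  carrier := {f | IsRepresentative f}
  mul_mem' {f g} hf hg := by
    obtain ⟨m, u, w, -, -, h⟩ := isRepresentative_iff.1 hf
    obtain ⟨n, u', w', -, -, h'⟩ := isRepresentative_iff.1 hg
    refine isRepresentative_of_eq_sum (ι := Fin m × Fin n) (fun i x => u i.1 x * u' i.2 x)
      (fun i x => w i.1 x * w' i.2 x) fun x y => ?_
    rw [Pi.mul_apply, h, h', Finset.sum_mul_sum, Fintype.sum_prod_type]
    simp only [mul_mul_mul_comm]
  add_mem' {f g} hf hg := by
    obtain ⟨m, u, w, -, -, h⟩ := isRepresentative_iff.1 hf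
    obtain ⟨n, u', w', -, -, h'⟩ := isRepresentative_iff.1 hg
    refine isRepresentative_of_eq_sum (ι := Fin m ⊕ Fin n) (Sum.elim u u') (Sum.elim w w')
      fun x y => ?_
    rw [Pi.add_apply, h, h', Fintype.sum_sum_type]
    rfl
  algebraMap_mem' c := isRepresentative_of_eq_sum (ι := Unit) (fun _ _ => c) (fun _ _ => 1)
    fun x y => by simp

theorem IsRepresentative.comp_inv {f : H → ℂ} (hf : IsRepresentative f) :
    IsRepresentative fun x => f x⁻¹ := by
  obtain ⟨m, u, w, -, -, h⟩ := isRepresentative_iff.1 hf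
  exact isRepresentative_of_eq_sum (fun i x => w i x⁻¹) (fun i x => u i x⁻¹) fun x y => by
    rw [mul_inv_rev, h]
    simp only [mul_comm]

namespace repFun

/-- Evaluation of representative functions at a point. -/
def eval (x : H) : repFun H →ₐ[ℂ] ℂ := (Pi.evalAlgHom ℂ (fun _ : H => ℂ) x).comp (repFun H).val

theorem eval_apply (x : H) (f : repFun H) : eval x f = (f : H → ℂ) x := rfl

theorem isSeparating_eval : IsSeparating fun x : H => (eval x).toLinearMap := fun _ hf =>
  Subtype.ext (funext hf)

theorem exists_comul (f : repFun H) : ∃ c : repFun H ⊗[ℂ] repFun H, ∀ x y,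
    Algebra.TensorProduct.productMap (eval x) (eval y) c = eval (x * y) f := by
  obtain ⟨n, u, w, hu, hw, h⟩ := isRepresentative_iff.1 f.2
  refine ⟨∑ i, (⟨u i, hu i⟩ : repFun H) ⊗ₜ (⟨w i, hw i⟩ : repFun H), fun x y => ?_⟩
  rw [map_sum, eval_apply, h]
  rfl

/-- The map dual to the inversion of `H`. -/
def antipodeMap : repFun H →ₗ[ℂ] repFun H where
  toFun f := ⟨fun x => (f : H → ℂ) x⁻¹, IsRepresentative.comp_inv f.2⟩
  map_add' _ _ := rfl
  map_smul' _ _ := rfl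

end repFun

variable (H) in
/-- The algebraic hull of a group exists. -/
theorem exists_isAlgebraicHull : ∃ (A : Type) (_ : CommRing A) (_ : HopfAlgebra ℂ A)
    (ev : A →ₐ[ℂ] (H → ℂ)), IsAlgebraicHull H A ev :=
  exists_isAlgebraicHull_of_eval repFun.isSeparating_eval
    repFun.exists_comul repFun.antipodeMap (fun _ _ => rfl) (repFun H).val (fun _ _ => rfl)
    fun f => ⟨fun ⟨g, hg⟩ => hg ▸ g.2, fun hf => ⟨⟨f, hf⟩, rfl⟩⟩

end

/-! ### Representations of the algebraic hull -/

section

instance (A : Type) [CommRing A] [HopfAlgebra ℂ A] :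
    (FdComod.forgetComod A).ReflectsIsomorphisms where
  reflects {V W} f hf := by
    have h1 : Function.Bijective (FdComod.Hom.lin f) :=
      (ConcreteCategory.isIso_iff_bijective ((FdComod.forgetComod A).map f)).1 hf
    let e := FdComod.isoMk (LinearEquiv.ofBijective (FdComod.Hom.lin f) h1) f.map_coact
    exact (inferInstance : IsIso e.hom)

/-- The forgetful functor from comodules to vector spaces is a symmetric tensor functor. -/
abbrev forgetComodBraided (A : Type) [CommRing A] [HopfAlgebra ℂ A] :
    (FdComod.forgetComod A).Braided where
  braided V W := by ext1; exact TensorProduct.ext rfl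

namespace IsAlgebraicHull

section Act

variable {H A : Type} [CommRing A] [HopfAlgebra ℂ A]

/-- Evaluation at a point, as a linear map. -/
def evalAt (ev : A →ₐ[ℂ] (H → ℂ)) (x : H) : A →ₗ[ℂ] ℂ :=
  LinearMap.proj x ∘ₗ ev.toLinearMap

/-- The map `1 ⊗ ev_x : V ⊗ A → V`. -/
def act (ev : A →ₐ[ℂ] (H → ℂ)) {V : Type} [AddCommGroup V] [Module ℂ V] (x : H) :
    V ⊗[ℂ] A →ₗ[ℂ] V :=
  evalRight V (evalAt ev x)

variable {ev : A →ₐ[ℂ] (H → ℂ)} {V W : Type} [AddCommGroup V] [Module ℂ V] [AddCommGroup W]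
  [Module ℂ W]

@[simp]
theorem act_tmul (x : H) (v : V) (a : A) : act ev x (v ⊗ₜ[ℂ] a) = ev a x • v := rfl

theorem act_rTensor (f : V →ₗ[ℂ] W) (x : H) (t : V ⊗[ℂ] A) :
    act ev x (f.rTensor A t) = f (act ev x t) := by
  induction t with
  | zero => simp
  | add s t hs ht => simp only [map_add, hs, ht]
  | tmul v a => simp

theorem act_mulTensor (x : H) (s : V ⊗[ℂ] A) (t : W ⊗[ℂ] A) :
    act ev x (mulTensor A V W (s ⊗ₜ t)) = act ev x s ⊗ₜ act ev x t := by
  induction s with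
  | zero => simp
  | add s s' hs hs' => simp only [map_add, add_tmul, hs, hs']
  | tmul v a =>
    induction t with
    | zero => simp
    | add t t' ht ht' => simp only [map_add, tmul_add, ht, ht']
    | tmul w b =>
      rw [mulTensor_tmul, act_tmul, act_tmul, act_tmul, map_mul, Pi.mul_apply, smul_tmul_smul]

theorem evalRight_assoc (x y : H) (t : (V ⊗[ℂ] A) ⊗[ℂ] A) :
    evalRight V (tensorFunctional (evalAt ev x) (evalAt ev y)) (TensorProduct.assoc ℂ V A A t) =
      act ev x (act ev y t) := by
  induction t with
  | zero => simp
  | add s t hs ht => simp only [map_add, hs, ht]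
  | tmul s b =>
    induction s with
    | zero => simp
    | add s t hs ht => simp only [map_add, add_tmul, hs, ht]
    | tmul v a =>
      rw [TensorProduct.assoc_tmul, evalRight_tmul, tensorFunctional_tmul, act_tmul, map_smul,
        act_tmul, smul_smul, mul_comm]
      rfl

end Act

variable {H A : Type} [Group H] [CommRing A] [HopfAlgebra ℂ A] {ev : A →ₐ[ℂ] (H → ℂ)}
  (h : IsAlgebraicHull H A ev) {V : Type} [AddCommGroup V] [Module ℂ V]

theorem isSeparating (h : IsAlgebraicHull H A ev) : IsSeparating fun x : H => evalAt ev x :=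
  fun _ ha => h.injective ((funext ha).trans (map_zero ev).symm)

/-- An element of `V ⊗ A` is determined by the `V`-valued function on `H` that it defines. All
identities for coactions below are checked at points of `H` in this way. -/
theorem act_ext (h : IsAlgebraicHull H A ev) {s t : V ⊗[ℂ] A}
    (hst : ∀ x : H, act ev x s = act ev x t) : s = t :=
  h.isSeparating.ext_evalRight hst

theorem evalRight_comul (h : IsAlgebraicHull H A ev) (x y : H) (t : V ⊗[ℂ] A) :
    evalRight V (tensorFunctional (evalAt ev x) (evalAt ev y))
      ((Coalgebra.comul (R := ℂ) (A := A)).lTensor V t) = act ev (x * y) t := by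
  induction t with
  | zero => simp
  | add s t hs ht => simp only [map_add, hs, ht]
  | tmul v a =>
    rw [LinearMap.lTensor_tmul, evalRight_tmul, act_tmul, ← h.comul]
    rfl

theorem rid_counit (h : IsAlgebraicHull H A ev) (t : V ⊗[ℂ] A) :
    TensorProduct.rid ℂ V ((Coalgebra.counit (R := ℂ) (A := A)).lTensor V t) = act ev 1 t := by
  induction t with
  | zero => simp
  | add s t hs ht => simp only [map_add, hs, ht]
  | tmul v a => rw [LinearMap.lTensor_tmul, TensorProduct.rid_tmul, h.counit, act_tmul]

/-- The coordinates of `x ↦ ρ x v` are matrix coefficients, hence representative, and so are given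
by elements of `A`. -/
theorem exists_coact (h : IsAlgebraicHull H A ev) [Module.Finite ℂ V] (ρ : Representation ℂ H V)
    (v : V) : ∃ t : V ⊗[ℂ] A, ∀ x, act ev x t = ρ x v := by
  let b := Module.finBasis ℂ V
  choose a ha using fun i => (h.range _).2 (isRepresentative_coeff ρ (b.coord i) v)
  refine ⟨∑ i, b i ⊗ₜ a i, fun x => ?_⟩
  rw [map_sum]
  conv_rhs => rw [← b.sum_repr (ρ x v)]
  refine Finset.sum_congr rfl fun i _ => ?_
  rw [act_tmul, ha]
  rfl

/-- The coaction corresponding to a representation. -/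
def coact [Module.Finite ℂ V] (ρ : Representation ℂ H V) : V →ₗ[ℂ] V ⊗[ℂ] A where
  toFun v := (h.exists_coact ρ v).choose
  map_add' v w := h.act_ext fun x => by
    rw [map_add, (h.exists_coact ρ _).choose_spec, (h.exists_coact ρ _).choose_spec,
      (h.exists_coact ρ _).choose_spec, map_add]
  map_smul' c v := h.act_ext fun x => by
    rw [map_smul, (h.exists_coact ρ _).choose_spec, (h.exists_coact ρ _).choose_spec, map_smul,
      RingHom.id_apply]

theorem act_coact [Module.Finite ℂ V] (ρ : Representation ℂ H V) (x : H) (v : V) :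
    act ev x (h.coact ρ v) = ρ x v :=
  (h.exists_coact ρ v).choose_spec x

theorem act_mulTensor_coact {W : Type} [AddCommGroup W] [Module ℂ W] [Module.Finite ℂ V]
    [Module.Finite ℂ W] (ρ : Representation ℂ H V) (ρ' : Representation ℂ H W) (x : H)
    (t : V ⊗[ℂ] W) :
    act ev x (mulTensor A V W (TensorProduct.map (h.coact ρ) (h.coact ρ') t)) =
      TensorProduct.map (ρ x) (ρ' x) t := by
  induction t with
  | zero => simp
  | add s t hs ht => simp only [map_add, hs, ht]
  | tmul v w => rw [TensorProduct.map_tmul, act_mulTensor, act_coact, act_coact, map_tmul]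

/-- The comodule corresponding to a representation. -/
def toComod [Module.Finite ℂ V] (ρ : Representation ℂ H V) : FdComod A where
  carrier := V
  coact := h.coact ρ
  coassoc v := (h.isSeparating.tensorFunctional h.isSeparating).ext_evalRight fun i => by
    rw [evalRight_assoc, h.evalRight_comul, act_rTensor, act_coact, act_coact, act_coact, map_mul]
    rfl
  counit v := (TensorProduct.rid ℂ V).injective (by
    rw [h.rid_counit, act_coact, map_one, TensorProduct.rid_tmul, one_smul]
    rfl)

theorem act_coact_fdRep (V : FDRep ℂ H) (x : H) (v : V) :
    act ev x ((h.toComod V.ρ).coact v) = V.ρ x v :=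
  h.act_coact V.ρ x v

/-- The representation corresponding to a comodule. -/
def toRep (V : FdComod A) : Representation ℂ H V where
  toFun x := act ev x ∘ₗ V.coact
  map_one' := LinearMap.ext fun v => by
    change act ev 1 (V.coact v) = v
    rw [← h.rid_counit, V.counit, TensorProduct.rid_tmul, one_smul]
  map_mul' x y := LinearMap.ext fun v => by
    change act ev (x * y) (V.coact v) = act ev x (V.coact (act ev y (V.coact v)))
    rw [← h.evalRight_comul, ← V.coassoc, evalRight_assoc, act_rTensor]

/-- The functor from representations of `H` to representations of its algebraic hull. -/
def comodFunctor : FDRep ℂ H ⥤ FdComod A where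
  obj V := h.toComod V.ρ
  map {V W} f :=
    { lin := f.hom.hom.hom
      map_coact := fun v => h.act_ext fun x => by
        refine (h.act_coact_fdRep W x _).trans ?_
        refine Eq.trans ?_ (act_rTensor _ _ _).symm
        refine Eq.trans ?_ (congrArg f.hom.hom.hom (h.act_coact_fdRep V x v)).symm
        exact (congrArg (fun f => f.hom.hom v) (f.comm x)).symm }
  map_id _ := rfl
  map_comp _ _ := rfl

instance : h.comodFunctor.Faithful where
  map_injective hfg := Action.Hom.ext (InducedCategory.hom_ext (ModuleCat.hom_ext
    (congrArg FdComod.Hom.lin hfg)))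

/-- Evaluating the comodule identity at a point `x` gives commutation with `x`. -/
instance : h.comodFunctor.Full where
  map_surjective {V W} f := ⟨
    { hom := InducedCategory.homMk (ModuleCat.ofHom (FdComod.Hom.lin f))
      comm := fun x => InducedCategory.hom_ext (ModuleCat.hom_ext (LinearMap.ext fun v => by
        have h1 := congrArg (act ev x) (f.map_coact v)
        have h2 := (h.act_coact_fdRep W x _).symm.trans (h1.trans (act_rTensor _ _ _))
        exact (h2.trans (congrArg (FdComod.Hom.lin f) (h.act_coact_fdRep V x v))).symm)) }, rfl⟩

instance : h.comodFunctor.EssSurj where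
  mem_essImage V := ⟨FDRep.of (h.toRep V), ⟨FdComod.isoMk (V := h.comodFunctor.obj _)
    (LinearEquiv.refl ℂ V) fun v => h.act_ext fun x => by
      refine Eq.trans ?_ (act_rTensor _ _ _).symm
      exact (h.act_coact (h.toRep V) x v).symm⟩⟩

instance : h.comodFunctor.IsEquivalence where

/-- A morphism to the comodule corresponding to a representation. -/
def homToComod {V : FdComod A} (W : FDRep ℂ H) (f : V →ₗ[ℂ] W)
    (hf : ∀ x v, W.ρ x (f v) = f (act ev x (V.coact v))) : V ⟶ h.comodFunctor.obj W where
  lin := f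
  map_coact v := h.act_ext fun x =>
    (h.act_coact_fdRep W x (f v)).trans ((hf x v).trans (act_rTensor f x _).symm)

/-- Representations of `H` are representations of its algebraic hull. -/
theorem tensorEquivalentOver (h : IsAlgebraicHull H A ev) :
    TensorEquivalentOver (forgetRep H) (FdComod.forgetComod A) := by
  let _ := forgetRepBraided H
  let _ := forgetComodBraided A
  -- Both structure maps are identities on the underlying spaces. It remains to see that the trivial
  -- and the tensor product coactions induce the trivial and the tensor product representations.
  refine .of_lift h.comodFunctor (Iso.refl _) ⟨?_, ?_⟩ fun V W => ⟨?_, ?_⟩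
  · refine h.homToComod (V := FdComod.unit) (𝟙_ (FDRep ℂ H)) (LinearMap.id : ℂ →ₗ[ℂ] ℂ)
      fun x c => ?_
    refine Eq.trans ?_ (act_tmul x (c : ℂ) (1 : A)).symm
    rw [map_one]
    exact (one_smul ℂ _).symm
  · rfl
  · refine h.homToComod (V := FdComod.tensor (h.toComod V.ρ) (h.toComod W.ρ))
      (MonoidalCategory.tensorObj V W) (LinearMap.id : V ⊗[ℂ] W →ₗ[ℂ] V ⊗[ℂ] W) fun x t => ?_
    exact (h.act_mulTensor_coact V.ρ W.ρ x t).symm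
  · ext1
    exact TensorProduct.ext' fun x y => rfl

end IsAlgebraicHull

end

end EquivariantRH

end

/-! ### The main theorem -/

theorem theorem19 (θ : ℝ) (hθ : Irrational θ) (τ : ℂ) (hτ : τ ≠ 0) (z : ℂˣ) :
    ∃ _ : (EquivariantRH.fibreFunctor θ τ z).Braided,
      EquivariantRH.IsCanonicalTensorStructure θ τ z ∧
      EquivariantRH.IsNeutralTannakian ℂ (EquivariantRH.fibreFunctor θ τ z) ∧
      EquivariantRH.TensorEquivalentOver (EquivariantRH.fibreFunctor θ τ z)
        (EquivariantRH.forgetRep (Multiplicative (EquivariantRH.ZPlusThetaZ θ))) ∧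
      Nonempty (EquivariantRH.ZPlusThetaZ θ ≃+ ℤ × ℤ) ∧
      EquivariantRH.TensorEquivalentOver (EquivariantRH.fibreFunctor θ τ z)
        (EquivariantRH.forgetRep (Multiplicative (ℤ × ℤ))) ∧
      ∃ (A : Type) (_ : CommRing A) (_ : HopfAlgebra ℂ A)
        (ev : A →ₐ[ℂ] (Multiplicative (ℤ × ℤ) → ℂ)),
        EquivariantRH.IsAlgebraicHull (Multiplicative (ℤ × ℤ)) A ev ∧
        EquivariantRH.TensorEquivalentOver (EquivariantRH.fibreFunctor θ τ z)
          (EquivariantRH.FdComod.forgetComod A) := by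
  open EquivariantRH in
  have hτz := HolGerm.hasTrivialConstants hτ z
  let hbr : (fibreFunctor θ τ z).Braided := EqDiffMod.horizontalBraided (eulerDerivation τ)
    (thetaAction θ) (eulerDerivationGerm τ (z : ℂ)) (objBqTau θ τ)
    fun _ hM => hM.hasHorizontalBasis_holGerm hτ z
  have hcover := tensorEquivalentOver_coverGroup (θ := θ) hτ z
  have hZ := hcover.trans (.of_mulEquiv (coverGroupEquiv hθ.ne_zero).symm)
  obtain ⟨A, _, _, ev, hA⟩ := exists_isAlgebraicHull (Multiplicative (ℤ × ℤ))
  -- The tensor structure is canonical by construction: the product of two germs is defined as the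
  -- preimage of their tensor product under the base change isomorphism.
  refine ⟨hbr, fun M N x y => LinearEquiv.apply_symm_apply _ _, ?_,
    hZ.trans (.of_mulEquiv (AddEquiv.toMultiplicative (zPlusThetaZEquiv hθ))),
    ⟨zPlusThetaZEquiv hθ⟩, hZ, A, _, _, ev, hA, hZ.trans hA.tensorEquivalentOver⟩
  have : (fibreFunctor θ τ z).Additive :=
    inferInstanceAs ((objBqTau θ τ).ι ⋙ EqDiffMod.horizontal _).Additive
  have : (fibreFunctor θ τ z).Linear ℂ :=
    inferInstanceAs (((objBqTau θ τ).ι ⋙ EqDiffMod.horizontal _).Linear ℂ)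
  -- Any of the equivalences with representations of a group would serve here; the one for `ℤ × θℤ`
  -- is the one obtained directly.
  exact .of_tensorEquivalentOver _ hcover
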